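/- Let $k$ be a field of characteristic zero, let $n\ge 1$, and let $p_{ij}\in k^\times$ for $1\le i<j\le n$. Let $A=k_{p_{ij}}[x_1,\dots,x_n]$ be the skew polynomial ring, i.e. the $k$-algebra generated by $x_1,\dots,x_n$ subject to the relations $x_jx_i=p_{ij}x_ix_j$ for $i<j$, graded by $\deg x_i=1$, with homogeneous components $A_d$. Let $\operatorname{Aut}(A)$ be the group of graded $k$-algebra automorphisms of $A$. An element $g\in\operatorname{Aut}(A)$ is called a quasi-reflection if $$\operatorname{Tr}_A(g,t):=\sum_{d\ge 0}\operatorname{tr}(g|_{A_d})\,t^d=\frac{1}{(1-t)^{n-1}(1-\lambda t)}\quad\text{in } k[[t]]\text{ for some }\lambda\in k,\ \lambda\ne 1 .$$ For integers $N\ge 2$ and $\alpha,\beta\ge 1$ with $\alpha\mid\beta$ and $2\mid\beta$, let $M(N,\alpha,\beta)$ be the group of automorphisms of $k_{-1}[x_1,\dots,x_N]$ (the skew polynomial ring with all $p_{ij}=-1$, $i<j$) generated by the automorphisms $\theta_{s,\lambda}$ with $\lambda\in k^\times$, $\lambda^\alpha=1$, and $\tau_{s,t,\lambda}$ with $s\ne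 t$, $\lambda\in k^\times$, $\lambda^\beta=1$. Here $\theta_{s,\lambda}$ sends $x_s\mapsto\lambda x_s$ and fixes every other $x_i$, and $\tau_{s,t,\lambda}$ sends $x_s\mapsto\lambda x_t$, $x_t\mapsto-\lambda^{-1}x_s$ and fixes every other $x_i$. A classical reflection group is a finite subgroup of $GL_m(k)$, for some $m\ge 0$, generated by (pseudo-)reflections, i.e. by linear maps $g$ of $k^m$ for which there are a basis $y_1,\dots,y_m$ and a scalar $c\ne 1$ with $g(y_j)=y_j$ for $j<m$ and $g(y_m)=c\,y_m$. If $G$ is a finite subgroup of $\operatorname{Aut}(A)$ generated by quasi-reflections of $A$, then, as an abstract group, $G$ is isomorphic to a finite direct product of classical reflection groups and groups of the form $M(N,\alpha,\beta)$ (with varying $N,\alpha,\beta$ as above). -/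

import Mathlib

/-! ### Skew polynomial rings -/

/-- The defining relations `x_j x_i = p_{ij} x_i x_j`, for `i < j`; the entries `p i j` with
`i ≥ j` are not used. -/
inductive SkewPoly.Rel {k : Type*} [Field k] {n : ℕ} (p : Fin n → Fin n → kˣ) :
    FreeAlgebra k (Fin n) → FreeAlgebra k (Fin n) → Prop
  | comm (i j : Fin n) (h : i < j) :
      SkewPoly.Rel p (FreeAlgebra.ι k j * FreeAlgebra.ι k i)
        ((p i j : k) • (FreeAlgebra.ι k i * FreeAlgebra.ι k j))

/-- The skew polynomial ring `k_{p_ij}[x_1, …, x_n]`, by generators and relations. -/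
def SkewPoly {k : Type*} [Field k] {n : ℕ} (p : Fin n → Fin n → kˣ) : Type _ :=
  RingQuot (SkewPoly.Rel p)

namespace SkewPoly

variable {k : Type*} [Field k] {n : ℕ}

noncomputable instance (p : Fin n → Fin n → kˣ) : Semiring (SkewPoly p) :=
  inferInstanceAs (Semiring (RingQuot (Rel p)))

noncomputable instance (p : Fin n → Fin n → kˣ) : Algebra k (SkewPoly p) :=
  inferInstanceAs (Algebra k (RingQuot (Rel p)))

noncomputable instance (p : Fin n → Fin n → kˣ) : Ring (SkewPoly p) :=
  Algebra.semiringToRing k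

/-- The quotient map from the free algebra. -/
noncomputable def proj (p : Fin n → Fin n → kˣ) : FreeAlgebra k (Fin n) →ₐ[k] SkewPoly p :=
  RingQuot.mkAlgHom k (Rel p)

/-- The generator `x_i`. -/
noncomputable def x (p : Fin n → Fin n → kˣ) (i : Fin n) : SkewPoly p :=
  proj p (FreeAlgebra.ι k i)

/-- The homogeneous component `A_d`: the linear span of the products of `d` generators,
written as the `d`-th power of `A_1 = k x_1 + … + k x_n`. -/
noncomputable def component (p : Fin n → Fin n → kˣ) (d : ℕ) : Submodule k (SkewPoly p) :=
  Submodule.span k (Set.range (x p)) ^ d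

/-- The group `Aut(A)` of graded algebra automorphisms of `A`. -/
noncomputable def gradedAut (p : Fin n → Fin n → kˣ) : Subgroup (SkewPoly p ≃ₐ[k] SkewPoly p) where
  carrier := {g | ∀ d, (component p d).map g.toLinearMap = component p d}
  one_mem' := fun d => by
    ext a
    simp [Submodule.mem_map]
  mul_mem' := fun {g h} hg hh d => by
    have e : (g * h).toLinearMap = g.toLinearMap ∘ₗ h.toLinearMap := rfl
    rw [e, Submodule.map_comp, hh d, hg d]
  inv_mem' := fun {g} hg d => by
    have e : (g⁻¹).toLinearMap ∘ₗ g.toLinearMap = LinearMap.id := by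
      ext a
      exact g.symm_apply_apply a
    conv_lhs => rw [← hg d]
    rw [← Submodule.map_comp, e, Submodule.map_id]

/-- The restriction `g|_{A_d}`. -/
noncomputable def restrictComponent {p : Fin n → Fin n → kˣ} (g : gradedAut p) (d : ℕ) :
    component p d →ₗ[k] component p d :=
  g.1.toLinearMap.restrict fun a ha => by
    rw [← g.2 d]
    exact Submodule.mem_map_of_mem ha

/-- The trace series `Tr_A(g,t) = ∑_d tr(g|_{A_d}) t^d`. -/
noncomputable def traceSeries {p : Fin n → Fin n → kˣ} (g : gradedAut p) : PowerSeries k :=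
  PowerSeries.mk fun d => LinearMap.trace k (component p d) (restrictComponent g d)

/-- `g` is a quasi-reflection: `Tr_A(g,t) = 1 / ((1-t)^{n-1} (1-ct))` for some scalar `c ≠ 1`. -/
def IsQuasiReflection {p : Fin n → Fin n → kˣ} (g : gradedAut p) : Prop :=
  ∃ c : k, c ≠ 1 ∧
    traceSeries g * ((1 - PowerSeries.X) ^ (n - 1) * (1 - PowerSeries.C c * PowerSeries.X)) = 1

theorem x_mul_x (p : Fin n → Fin n → kˣ) {i j : Fin n} (h : i < j) :
    x p j * x p i = (p i j : k) • (x p i * x p j) := by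
  have h' : proj p _ = proj p _ := RingQuot.mkAlgHom_rel k (Rel.comm (p := p) i j h)
  simpa [x, map_mul] using h'

/-- Two algebra maps that agree on the generators are equal. -/
theorem algHom_ext {p : Fin n → Fin n → kˣ} {B : Type*} [Semiring B] [Algebra k B]
    {f g : SkewPoly p →ₐ[k] B} (h : ∀ i, f (x p i) = g (x p i)) : f = g := by
  refine RingQuot.ringQuot_ext' k f g ?_
  apply FreeAlgebra.hom_ext
  funext i
  exact h i

/-- The algebra map sending `x_i` to `y_i`, where the `y_i` satisfy the defining relations. -/
noncomputable def lift (p : Fin n → Fin n → kˣ) {B : Type*} [Semiring B] [Algebra k B]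
    (y : Fin n → B) (hy : ∀ i j, i < j → y j * y i = (p i j : k) • (y i * y j)) :
    SkewPoly p →ₐ[k] B :=
  RingQuot.liftAlgHom k ⟨FreeAlgebra.lift k y, by
    rintro _ _ ⟨i, j, h⟩
    simpa using hy i j h⟩

theorem lift_x (p : Fin n → Fin n → kˣ) {B : Type*} [Semiring B] [Algebra k B]
    (y : Fin n → B) (hy : ∀ i j, i < j → y j * y i = (p i j : k) • (y i * y j)) (i : Fin n) :
    lift p y hy (x p i) = y i := by
  have h := RingQuot.liftAlgHom_mkAlgHom_apply k (FreeAlgebra.lift k y) (s := Rel p) (by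
    rintro _ _ ⟨i, j, h⟩
    simpa using hy i j h) (FreeAlgebra.ι k i)
  rw [FreeAlgebra.lift_ι_apply] at h
  exact h

/-! ### The groups `M(n, α, β)` -/

/-- The parameters of `k_{-1}[x_1, …, x_n]`: `p_ij = -1` for all `i < j`. -/
def minusOne (k : Type*) [Field k] (n : ℕ) : Fin n → Fin n → kˣ := fun _ _ => -1

theorem anticomm {i j : Fin n} (h : i ≠ j) :
    x (minusOne k n) j * x (minusOne k n) i = -(x (minusOne k n) i * x (minusOne k n) j) := by
  rcases lt_or_gt_of_ne h with h | h
  · simpa [minusOne] using x_mul_x (minusOne k n) h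
  · have := x_mul_x (minusOne k n) h
    simp only [minusOne, Units.val_neg, Units.val_one, neg_smul, one_smul] at this
    rw [this, neg_neg]

/-- The endomorphism of `k_{-1}[x_1, …, x_n]` with `x_s ↦ c x_s` and `x_i ↦ x_i` for `i ≠ s`. -/
noncomputable def thetaHom (s : Fin n) (c : kˣ) :
    SkewPoly (minusOne k n) →ₐ[k] SkewPoly (minusOne k n) :=
  lift (minusOne k n)
    (fun i => if i = s then (c : k) • x (minusOne k n) s else x (minusOne k n) i)
    (by
      intro i j h
      have hij := anticomm (k := k) h.ne
      have e : (minusOne k n i j : k) = -1 := by simp [minusOne]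
      rw [e]
      split_ifs <;> subst_vars <;> simp_all)

theorem thetaHom_x (s : Fin n) (c : kˣ) (i : Fin n) :
    thetaHom s c (x (minusOne k n) i) =
      if i = s then (c : k) • x (minusOne k n) s else x (minusOne k n) i :=
  lift_x _ _ _ i

theorem thetaHom_comp (s : Fin n) (c d : kˣ) (h : c * d = 1) :
    (thetaHom s c).comp (thetaHom (k := k) s d) = AlgHom.id k _ := by
  have h' : (d : k) * c = 1 := by rw [mul_comm, ← Units.val_mul, h, Units.val_one]
  apply algHom_ext
  intro i
  by_cases hi : i = s <;> simp [thetaHom_x, hi, smul_smul, h']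

/-- The standard reflection `θ_{s,c}` of `k_{-1}[x_1, …, x_n]`: `x_s ↦ c x_s`, and
`x_i ↦ x_i` for `i ≠ s`. -/
noncomputable def theta (s : Fin n) (c : kˣ) :
    SkewPoly (minusOne k n) ≃ₐ[k] SkewPoly (minusOne k n) :=
  AlgEquiv.ofAlgHom (thetaHom s c) (thetaHom s c⁻¹)
    (thetaHom_comp s c c⁻¹ (by simp)) (thetaHom_comp s c⁻¹ c (by simp))

/-- The endomorphism of `k_{-1}[x_1, …, x_n]` with `x_s ↦ c x_t`, `x_t ↦ -c⁻¹ x_s` and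
`x_i ↦ x_i` for `i ≠ s, t`. -/
noncomputable def tauHom (s t : Fin n) (hst : s ≠ t) (c : kˣ) :
    SkewPoly (minusOne k n) →ₐ[k] SkewPoly (minusOne k n) :=
  lift (minusOne k n)
    (fun i => if i = s then (c : k) • x (minusOne k n) t
      else if i = t then -((c⁻¹ : kˣ) : k) • x (minusOne k n) s else x (minusOne k n) i)
    (by
      intro i j h
      have e : ∀ a b, (minusOne k n a b : k) = -1 := fun _ _ => by simp [minusOne]
      have key : ∀ a b : Fin n, a ≠ b → ∀ u v : k,
          (u • x (minusOne k n) b) * (v • x (minusOne k n) a) =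
            (-1 : k) • ((v • x (minusOne k n) a) * (u • x (minusOne k n) b)) := by
        intro a b hab u v
        simp only [smul_mul_smul_comm, anticomm hab, neg_smul, one_smul, smul_neg, mul_comm u v]
      by_cases his : i = s
      · have hjs : j ≠ s := fun q => h.ne (his.trans q.symm)
        by_cases hjt : j = t
        · simpa only [his, hjt, hst.symm, e, if_true, if_false] using key t s hst.symm _ _
        · simpa only [his, hjs, hjt, e, if_true, if_false, one_smul] using
            key t j (Ne.symm hjt) 1 (c : k)
      by_cases hit : i = t
      · have hjt : j ≠ t := fun q => h.ne (hit.trans q.symm)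
        by_cases hjs : j = s
        · simpa only [hit, hjs, hst.symm, e, if_true, if_false] using key s t hst _ _
        · simpa only [hit, hst.symm, hjs, hjt, e, if_true, if_false, one_smul] using
            key s j (Ne.symm hjs) 1 (-((c⁻¹ : kˣ) : k))
      by_cases hjs : j = s
      · simpa only [his, hit, hjs, e, if_true, if_false, one_smul] using key i t hit (c : k) 1
      by_cases hjt : j = t
      · simpa only [his, hit, hst.symm, hjt, e, if_true, if_false, one_smul] using
          key i s his (-((c⁻¹ : kˣ) : k)) 1
      · simpa only [his, hit, hjs, hjt, e, if_true, if_false, one_smul] using key i j h.ne 1 1)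

theorem tauHom_x (s t : Fin n) (hst : s ≠ t) (c : kˣ) (i : Fin n) :
    tauHom s t hst c (x (minusOne k n) i) =
      if i = s then (c : k) • x (minusOne k n) t
      else if i = t then -((c⁻¹ : kˣ) : k) • x (minusOne k n) s else x (minusOne k n) i :=
  lift_x _ _ _ i

theorem tauHom_comp (s t : Fin n) (hst : s ≠ t) (c d : kˣ) (h : d = -c) :
    (tauHom s t hst c).comp (tauHom (k := k) s t hst d) = AlgHom.id k _ := by
  subst h
  apply algHom_ext
  intro i
  by_cases hi : i = s
  · simp [tauHom_x, hi, hst.symm, smul_smul]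
  · by_cases ht : i = t
    · simp [tauHom_x, ht, hst.symm, smul_smul]
    · simp [tauHom_x, hi, ht]

/-- The standard mystic reflection `τ_{s,t,c}` of `k_{-1}[x_1, …, x_n]`: `x_s ↦ c x_t`,
`x_t ↦ -c⁻¹ x_s`, and `x_i ↦ x_i` for `i ≠ s, t`. -/
noncomputable def tau (s t : Fin n) (hst : s ≠ t) (c : kˣ) :
    SkewPoly (minusOne k n) ≃ₐ[k] SkewPoly (minusOne k n) :=
  AlgEquiv.ofAlgHom (tauHom s t hst c) (tauHom s t hst (-c))
    (tauHom_comp s t hst c (-c) rfl) (tauHom_comp s t hst (-c) c (neg_neg c).symm)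

/-- The group `M(n, α, β)`: the group of automorphisms of `k_{-1}[x_1, …, x_n]` generated by the
`θ_{i,c}` with `c ^ α = 1` and the `τ_{i,j,c}` with `c ^ β = 1`. -/
noncomputable def mysticGroup (k : Type*) [Field k] (n α β : ℕ) :
    Subgroup (SkewPoly (minusOne k n) ≃ₐ[k] SkewPoly (minusOne k n)) :=
  Subgroup.closure
    ({g | ∃ (i : Fin n) (c : kˣ), c ^ α = 1 ∧ g = theta i c} ∪
      {g | ∃ (i j : Fin n) (h : i ≠ j) (c : kˣ), c ^ β = 1 ∧ g = tau i j h c})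

end SkewPoly

/-! ### Classical reflection groups -/

/-- `g` is a (pseudo-)reflection of `k^m`: in some basis it fixes all basis vectors but one, and
multiplies that one by a scalar `c ≠ 1`. -/
def IsClassicalReflection {k : Type*} [Field k] {m : ℕ}
    (g : (Fin m → k) ≃ₗ[k] (Fin m → k)) : Prop :=
  ∃ (y : Module.Basis (Fin m) k (Fin m → k)) (i : Fin m) (c : k),
    c ≠ 1 ∧ g (y i) = c • y i ∧ ∀ j, j ≠ i → g (y j) = y j

/-- A classical reflection group: a finite subgroup of `GL_m(k)` generated by reflections. -/
def IsClassicalReflectionGroup {k : Type*} [Field k] {m : ℕ}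
    (R : Subgroup ((Fin m → k) ≃ₗ[k] (Fin m → k))) : Prop :=
  Finite R ∧ Subgroup.closure {g | g ∈ R ∧ IsClassicalReflection g} = R

/-!
Let `q i j` be the scalars with `x_j x_i = q i j • x_i x_j`. A graded automorphism is determined by
its action on `k^n`, the space of linear forms. Call the indices with equal rows of `q` a block. The
image of a variable is a normal element of degree one, and comparing coefficients in degree two
shows that the support of such an element lies in one block. Hence a graded automorphism permutes
the blocks, and `q` is constant along its nonzero entries (`SkewPoly.commParam_eq_of_act_ne_zero`,
`SkewPoly.exists_blockPerm`).

Over the algebraic closure, an automorphism `g` of finite order is therefore monomial in variables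
`y_l` adapted to the blocks, `g y_l = c_l y_{σ l}`, where `σ` fixes every index whose block it fixes
(`SkewPoly.exists_monomialization`). Its trace series is then a sum over the `σ`-invariant monomials
and equals `∏ 1 / (1 - ζ_o t ^ r_o)` over the orbits `o` of `σ` (`invariant_genFun_mul`). If `g` is
a quasi-reflection, comparing roots with `(1 - t) ^ (n - 1) (1 - λ t)` leaves two cases
(`SkewPoly.Monomialization.cases_of_isQuasiReflection`): `σ` is the identity and at most one `c_l`
is not `1`, so that `g` is a reflection of the variables of one block; or `σ` interchanges two
variables whose product is fixed by `g`, which forces these to be, up to scalars, two of the `x_i` that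
anticommute, and `g` to be a mystic reflection `τ_{s,t,c}` (`SkewPoly.IsQuasiReflection.cases`).

For the group `Γ` generated by such elements, join two indices if they are in the same block or are
moved by a common mystic reflection in `Γ`. This is an equivalence relation, every generator acts on
one class only, and so `Γ` is the product of its parts on the classes
(`nonempty_closure_mulEquiv_pi`). A class without mystic reflections is a block, and gives a group
generated by reflections (`exists_isClassicalReflectionGroup`). In a class with mystic reflections
all blocks are singletons, and after rescaling the coordinates all `τ_{s,t,1}` belong to the group;
the scalars of its reflections `θ_{s,c}` and `τ_{s,t,c}` then form two groups of roots of unity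
independent of the indices, of orders `α` and `β`, so that the group is `M(N, α, β)`
(`exists_mulEquiv_mysticLin`).
-/

/-! ### Monomials in `q`-commuting elements, and the monomial basis -/

section Monomials

variable {K B ι : Type*} [Field K] [Ring B] [Algebra K B]

/-- The product of the elements `y i` over the multiset `M`, in an arbitrary but fixed order. When
the `y i` commute up to nonzero scalars, another order changes it by a nonzero scalar only. -/
noncomputable def monomialProd (y : ι → B) (M : Multiset ι) : B := (M.toList.map y).prod

/-- The elements `y i` commute with each other up to nonzero scalars. -/
def QCommute (K : Type*) [Field K] [Algebra K B] (y : ι → B) : Prop :=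
  ∀ i j, ∃ c : K, c ≠ 0 ∧ y j * y i = c • (y i * y j)

theorem QCommute.prod_perm {y : ι → B} (hy : QCommute K y) {l₁ l₂ : List ι} (h : l₁.Perm l₂) :
    ∃ c : K, c ≠ 0 ∧ (l₁.map y).prod = c • (l₂.map y).prod := by
  induction h with
  | nil => exact ⟨1, one_ne_zero, by simp⟩
  | cons i _ ih =>
    obtain ⟨c, hc, e⟩ := ih
    exact ⟨c, hc, by simp [e]⟩
  | swap i j l =>
    obtain ⟨c, hc, e⟩ := hy i j
    exact ⟨c, hc, by simp [← mul_assoc, e]⟩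
  | trans _ _ ih₁ ih₂ =>
    obtain ⟨c, hc, e⟩ := ih₁
    obtain ⟨d, hd, e'⟩ := ih₂
    exact ⟨c * d, mul_ne_zero hc hd, by rw [e, e', smul_smul]⟩

theorem QCommute.prod_eq_smul_monomialProd {y : ι → B} (hy : QCommute K y) (l : List ι) :
    ∃ c : K, c ≠ 0 ∧ (l.map y).prod = c • monomialProd y (l : Multiset ι) :=
  hy.prod_perm (Multiset.coe_eq_coe.1 (Multiset.coe_toList _).symm)

theorem monomialProd_zero (y : ι → B) : monomialProd y 0 = 1 := by simp [monomialProd]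

theorem QCommute.monomialProd_add {y : ι → B} (hy : QCommute K y) (M L : Multiset ι) :
    ∃ c : K, c ≠ 0 ∧ monomialProd y M * monomialProd y L = c • monomialProd y (M + L) := by
  obtain ⟨c, hc, e⟩ := hy.prod_eq_smul_monomialProd (M.toList ++ L.toList)
  refine ⟨c, hc, ?_⟩
  rw [← Multiset.coe_add, Multiset.coe_toList, Multiset.coe_toList] at e
  rw [← e, List.map_append, List.prod_append, monomialProd, monomialProd]

open Pointwise in
/-- The monomials of degree `d` span the `d`-th power of the span of the `y i`. -/
theorem QCommute.span_pow_eq {y : ι → B} (hy : QCommute K y) (d : ℕ) :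
    Submodule.span K (Set.range y) ^ d =
      Submodule.span K (Set.range fun M : Sym ι d => monomialProd y (M : Multiset ι)) := by
  rw [Submodule.span_pow]
  apply le_antisymm
  · rw [Submodule.span_le]
    intro b hb
    obtain ⟨f, rfl⟩ := Set.mem_pow.1 hb
    choose g hg using fun i => (f i).2
    have e : (fun i => ((f i : Set.range y) : B)) = y ∘ g := funext fun i => (hg i).symm
    obtain ⟨c, hc, e'⟩ := hy.prod_eq_smul_monomialProd (List.ofFn g)
    rw [e, ← List.map_ofFn, e']
    exact Submodule.smul_mem _ _
      (Submodule.subset_span ⟨⟨(List.ofFn g : Multiset ι), by simp⟩, rfl⟩)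
  · rw [Submodule.span_le]
    rintro _ ⟨M, rfl⟩
    apply Submodule.subset_span
    have : ∀ l : List ι, (l.map y).prod ∈ Set.range y ^ l.length := by
      intro l
      induction l with
      | nil => simp
      | cons i l ih =>
        rw [List.map_cons, List.prod_cons, List.length_cons, pow_succ']
        exact Set.mul_mem_mul ⟨i, rfl⟩ ih
    have h := this (M : Multiset ι).toList
    rwa [Multiset.length_toList, Sym.card_coe] at h

end Monomials

namespace SkewPoly

variable {k : Type*} [Field k] {n : ℕ}

/-- The scalars `q i j`, for all `i` and `j`, with `x_j x_i = q i j • x_i x_j`. -/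
noncomputable def commParam (p : Fin n → Fin n → kˣ) (i j : Fin n) : kˣ :=
  if i < j then p i j else if j < i then (p j i)⁻¹ else 1

theorem commParam_of_lt (p : Fin n → Fin n → kˣ) {i j : Fin n} (h : i < j) :
    commParam p i j = p i j := by simp [commParam, h]

@[simp] theorem commParam_self (p : Fin n → Fin n → kˣ) (i : Fin n) : commParam p i i = 1 := by
  simp [commParam]

theorem commParam_symm (p : Fin n → Fin n → kˣ) (i j : Fin n) :
    commParam p j i = (commParam p i j)⁻¹ := by
  rcases lt_trichotomy i j with h | rfl | h
  · simp [commParam, h, h.not_gt]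
  · simp
  · simp [commParam, h, h.not_gt]

/-- The defining relations, for all pairs of indices in place of `i < j`. -/
theorem x_mul_x' (p : Fin n → Fin n → kˣ) (i j : Fin n) :
    x p j * x p i = (commParam p i j : k) • (x p i * x p j) := by
  rcases lt_trichotomy i j with h | rfl | h
  · rw [commParam_of_lt p h, x_mul_x p h]
  · simp
  · rw [commParam_symm, commParam_of_lt p h, x_mul_x p h, smul_smul]
    simp

theorem qCommute_x (p : Fin n → Fin n → kˣ) : QCommute k (x p) := fun i j =>
  ⟨_, (commParam p i j).ne_zero, x_mul_x' p i j⟩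

/-- The scalar by which left multiplication by `x_i` multiplies the monomial basis vector of `M`,
in the normal form with increasing indices. -/
noncomputable def modelScalar (p : Fin n → Fin n → kˣ) (i : Fin n) (M : Multiset (Fin n)) : k :=
  (M.map fun j => if j < i then (p j i : k) else 1).prod

theorem modelScalar_ne_zero (p : Fin n → Fin n → kˣ) (i : Fin n) (M : Multiset (Fin n)) :
    modelScalar p i M ≠ 0 := by
  rw [modelScalar]
  apply Multiset.prod_ne_zero
  simp only [Multiset.mem_map, not_exists, not_and]
  intro j _
  split_ifs <;> simp

/-- The operator of left multiplication by `x_i` on the vector space with basis the monomials, a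
monomial being given by the multiset of the indices of its variables. -/
noncomputable def modelOp (p : Fin n → Fin n → kˣ) (i : Fin n) :
    Module.End k (Multiset (Fin n) →₀ k) :=
  Finsupp.lsum k fun M => (Finsupp.lsingle (i ::ₘ M)) ∘ₗ (modelScalar p i M • LinearMap.id)

theorem modelOp_single (p : Fin n → Fin n → kˣ) (i : Fin n) (M : Multiset (Fin n)) (c : k) :
    modelOp p i (Finsupp.single M c) = Finsupp.single (i ::ₘ M) (modelScalar p i M * c) := by
  simp [modelOp]

/-- The representation of the skew polynomial ring on the vector space with basis the monomials. -/
noncomputable def model (p : Fin n → Fin n → kˣ) :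
    SkewPoly p →ₐ[k] Module.End k (Multiset (Fin n) →₀ k) :=
  lift p (modelOp p) (by
    intro i j h
    refine Finsupp.lhom_ext fun M c => ?_
    simp only [Module.End.mul_apply, LinearMap.smul_apply, modelOp_single, Finsupp.smul_single]
    rw [Multiset.cons_swap]
    congr 1
    simp only [modelScalar, Multiset.map_cons, Multiset.prod_cons, h, h.not_gt, if_true, if_false,
      smul_eq_mul]
    ring)

theorem model_x (p : Fin n → Fin n → kˣ) (i : Fin n) : model p (x p i) = modelOp p i :=
  lift_x _ _ _ _

/-- A product of variables maps the empty monomial of the model to a nonzero multiple of the basis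
vector of its indices. -/
theorem model_list (p : Fin n → Fin n → kˣ) (l : List (Fin n)) :
    ∃ c : k, c ≠ 0 ∧ model p (l.map (x p)).prod (Finsupp.single 0 1) =
      Finsupp.single (l : Multiset (Fin n)) c := by
  induction l with
  | nil => exact ⟨1, one_ne_zero, by simp⟩
  | cons i l ih =>
    obtain ⟨c, hc, e⟩ := ih
    refine ⟨_, mul_ne_zero (modelScalar_ne_zero p i l) hc, ?_⟩
    rw [List.map_cons, List.prod_cons, map_mul, Module.End.mul_apply, e, model_x, modelOp_single]
    rfl

/-- The monomials are linearly independent: acting on the empty monomial of the model, they give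
nonzero multiples of distinct basis vectors. -/
theorem linearIndependent_monomialProd (p : Fin n → Fin n → kˣ) :
    LinearIndependent k fun M : Multiset (Fin n) => monomialProd (x p) M := by
  let ev : SkewPoly p →ₗ[k] (Multiset (Fin n) →₀ k) :=
    (LinearMap.applyₗ (Finsupp.single 0 1)) ∘ₗ (model p).toLinearMap
  have h : ∀ M : Multiset (Fin n), ∃ c : kˣ,
      ev (monomialProd (x p) M) = c • Finsupp.single M (1 : k) := by
    intro M
    obtain ⟨c, hc, e⟩ := model_list p M.toList
    refine ⟨Units.mk0 c hc, ?_⟩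
    rw [Multiset.coe_toList] at e
    simpa [ev, monomialProd, Units.smul_def] using e
  choose c hc using h
  apply LinearIndependent.of_comp ev
  have : ev ∘ (fun M => monomialProd (x p) M) = c • fun M => Finsupp.single M (1 : k) :=
    funext hc
  rw [this]
  exact (Finsupp.basisSingleOne (R := k)).linearIndependent.units_smul c |> fun h => by
    simpa using h

/-- The monomial basis of the homogeneous component of degree `d`. -/
noncomputable def monomialBasis (p : Fin n → Fin n → kˣ) (d : ℕ) :
    Module.Basis (Sym (Fin n) d) k (component p d) :=
  (Module.Basis.span ((linearIndependent_monomialProd p).comp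
    (fun M : Sym (Fin n) d => (M : Multiset (Fin n))) Sym.coe_injective)).map
    (LinearEquiv.ofEq _ _ ((qCommute_x p).span_pow_eq d).symm)

theorem monomialBasis_apply (p : Fin n → Fin n → kˣ) (d : ℕ) (M : Sym (Fin n) d) :
    (monomialBasis p d M : SkewPoly p) = monomialProd (x p) (M : Multiset (Fin n)) := by
  simp only [monomialBasis, Module.Basis.map_apply, Module.Basis.span_apply,
    Function.comp_apply]
  rfl

theorem component_one (p : Fin n → Fin n → kˣ) :
    component p 1 = Submodule.span k (Set.range (x p)) := by
  rw [component, pow_one]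

theorem linearIndependent_x (p : Fin n → Fin n → kˣ) : LinearIndependent k (x p) := by
  have := (linearIndependent_monomialProd p).comp (fun i : Fin n => ({i} : Multiset (Fin n)))
    (fun i j h => by simpa using h)
  convert this using 1
  funext i
  simp [monomialProd]

end SkewPoly

/-! ### Graded automorphisms as matrices -/

namespace SkewPoly

variable {k : Type*} [Field k] {n : ℕ}

/-- The identification of `k^n` with the linear forms: `v ↦ ∑ i, v i • x_i`. -/
noncomputable def linForm (p : Fin n → Fin n → kˣ) : (Fin n → k) →ₗ[k] SkewPoly p :=
  Fintype.linearCombination k (x p)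

theorem linForm_apply (p : Fin n → Fin n → kˣ) (v : Fin n → k) :
    linForm p v = ∑ i, v i • x p i := Fintype.linearCombination_apply _ _ _

@[simp] theorem linForm_single (p : Fin n → Fin n → kˣ) (i : Fin n) (c : k) :
    linForm p (Pi.single i c) = c • x p i := by
  simp [linForm]

theorem linForm_injective (p : Fin n → Fin n → kˣ) : Function.Injective (linForm p) :=
  (linearIndependent_x p).fintypeLinearCombination_injective

theorem range_linForm (p : Fin n → Fin n → kˣ) : LinearMap.range (linForm p) = component p 1 := by
  rw [component_one, linForm, Fintype.range_linearCombination]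

theorem map_linForm_mem {p : Fin n → Fin n → kˣ} (g : gradedAut p) (v : Fin n → k) :
    g.1 (linForm p v) ∈ LinearMap.range (linForm p) := by
  rw [range_linForm, ← g.2 1, ← range_linForm]
  exact Submodule.mem_map_of_mem ⟨v, rfl⟩

/-- The linear map of `k^n` induced by a graded automorphism on the linear forms. -/
noncomputable def actLin {p : Fin n → Fin n → kˣ} (g : gradedAut p) :
    (Fin n → k) →ₗ[k] (Fin n → k) :=
  (LinearEquiv.ofInjective (linForm p) (linForm_injective p)).symm.toLinearMap ∘ₗ
    (g.1.toLinearMap ∘ₗ linForm p).codRestrict _ (map_linForm_mem g)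

theorem linForm_actLin {p : Fin n → Fin n → kˣ} (g : gradedAut p) (v : Fin n → k) :
    linForm p (actLin g v) = g.1 (linForm p v) := by
  have h := congrArg Subtype.val ((LinearEquiv.ofInjective (linForm p)
    (linForm_injective p)).apply_symm_apply ⟨_, map_linForm_mem g v⟩)
  exact h

/-- The action of the graded automorphisms on `k^n`, identified with the linear forms. -/
noncomputable def act (p : Fin n → Fin n → kˣ) :
    gradedAut p →* ((Fin n → k) ≃ₗ[k] (Fin n → k)) where
  toFun g := LinearEquiv.ofLinearMap (actLin g) (actLin g⁻¹)
    (LinearMap.ext fun v => linForm_injective p (by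
      rw [LinearMap.comp_apply, linForm_actLin, linForm_actLin]
      exact g.1.apply_symm_apply _))
    (LinearMap.ext fun v => linForm_injective p (by
      rw [LinearMap.comp_apply, linForm_actLin, linForm_actLin]
      exact g.1.symm_apply_apply _))
  map_one' := LinearEquiv.ext fun v => linForm_injective p (linForm_actLin 1 v)
  map_mul' g h := LinearEquiv.ext fun v => linForm_injective p (by
    refine (linForm_actLin (g * h) v).trans ?_
    refine Eq.trans ?_ (linForm_actLin g _).symm
    refine Eq.trans ?_ (congrArg g.1 (linForm_actLin h _).symm)
    rfl)

theorem linForm_act {p : Fin n → Fin n → kˣ} (g : gradedAut p) (v : Fin n → k) :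
    linForm p (act p g v) = g.1 (linForm p v) := linForm_actLin g v

theorem gradedAut_x {p : Fin n → Fin n → kˣ} (g : gradedAut p) (i : Fin n) :
    g.1 (x p i) = linForm p (act p g (Pi.single i 1)) := by
  rw [linForm_act, linForm_single, one_smul]

theorem act_injective (p : Fin n → Fin n → kˣ) : Function.Injective (act p) := by
  intro g h e
  apply Subtype.ext
  have : (g.1 : SkewPoly p →ₐ[k] SkewPoly p) = h.1 := by
    apply algHom_ext
    intro i
    exact (gradedAut_x g i).trans ((by rw [e]) : _ = linForm p (act p h _)) |>.trans
      (gradedAut_x h i).symm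
  exact AlgEquiv.ext fun a => DFunLike.congr_fun this a

/-- An algebra automorphism mapping the linear forms onto the linear forms is graded. -/
theorem mem_gradedAut_of_map_span {p : Fin n → Fin n → kˣ} (g : SkewPoly p ≃ₐ[k] SkewPoly p)
    (h : (component p 1).map g.toLinearMap = component p 1) : g ∈ gradedAut p := by
  intro d
  rw [component_one] at h
  rw [component]
  exact (Submodule.map_pow _ (g : SkewPoly p →ₐ[k] SkewPoly p) d).trans
    (congrArg (fun W => W ^ d) h)

/-- The product of two linear forms, acting on the empty monomial of the model. Its coefficients are
those of the product in the basis of monomials with increasing indices. -/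
theorem model_linForm_mul (p : Fin n → Fin n → kˣ) (b c : Fin n → k) :
    model p (linForm p b * linForm p c) (Finsupp.single 0 1) =
      ∑ i, ∑ j, Finsupp.single (i ::ₘ {j}) (b i * c j * modelScalar p i {j}) := by
  rw [linForm_apply, linForm_apply, Finset.sum_mul_sum]
  simp only [smul_mul_smul_comm, map_sum, map_smul, map_mul, LinearMap.sum_apply,
    LinearMap.smul_apply, Module.End.mul_apply, model_x, modelOp_single, Finsupp.smul_single]
  refine Finset.sum_congr rfl fun i _ => Finset.sum_congr rfl fun j _ => ?_
  simp [modelScalar]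

/-- Comparison of the coefficients at `x_s ^ 2` in an equality of products of linear forms. -/
theorem linForm_mul_eq_diag {p : Fin n → Fin n → kˣ} {b c b' c' : Fin n → k}
    (h : linForm p b * linForm p c = linForm p b' * linForm p c') (s : Fin n) :
    b s * c s = b' s * c' s := by
  have key : ∀ b c : Fin n → k,
      (model p (linForm p b * linForm p c) (Finsupp.single 0 1)) (s ::ₘ {s}) = b s * c s := by
    intro b c
    rw [model_linForm_mul, Finsupp.finsetSum_apply, Finset.sum_eq_single s,
      Finsupp.finsetSum_apply, Finset.sum_eq_single s]
    · simp [modelScalar]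
    · intro j _ hj
      rw [Finsupp.single_apply, if_neg]
      simpa using hj
    · simp
    · intro i _ hi
      rw [Finsupp.finsetSum_apply]
      refine Finset.sum_eq_zero fun j _ => ?_
      rw [Finsupp.single_apply, if_neg]
      intro e
      have : i ∈ s ::ₘ ({s} : Multiset (Fin n)) := e ▸ Multiset.mem_cons_self i _
      simp at this
      exact hi this
    · simp
  rw [← key b c, h, key]

theorem modelScalar_singleton (p : Fin n → Fin n → kˣ) (s t : Fin n) :
    modelScalar p t {s} = commParam p s t * modelScalar p s {t} := by
  simp only [modelScalar, Multiset.map_singleton, Multiset.prod_singleton]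
  rcases lt_trichotomy s t with h | rfl | h
  · simp [h, h.not_gt, commParam]
  · simp
  · simp [h, h.not_gt, commParam]

/-- Comparison of the coefficients at the monomial of `x_s` and `x_t` in an equality of products
of linear forms. -/
theorem linForm_mul_eq_offdiag {p : Fin n → Fin n → kˣ} {b c b' c' : Fin n → k}
    (h : linForm p b * linForm p c = linForm p b' * linForm p c') {s t : Fin n} (hst : s ≠ t) :
    b s * c t + commParam p s t * (b t * c s) = b' s * c' t + commParam p s t * (b' t * c' s) := by
  have key : ∀ b c : Fin n → k,
      (model p (linForm p b * linForm p c) (Finsupp.single 0 1)) (s ::ₘ {t}) =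
        modelScalar p s {t} * (b s * c t + commParam p s t * (b t * c s)) := by
    intro b c
    rw [model_linForm_mul, Finsupp.finsetSum_apply]
    have : ∀ i j : Fin n, (Finsupp.single (i ::ₘ ({j} : Multiset (Fin n)))
        (b i * c j * modelScalar p i {j})) (s ::ₘ {t}) =
        (if i = s then if j = t then b i * c j * modelScalar p i {j} else 0 else 0) +
        (if i = t then if j = s then b i * c j * modelScalar p i {j} else 0 else 0) := by
      intro i j
      rw [Finsupp.single_apply]
      by_cases hi : i = s
      · subst hi
        simp [hst]
      · by_cases hi' : i = t
        · subst hi'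
          have : (i ::ₘ ({j} : Multiset (Fin n)) = s ::ₘ {i}) ↔ j = s := by
            rw [← Multiset.singleton_add s, add_comm, Multiset.singleton_add]
            simp
          simp [hi, this]
        · rw [if_neg, if_neg hi, if_neg hi', add_zero]
          intro e
          have : i ∈ s ::ₘ ({t} : Multiset (Fin n)) := e ▸ Multiset.mem_cons_self i _
          simp at this
          exact this.elim hi hi'
    simp only [Finsupp.finsetSum_apply, this, Finset.sum_add_distrib, Finset.sum_ite_irrel,
      Finset.sum_ite_eq', Finset.sum_const_zero, Finset.mem_univ, if_true]
    rw [modelScalar_singleton p s t]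
    ring
  have e := key b c
  rw [h, key] at e
  exact (mul_left_cancel₀ (modelScalar_ne_zero p s {t}) e).symm

/-- The variables are normal elements. -/
theorem x_mul_linForm {p : Fin n → Fin n → kˣ} (w : Fin n → k) (i : Fin n) :
    x p i * linForm p w = linForm p (fun j => commParam p j i * w j) * x p i := by
  rw [linForm_apply, linForm_apply, Finset.mul_sum, Finset.sum_mul]
  refine Finset.sum_congr rfl fun j _ => ?_
  rw [mul_smul_comm, x_mul_x' p j i, smul_mul_assoc, smul_smul, mul_comm]

/-- The indices `i` and `j` are in the same block if `x_i` and `x_j` commute with every `x_u` up to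
the same scalar. -/
def blockSetoid (p : Fin n → Fin n → kˣ) : Setoid (Fin n) where
  r i j := ∀ u, commParam p i u = commParam p j u
  iseqv := ⟨fun _ _ => rfl, fun h u => (h u).symm, fun h h' u => (h u).trans (h' u)⟩

/-- The image of a variable under a graded automorphism is a normal element of degree one, and the
support of such an element lies in a single block. -/
theorem blockSetoid_of_act_ne_zero {p : Fin n → Fin n → kˣ} (g : gradedAut p) {i u v : Fin n}
    (hu : act p g (Pi.single i 1) u ≠ 0) (hv : act p g (Pi.single i 1) v ≠ 0) :
    blockSetoid p u v := by
  intro t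
  set b := act p g (Pi.single i 1) with hb
  -- normality of the image: a variable moves past it and becomes another linear form
  obtain ⟨w, hw⟩ : ∃ w, linForm p b * linForm p (Pi.single t 1) = linForm p w * linForm p b := by
    refine ⟨act p g fun j => commParam p j i * (act p g).symm (Pi.single t 1) j, ?_⟩
    have h := congrArg g.1 (x_mul_linForm (p := p) ((act p g).symm (Pi.single t 1)) i)
    rw [map_mul, map_mul, gradedAut_x, ← hb, ← linForm_act, ← linForm_act] at h
    rwa [LinearEquiv.apply_symm_apply] at h
  -- the coefficient `w t` determines the scalar of `t` with all indices in the support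
  have key : ∀ s, b s ≠ 0 → (commParam p s t : k) * w t = 1 := by
    intro s hs
    have hdiag := linForm_mul_eq_diag hw s
    by_cases hst : s = t
    · subst hst
      rw [Pi.single_eq_same, mul_comm (w s)] at hdiag
      simpa using (mul_left_cancel₀ hs hdiag).symm
    · rw [Pi.single_eq_of_ne hst, mul_zero, eq_comm, mul_eq_zero, or_iff_left hs] at hdiag
      have := linForm_mul_eq_offdiag hw hst
      rw [Pi.single_eq_same, Pi.single_eq_of_ne hst, hdiag] at this
      have : b s * 1 = b s * (commParam p s t * w t) := by linear_combination this
      exact (mul_left_cancel₀ hs this).symm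
  have hw0 : w t ≠ 0 := right_ne_zero_of_mul_eq_one (key u hu)
  exact Units.ext (mul_right_cancel₀ hw0 ((key u hu).trans (key v hv).symm))

/-- A graded automorphism preserves the commutation scalars along its nonzero entries. -/
theorem commParam_eq_of_act_ne_zero {p : Fin n → Fin n → kˣ} (g : gradedAut p) {i j u v : Fin n}
    (hu : act p g (Pi.single i 1) u ≠ 0) (hv : act p g (Pi.single j 1) v ≠ 0) :
    commParam p u v = commParam p i j := by
  have hblock : ∀ s t, act p g (Pi.single i 1) s ≠ 0 → act p g (Pi.single j 1) t ≠ 0 →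
      commParam p s t = commParam p u v := by
    intro s t hs ht
    rw [blockSetoid_of_act_ne_zero g hs hu t, commParam_symm p t u, commParam_symm p v u,
      blockSetoid_of_act_ne_zero g ht hv u]
  -- both scalars are the ratio of the products of the images of `x_i` and `x_j` in the two orders
  have e₁ : g.1 (x p j) * g.1 (x p i) = (commParam p i j : k) • (g.1 (x p i) * g.1 (x p j)) := by
    rw [← map_mul, x_mul_x', map_smul, map_mul]
  have e₂ : g.1 (x p j) * g.1 (x p i) = (commParam p u v : k) • (g.1 (x p i) * g.1 (x p j)) := by
    rw [gradedAut_x, gradedAut_x, linForm_apply, linForm_apply, Finset.sum_mul_sum,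
      Finset.sum_mul_sum, Finset.sum_comm, Finset.smul_sum]
    refine Finset.sum_congr rfl fun s _ => ?_
    rw [Finset.smul_sum]
    refine Finset.sum_congr rfl fun t _ => ?_
    by_cases hs : act p g (Pi.single i 1) s = 0
    · simp [hs]
    by_cases ht : act p g (Pi.single j 1) t = 0
    · simp [ht]
    rw [smul_mul_smul_comm, smul_mul_smul_comm, x_mul_x', hblock s t hs ht, smul_smul, smul_smul]
    congr 1
    ring
  have hne : g.1 (x p i) * g.1 (x p j) ≠ 0 := by
    rw [← map_mul]
    intro h
    obtain ⟨c, hc, e⟩ := (qCommute_x p).prod_eq_smul_monomialProd [i, j]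
    have h0 := (map_eq_zero_iff g.1 g.1.injective).1 h
    simp only [List.map_cons, List.map_nil, List.prod_cons, List.prod_nil, mul_one] at e
    rw [h0, eq_comm, smul_eq_zero, or_iff_right hc] at e
    exact (linearIndependent_monomialProd p).ne_zero _ e
  exact Units.ext (smul_left_injective k hne (e₂.symm.trans e₁))

theorem exists_act_ne_zero {p : Fin n → Fin n → kˣ} (g : gradedAut p) (u : Fin n) :
    ∃ i, act p g (Pi.single i 1) u ≠ 0 := by
  by_contra! h
  have : ∀ v, act p g v u = 0 := by
    intro v
    rw [← Finset.univ_sum_single v, map_sum, Finset.sum_apply]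
    refine Finset.sum_eq_zero fun i _ => ?_
    have : (Pi.single i (v i) : Fin n → k) = v i • Pi.single i 1 := by simp [← Pi.single_smul]
    rw [this, map_smul, Pi.smul_apply, h, smul_zero]
  have h1 := this ((act p g).symm (Pi.single u 1))
  simp at h1

theorem exists_act_ne_zero' {p : Fin n → Fin n → kˣ} (g : gradedAut p) (i : Fin n) :
    ∃ u, act p g (Pi.single i 1) u ≠ 0 := by
  by_contra! h
  have : act p g (Pi.single i 1) = 0 := funext h
  simp at this

theorem blockSetoid_iff_of_act_ne_zero {p : Fin n → Fin n → kˣ} (g : gradedAut p)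
    {i j u v : Fin n} (hu : act p g (Pi.single i 1) u ≠ 0) (hv : act p g (Pi.single j 1) v ≠ 0) :
    blockSetoid p i j ↔ blockSetoid p u v := by
  constructor
  · intro h t
    obtain ⟨l, hl⟩ := exists_act_ne_zero g t
    rw [commParam_eq_of_act_ne_zero g hu hl, commParam_eq_of_act_ne_zero g hv hl, h l]
  · intro h l
    obtain ⟨t, ht⟩ := exists_act_ne_zero' g l
    rw [← commParam_eq_of_act_ne_zero g hu ht, ← commParam_eq_of_act_ne_zero g hv ht, h t]

/-- The permutation of the blocks induced by a graded automorphism. -/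
theorem exists_blockPerm {p : Fin n → Fin n → kˣ} (g : gradedAut p) :
    ∃ π : Equiv.Perm (Quotient (blockSetoid p)), ∀ i u, act p g (Pi.single i 1) u ≠ 0 →
      (⟦u⟧ : Quotient (blockSetoid p)) = π ⟦i⟧ := by
  classical
  choose f hf using exists_act_ne_zero' g
  let F : Quotient (blockSetoid p) → Quotient (blockSetoid p) :=
    Quotient.map f fun i j h => (blockSetoid_iff_of_act_ne_zero g (hf i) (hf j)).1 h
  have hF : Function.Injective F := by
    rintro ⟨i⟩ ⟨j⟩ h
    exact Quotient.sound ((blockSetoid_iff_of_act_ne_zero g (hf i) (hf j)).2 (Quotient.exact h))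
  refine ⟨Equiv.ofBijective F (Finite.injective_iff_bijective.1 hF), fun i u hu => ?_⟩
  exact Quotient.sound (blockSetoid_of_act_ne_zero g hu (hf i))

end SkewPoly

/-! ### Sums over the multisets invariant under a permutation -/

section InvariantMultisets

variable {ι : Type*}

/-- The orbits of a permutation. -/
abbrev PermOrbit (σ : Equiv.Perm ι) : Type _ := Quotient (Equiv.Perm.SameCycle.setoid σ)

theorem orbitMk_apply (σ : Equiv.Perm ι) (i : ι) :
    Quotient.mk (Equiv.Perm.SameCycle.setoid σ) (σ i) =
      Quotient.mk (Equiv.Perm.SameCycle.setoid σ) i :=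
  Quotient.sound (Equiv.Perm.sameCycle_apply_left.2 (Equiv.Perm.SameCycle.refl _ _))

section

variable [DecidableEq ι]

theorem map_eq_self_iff_count {σ : Equiv.Perm ι} {M : Multiset ι} :
    M.map σ = M ↔ ∀ i, M.count (σ i) = M.count i := by
  constructor
  · intro h i
    conv_lhs => rw [← h]
    exact Multiset.count_map_eq_count' _ _ σ.injective i
  · intro h
    ext i
    obtain ⟨j, rfl⟩ := σ.surjective i
    rw [Multiset.count_map_eq_count' _ _ σ.injective, h]

theorem count_eq_of_sameCycle [Finite ι] {σ : Equiv.Perm ι} {M : Multiset ι} (hM : M.map σ = M)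
    {i j : ι} (h : σ.SameCycle i j) : M.count i = M.count j := by
  rw [map_eq_self_iff_count] at hM
  have h1 : ∀ (m : ℕ) (i : ι), M.count ((σ ^ m) i) = M.count i := by
    intro m
    induction m with
    | zero => simp
    | succ m ih => intro i; rw [pow_succ, Equiv.Perm.mul_apply, ih, hM]
  obtain ⟨m, -, -, e⟩ := h.exists_pow_eq''
  rw [← e, h1]

end

variable [Fintype ι]

open Classical in
noncomputable instance (σ : Equiv.Perm ι) : Fintype (PermOrbit σ) := Quotient.fintype _

open Classical in
/-- The elements of an orbit, as a multiset. -/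
noncomputable def orbitMultiset (σ : Equiv.Perm ι) (c : PermOrbit σ) : Multiset ι :=
  (Finset.univ.filter fun i => (Quotient.mk (Equiv.Perm.SameCycle.setoid σ) i) = c).val

theorem mem_orbitMultiset {σ : Equiv.Perm ι} {c : PermOrbit σ} {i : ι} :
    i ∈ orbitMultiset σ c ↔ Quotient.mk (Equiv.Perm.SameCycle.setoid σ) i = c := by
  simp [orbitMultiset]

open Classical in
theorem count_orbitMultiset [DecidableEq ι] {σ : Equiv.Perm ι} {c : PermOrbit σ} {i : ι} :
    (orbitMultiset σ c).count i =
      if Quotient.mk (Equiv.Perm.SameCycle.setoid σ) i = c then 1 else 0 := by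
  have : (orbitMultiset σ c).Nodup := Finset.nodup _
  rw [Multiset.count_eq_of_nodup this]
  exact if_congr mem_orbitMultiset rfl rfl

theorem map_orbitMultiset (σ : Equiv.Perm ι) (c : PermOrbit σ) :
    (orbitMultiset σ c).map σ = orbitMultiset σ c := by
  classical
  rw [map_eq_self_iff_count]
  intro i
  rw [count_orbitMultiset, count_orbitMultiset, orbitMk_apply]

theorem card_orbitMultiset_pos (σ : Equiv.Perm ι) (c : PermOrbit σ) :
    0 < (orbitMultiset σ c).card := by
  rw [Multiset.card_pos_iff_exists_mem]
  exact ⟨c.out, mem_orbitMultiset.2 c.out_eq⟩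

/-- An invariant multiset is a sum of orbits. -/
theorem eq_sum_orbitMultiset [DecidableEq ι] {σ : Equiv.Perm ι} {M : Multiset ι}
    (hM : M.map σ = M) :
    M = ∑ c : PermOrbit σ, M.count c.out • orbitMultiset σ c := by
  classical
  ext i
  rw [Multiset.count_sum']
  simp only [Multiset.count_nsmul, count_orbitMultiset, mul_ite, mul_one, mul_zero,
    Finset.sum_ite_eq, Finset.mem_univ, if_true]
  exact count_eq_of_sameCycle hM
    (Equiv.Perm.SameCycle.symm (Quotient.exact (s := Equiv.Perm.SameCycle.setoid σ)
      (Quotient.out_eq (s := Equiv.Perm.SameCycle.setoid σ) _)))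

theorem map_sum_orbitMultiset {σ : Equiv.Perm ι} (s : Finset (PermOrbit σ))
    (m : PermOrbit σ → ℕ) :
    (∑ c ∈ s, m c • orbitMultiset σ c).map σ = ∑ c ∈ s, m c • orbitMultiset σ c := by
  classical
  rw [map_eq_self_iff_count]
  intro i
  simp only [Multiset.count_sum', Multiset.count_nsmul, count_orbitMultiset, orbitMk_apply]

variable {K : Type*} [Field K]

theorem weight_sum_orbitMultiset {σ : Equiv.Perm ι} {w : Multiset ι → K} (h0 : w 0 = 1)
    (hw : ∀ M L, M.map σ = M → L.map σ = L → w (M + L) = w M * w L)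
    (s : Finset (PermOrbit σ)) (m : PermOrbit σ → ℕ) :
    w (∑ c ∈ s, m c • orbitMultiset σ c) = ∏ c ∈ s, w (orbitMultiset σ c) ^ m c := by
  classical
  have hpow : ∀ c, ∀ j : ℕ, w (j • orbitMultiset σ c) = w (orbitMultiset σ c) ^ j := by
    intro c j
    induction j with
    | zero => simp [h0]
    | succ j ih =>
      rw [succ_nsmul, hw _ _ _ (map_orbitMultiset σ c), ih, pow_succ]
      simpa using map_sum_orbitMultiset {c} fun _ => j
  induction s using Finset.induction_on with
  | empty => simp [h0]
  | insert c s hc ih =>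
    rw [Finset.sum_insert hc, Finset.prod_insert hc, hw _ _ _ (map_sum_orbitMultiset s m), ih, hpow]
    simpa using map_sum_orbitMultiset {c} m

/-- The geometric series `∑ ζ ^ m X ^ (r m)` is the inverse of `1 - ζ X ^ r`. -/
theorem geometric_mul (ζ : K) {r : ℕ} (hr : 0 < r) :
    (PowerSeries.mk fun l => if r ∣ l then ζ ^ (l / r) else 0) *
      (1 - PowerSeries.C ζ * PowerSeries.X ^ r) = 1 := by
  ext l
  rw [mul_sub, mul_one, map_sub, ← mul_assoc, PowerSeries.coeff_mul_X_pow',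
    PowerSeries.coeff_mul_C, PowerSeries.coeff_mk, PowerSeries.coeff_mk, PowerSeries.coeff_one]
  by_cases hl : l = 0
  · subst hl
    simp [hr.ne']
  rw [if_neg hl]
  by_cases hrl : r ≤ l
  · obtain ⟨m, rfl⟩ := Nat.exists_eq_add_of_le hrl
    simp only [hrl, if_true, Nat.add_sub_cancel_left, Nat.dvd_add_right (dvd_refl r)]
    split_ifs
    · rw [Nat.add_div_left _ hr, pow_succ, sub_self]
    · simp
  · rw [if_neg hrl, if_neg, sub_zero]
    exact fun h => hrl (Nat.le_of_dvd (Nat.pos_of_ne_zero hl) h)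

open Classical in
/-- The generating function of a multiplicative weight on the invariant multisets is a product of
geometric series, one for each orbit. -/
theorem invariant_genFun_mul [DecidableEq ι] {σ : Equiv.Perm ι} {w : Multiset ι → K} (h0 : w 0 = 1)
    (hw : ∀ M L, M.map σ = M → L.map σ = L → w (M + L) = w M * w L) :
    (PowerSeries.mk fun d =>
      ∑ M ∈ Finset.univ.filter fun M : Sym ι d => (M : Multiset ι).map σ = M, w M) *
      ∏ c : PermOrbit σ, (1 - PowerSeries.C (w (orbitMultiset σ c)) *
        PowerSeries.X ^ (orbitMultiset σ c).card) = 1 := by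
  set r : PermOrbit σ → ℕ := fun c => (orbitMultiset σ c).card with hr
  have hr0 : ∀ c, 0 < r c := card_orbitMultiset_pos σ
  have key : (PowerSeries.mk fun d =>
      ∑ M ∈ Finset.univ.filter fun M : Sym ι d => (M : Multiset ι).map σ = M, w M) =
      ∏ c : PermOrbit σ, PowerSeries.mk fun l =>
        if r c ∣ l then w (orbitMultiset σ c) ^ (l / r c) else 0 := by
    ext d
    rw [PowerSeries.coeff_mk, PowerSeries.coeff_prod]
    -- an invariant multiset corresponds to the sizes of its parts in the orbits
    refine Finset.sum_of_injOn
      (fun M => Finsupp.equivFunOnFinite.symm fun c => r c * (M : Multiset ι).count c.out)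
      ?_ ?_ ?_ ?_
    · intro M hM L hL e
      simp only [Finset.coe_filter, Finset.mem_univ, true_and, Set.mem_ofPred_eq] at hM hL
      apply Sym.coe_injective
      rw [eq_sum_orbitMultiset hM, eq_sum_orbitMultiset hL]
      refine Finset.sum_congr rfl fun c _ => ?_
      have := DFunLike.congr_fun e c
      simp only [Finsupp.equivFunOnFinite_symm_apply_apply] at this
      rw [Nat.eq_of_mul_eq_mul_left (hr0 c) this]
    · intro M hM
      simp only [Finset.coe_filter, Finset.mem_univ, true_and, Set.mem_ofPred_eq] at hM
      simp only [Finset.mem_coe, Finset.mem_finsuppAntidiag, Finset.subset_univ, and_true]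
      have := congrArg Multiset.card (eq_sum_orbitMultiset hM)
      rw [Sym.card_coe, Multiset.card_sum] at this
      simp only [Finsupp.equivFunOnFinite_symm_apply_apply]
      refine Eq.trans ?_ this.symm
      exact Finset.sum_congr rfl fun c _ => by rw [Multiset.card_nsmul, mul_comm]
    · intro l hl hl'
      by_contra hne
      simp only [PowerSeries.coeff_mk] at hne
      have hdvd : ∀ c, r c ∣ l c := by
        intro c
        by_contra hc
        exact hne (Finset.prod_eq_zero (Finset.mem_univ c) (if_neg hc))
      simp only [Finset.mem_finsuppAntidiag, Finset.subset_univ, and_true] at hl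
      have hinv := map_sum_orbitMultiset (σ := σ) Finset.univ fun c => l c / r c
      have hcard : (∑ c, (l c / r c) • orbitMultiset σ c).card = d := by
        rw [Multiset.card_sum, ← hl]
        refine Finset.sum_congr rfl fun c _ => ?_
        rw [Multiset.card_nsmul]
        exact Nat.div_mul_cancel (hdvd c)
      refine hl' ⟨⟨_, hcard⟩, ?_, ?_⟩
      · simp only [Finset.coe_filter, Finset.mem_univ, true_and]
        exact hinv
      · ext c
        rw [Finsupp.equivFunOnFinite_symm_apply_apply]
        change r c * Multiset.count c.out (∑ c, (l c / r c) • orbitMultiset σ c) = l c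
        rw [Multiset.count_sum']
        simp only [Multiset.count_nsmul, count_orbitMultiset, mul_ite, mul_one, mul_zero,
          Quotient.out_eq, Finset.sum_ite_eq, Finset.mem_univ, if_true]
        exact Nat.mul_div_cancel' (hdvd c)
    · intro M hM
      simp only [Finset.mem_filter, Finset.mem_univ, true_and] at hM
      conv_lhs => rw [eq_sum_orbitMultiset hM]
      rw [weight_sum_orbitMultiset h0 hw]
      refine Finset.prod_congr rfl fun c _ => ?_
      rw [PowerSeries.coeff_mk, Finsupp.equivFunOnFinite_symm_apply_apply,
        if_pos (dvd_mul_right _ _), Nat.mul_div_cancel_left _ (hr0 c)]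
  rw [key, ← Finset.prod_mul_distrib]
  exact Finset.prod_eq_one fun c _ => geometric_mul _ (hr0 c)

end InvariantMultisets

/-! ### Factorizations of `(1 - X) ^ s * (1 - c X)` -/

section Factorization

open Polynomial

variable {K : Type*} [Field K]

variable {O : Type*} [Fintype O] {ζ : O → K} {r : O → ℕ} {s : ℕ} {c : K}

/-- A root other than `1` of one of the factors is the root of `1 - c X`. -/
theorem root_of_prod_eq
    (h : ∏ o, (1 - C (ζ o) * X ^ r o) = (1 - X) ^ s * (1 - C c * X : K[X])) {o : O} {ρ : K}
    (hρ : ζ o * ρ ^ r o = 1) (h1 : ρ ≠ 1) : c * ρ = 1 := by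
  have := congrArg (eval ρ) h
  rw [eval_prod, Finset.prod_eq_zero (Finset.mem_univ o) (by simp [hρ])] at this
  simp only [eval_mul, eval_pow, eval_sub, eval_one, eval_X, eval_C] at this
  rw [eq_comm, mul_eq_zero, or_iff_right (pow_ne_zero _ (sub_ne_zero.2 h1.symm)),
    sub_eq_zero] at this
  exact this.symm

variable [IsAlgClosed K] [CharZero K]

/-- A factor other than `1 - X` has a root other than `1`. -/
theorem exists_root_ne_one {r : ℕ} (hr : 0 < r) {ζ : K} (hζ : ζ ≠ 0) (h : ¬ (r = 1 ∧ ζ = 1)) :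
    ∃ ρ : K, ζ * ρ ^ r = 1 ∧ ρ ≠ 1 := by
  obtain ⟨ρ, hρ⟩ := IsAlgClosed.exists_pow_nat_eq ζ⁻¹ hr
  by_cases h1 : ρ = 1
  · have hζ1 : ζ = 1 := by simpa [h1] using hρ.symm
    have : NeZero (r : K) := ⟨Nat.cast_ne_zero.2 hr.ne'⟩
    obtain ⟨ω, hω⟩ := HasEnoughRootsOfUnity.exists_primitiveRoot K r
    refine ⟨ω, by rw [hω.pow_eq_one, hζ1, mul_one], fun hω1 => h ⟨?_, hζ1⟩⟩
    rw [hω.eq_orderOf, hω1, orderOf_one]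
  · exact ⟨ρ, by rw [hρ, mul_inv_cancel₀ hζ], h1⟩

/-- At most one factor differs from `1 - X`. -/
theorem factor_unique (hr : ∀ o, 0 < r o) (hζ : ∀ o, ζ o ≠ 0)
    (h : ∏ o, (1 - C (ζ o) * X ^ r o) = (1 - X) ^ s * (1 - C c * X : K[X])) {o o' : O}
    (ho : ¬ (r o = 1 ∧ ζ o = 1)) (ho' : ¬ (r o' = 1 ∧ ζ o' = 1)) : o = o' := by
  classical
  by_contra hne
  obtain ⟨ρ, hρ, h1⟩ := exists_root_ne_one (hr o) (hζ o) ho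
  obtain ⟨ρ', hρ', h1'⟩ := exists_root_ne_one (hr o') (hζ o') ho'
  have e := root_of_prod_eq h hρ h1
  have e' := root_of_prod_eq h hρ' h1'
  have hc : c ≠ 0 := left_ne_zero_of_mul_eq_one e
  obtain rfl : ρ = ρ' := mul_left_cancel₀ hc (e.trans e'.symm)
  -- `ρ` is a root of two factors, but a simple root of the right-hand side
  have hd := congrArg (fun P => eval ρ (derivative P)) h
  rw [← Finset.mul_prod_erase _ _ (Finset.mem_univ o),
    ← Finset.mul_prod_erase _ _ (Finset.mem_erase.2 ⟨Ne.symm hne, Finset.mem_univ o'⟩)] at hd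
  simp only [derivative_mul, eval_add, eval_mul, eval_sub, eval_one, eval_C, eval_pow, eval_X, hρ,
    hρ', e, sub_self, mul_zero, zero_mul, add_zero, zero_add, derivative_sub, derivative_one,
    derivative_C, derivative_X, mul_one, zero_sub, eval_neg] at hd
  rw [eq_comm, mul_eq_zero] at hd
  rcases hd with hd | hd
  · exact pow_ne_zero _ (sub_ne_zero.2 h1.symm) hd
  · exact hc (neg_eq_zero.1 hd)

/-- Each factor is linear or equal to `1 - X ^ 2`: the roots of the factor `1 - ζ X ^ r` are `r`
different numbers, at most one of which differs from `1`, and they are permuted by the `r`-th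
roots of unity. -/
theorem factor_cases (hr : ∀ o, 0 < r o) (hζ : ∀ o, ζ o ≠ 0)
    (h : ∏ o, (1 - C (ζ o) * X ^ r o) = (1 - X) ^ s * (1 - C c * X : K[X])) (o : O) :
    r o = 1 ∨ (r o = 2 ∧ ζ o = 1) := by
  by_cases ho : r o = 1 ∧ ζ o = 1
  · exact Or.inl ho.1
  obtain ⟨ρ, hρ, h1⟩ := exists_root_ne_one (hr o) (hζ o) ho
  have e := root_of_prod_eq h hρ h1
  have hc : c ≠ 0 := left_ne_zero_of_mul_eq_one e
  have hρ0 : ρ ≠ 0 := right_ne_zero_of_mul_eq_one e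
  have : NeZero (r o : K) := ⟨Nat.cast_ne_zero.2 (hr o).ne'⟩
  obtain ⟨ω, hω⟩ := HasEnoughRootsOfUnity.exists_primitiveRoot K (r o)
  by_cases hr1 : r o = 1
  · exact Or.inl hr1
  have hω1 : ω ≠ 1 := fun hω1 => hr1 (by rw [hω.eq_orderOf, hω1, orderOf_one])
  have hroot : ∀ η : K, η ^ r o = 1 → η ≠ 1 → η * ρ = 1 := by
    intro η hη hη1
    by_contra hne
    have := root_of_prod_eq h (o := o) (ρ := η * ρ)
      (by rw [mul_pow, hη, one_mul, hρ]) hne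
    exact hη1 (mul_right_cancel₀ hρ0 (mul_left_cancel₀ hc (by rw [this, one_mul, e])))
  have h2 : ω ^ 2 = 1 := by
    by_contra h2
    have h3 := hroot (ω ^ 2) (by rw [← pow_mul, mul_comm, pow_mul, hω.pow_eq_one, one_pow]) h2
    have h4 := hroot ω hω.pow_eq_one hω1
    have := mul_right_cancel₀ hρ0 (h3.trans h4.symm)
    rw [sq] at this
    exact hω1 (mul_left_cancel₀ (hω.ne_zero (hr o).ne') (this.trans (mul_one _).symm))
  have hr2 : r o = 2 := by
    have := Nat.le_of_dvd two_pos (hω.dvd_of_pow_eq_one 2 h2)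
    have := hr o
    omega
  refine Or.inr ⟨hr2, ?_⟩
  have h4 := hroot ω hω.pow_eq_one hω1
  have h5 : ρ ^ 2 = 1 := by
    have := congrArg (· ^ 2) h4
    simpa [mul_pow, h2] using this
  rwa [hr2, h5, mul_one] at hρ

end Factorization

/-! ### The trace series of an automorphism that is monomial over an extension field -/

/-- The trace does not change under extension of scalars, when bases correspond. -/
theorem trace_eq_of_semilinear {k K W W' ι : Type*} [Field k] [Field K] [Algebra k K]
    [AddCommGroup W] [Module k W] [AddCommGroup W'] [Module K W'] [Fintype ι]
    (b : Module.Basis ι k W) (b' : Module.Basis ι K W') (Φ : W →+ W')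
    (hΦ : ∀ (c : k) w, Φ (c • w) = algebraMap k K c • Φ w) (hb : ∀ i, Φ (b i) = b' i)
    (f : W →ₗ[k] W) (f' : W' →ₗ[K] W') (hf : ∀ w, Φ (f w) = f' (Φ w)) :
    LinearMap.trace K W' f' = algebraMap k K (LinearMap.trace k W f) := by
  classical
  rw [LinearMap.trace_eq_matrix_trace k b, LinearMap.trace_eq_matrix_trace K b', Matrix.trace,
    Matrix.trace, map_sum]
  refine Finset.sum_congr rfl fun i _ => ?_
  rw [Matrix.diag_apply, Matrix.diag_apply, LinearMap.toMatrix_apply, LinearMap.toMatrix_apply,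
    ← hb, ← hf, ← b.sum_repr (f (b i)), map_sum]
  simp only [hΦ, hb, map_sum, map_smul, Module.Basis.repr_self]
  simp [Finsupp.finsetSum_apply, Finsupp.single_apply, Algebra.smul_def]

namespace SkewPoly

variable {k : Type*} [Field k] {n : ℕ}

/-- The universal property of the skew polynomial ring for algebras over an extension field. -/
theorem exists_semilinear_lift {K B : Type*} [Field K] [Algebra k K] [Ring B] [Algebra K B]
    (p : Fin n → Fin n → kˣ) (y : Fin n → B)
    (hy : ∀ i j, i < j → y j * y i = algebraMap k K (p i j) • (y i * y j)) :
    ∃ Φ : SkewPoly p →+* B, (∀ (c : k) a, Φ (c • a) = algebraMap k K c • Φ a) ∧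
      ∀ i, Φ (x p i) = y i := by
  let _ : Algebra k B := Algebra.compHom B (algebraMap k K)
  have hsmul : ∀ (c : k) (b : B), c • b = algebraMap k K c • b := fun _ _ => rfl
  refine ⟨lift p y fun i j h => by rw [hy i j h, hsmul], fun c a => ?_, fun i => lift_x _ _ _ _⟩
  exact (map_smul (lift p y _) c a).trans (hsmul _ _)

theorem map_monomialProd {A B ι : Type*} [Ring A] [Ring B] (f : A →+* B) (y : ι → A)
    (M : Multiset ι) : f (monomialProd y M) = monomialProd (fun i => f (y i)) M := by
  rw [monomialProd, map_list_prod, List.map_map]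
  rfl

/-- A monomial endomorphism `x_l ↦ c_l x_{σ l}` permutes the monomials up to nonzero scalars, and
its traces are sums over the invariant monomials. -/
theorem exists_weight (p : Fin n → Fin n → kˣ) (g : SkewPoly p →ₐ[k] SkewPoly p)
    (σ : Equiv.Perm (Fin n)) (c : Fin n → k) (hc : ∀ l, c l ≠ 0)
    (hg : ∀ l, g (x p l) = c l • x p (σ l)) :
    ∃ w : Multiset (Fin n) → k, (∀ M, w M ≠ 0) ∧ w 0 = 1 ∧
      (∀ M L, M.map σ = M → L.map σ = L → w (M + L) = w M * w L) ∧
      (∀ M, M.map σ = M → g (monomialProd (x p) M) = w M • monomialProd (x p) M) ∧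
      ∀ (d : ℕ) (f : component p d →ₗ[k] component p d), (∀ a, (f a : SkewPoly p) = g a) →
        LinearMap.trace k (component p d) f =
          ∑ M ∈ Finset.univ.filter fun M : Sym (Fin n) d => (M : Multiset (Fin n)).map σ = M,
            w M := by
  classical
  have hne := (linearIndependent_monomialProd p).ne_zero
  have key : ∀ M : Multiset (Fin n), ∃ a : k, a ≠ 0 ∧
      g (monomialProd (x p) M) = a • monomialProd (x p) (M.map σ) := by
    intro M
    have : ∀ l : List (Fin n), ∃ a : k, a ≠ 0 ∧
        g (l.map (x p)).prod = a • ((l.map σ).map (x p)).prod := by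
      intro l
      induction l with
      | nil => exact ⟨1, one_ne_zero, by simp⟩
      | cons i l ih =>
        obtain ⟨a, ha, e⟩ := ih
        refine ⟨c i * a, mul_ne_zero (hc i) ha, ?_⟩
        simp only [List.map_cons, List.prod_cons, map_mul, e, hg, smul_mul_smul_comm]
    obtain ⟨a, ha, e⟩ := this M.toList
    obtain ⟨b, hb, e'⟩ := (qCommute_x p).prod_eq_smul_monomialProd (M.toList.map σ)
    rw [← Multiset.map_coe, Multiset.coe_toList] at e'
    exact ⟨a * b, mul_ne_zero ha hb, by rw [monomialProd, e, e', smul_smul]⟩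
  choose w hw0 hw using key
  refine ⟨w, hw0, ?_, ?_, ?_, ?_⟩
  · have h := hw 0
    rw [Multiset.map_zero, monomialProd_zero, map_one] at h
    have h' : (1 : k) • (1 : SkewPoly p) = w 0 • 1 := by rw [one_smul]; exact h
    have h1 := hne 0
    rw [monomialProd_zero] at h1
    exact (smul_left_injective k h1 h').symm
  · intro M L hM hL
    obtain ⟨a, ha, e⟩ := (qCommute_x p).monomialProd_add M L
    have h := congrArg g e
    rw [map_mul, map_smul, hw, hw, hw, Multiset.map_add, hM, hL, smul_mul_smul_comm, e, smul_smul,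
      smul_smul, mul_comm _ a] at h
    exact (mul_left_cancel₀ ha (smul_left_injective k (hne _) h)).symm
  · intro M hM
    rw [hw, hM]
  · intro d f hf
    rw [LinearMap.trace_eq_matrix_trace k (monomialBasis p d), Matrix.trace, Finset.sum_filter]
    refine Finset.sum_congr rfl fun M _ => ?_
    rw [Matrix.diag_apply, LinearMap.toMatrix_apply]
    have : f (monomialBasis p d M) = w M • monomialBasis p d (M.map σ) := by
      apply Subtype.ext
      rw [hf, Submodule.coe_smul, monomialBasis_apply, monomialBasis_apply, hw]
      rfl
    rw [this, map_smul, Module.Basis.repr_self, Finsupp.smul_apply, Finsupp.single_apply,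
      smul_eq_mul, mul_ite, mul_one, mul_zero]
    refine if_congr ?_ rfl rfl
    rw [← Sym.coe_inj]
    rfl

/-- The scalar by which the blocks `B` and `C` commute. -/
noncomputable def blockParam (p : Fin n → Fin n → kˣ) (B C : Quotient (blockSetoid p)) : kˣ :=
  commParam p B.out C.out

theorem commParam_congr {p : Fin n → Fin n → kˣ} {i i' j j' : Fin n} (h : blockSetoid p i i')
    (h' : blockSetoid p j j') : commParam p i j = commParam p i' j' := by
  rw [h, commParam_symm p j, h', ← commParam_symm]

theorem blockParam_mk (p : Fin n → Fin n → kˣ) (i j : Fin n) :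
    blockParam p ⟦i⟧ ⟦j⟧ = commParam p i j :=
  commParam_congr (Quotient.exact (Quotient.out_eq _)) (Quotient.exact (Quotient.out_eq _))

theorem blockParam_symm (p : Fin n → Fin n → kˣ) (B C : Quotient (blockSetoid p)) :
    blockParam p C B = (blockParam p B C)⁻¹ := commParam_symm _ _ _

theorem blockParam_self (p : Fin n → Fin n → kˣ) (B : Quotient (blockSetoid p)) :
    blockParam p B B = 1 := commParam_self _ _

/-- A graded automorphism preserves the commutation scalars of the blocks. -/
theorem blockParam_perm {p : Fin n → Fin n → kˣ} (g : gradedAut p)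
    {π : Equiv.Perm (Quotient (blockSetoid p))}
    (hπ : ∀ i u, act p g (Pi.single i 1) u ≠ 0 → (⟦u⟧ : Quotient (blockSetoid p)) = π ⟦i⟧)
    (B C : Quotient (blockSetoid p)) : blockParam p (π B) (π C) = blockParam p B C := by
  induction B using Quotient.inductionOn with | _ i
  induction C using Quotient.inductionOn with | _ j
  obtain ⟨u, hu⟩ := exists_act_ne_zero' g i
  obtain ⟨v, hv⟩ := exists_act_ne_zero' g j
  rw [← hπ i u hu, ← hπ j v hv, blockParam_mk, blockParam_mk]
  exact commParam_eq_of_act_ne_zero g hu hv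

variable {K : Type*} [Field K] [Algebra k K]

/-- A change of coordinates over the field `K` that respects the blocks and makes the graded
automorphism `g` monomial. The new variables are `y_l = ∑ i, Z i l • x_i`, of block `bl l`, the old
ones are `x_i = ∑ l, U l i • y_l`, and `g` maps `y_l` to `c l • y_{σ l}`. -/
structure Monomialization (K : Type*) [Field K] [Algebra k K] {p : Fin n → Fin n → kˣ}
    (g : gradedAut p) (π : Equiv.Perm (Quotient (blockSetoid p))) where
  /-- the new variables in terms of the old ones -/
  Z : Matrix (Fin n) (Fin n) K
  /-- the old variables in terms of the new ones -/
  U : Matrix (Fin n) (Fin n) K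
  /-- the blocks of the new variables -/
  bl : Fin n → Quotient (blockSetoid p)
  /-- the permutation of the new variables -/
  σ : Equiv.Perm (Fin n)
  /-- the scalars of the monomial action -/
  c : Fin n → K
  c_ne_zero : ∀ l, c l ≠ 0
  Z_mul_U : Z * U = 1
  bl_of_U_ne_zero : ∀ l i, U l i ≠ 0 → bl l = ⟦i⟧
  bl_of_Z_ne_zero : ∀ i l, Z i l ≠ 0 → bl l = ⟦i⟧
  bl_σ : ∀ l, bl (σ l) = π (bl l)
  bl_σ_ne : ∀ l, σ l ≠ l → bl (σ l) ≠ bl l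
  U_mul : ∀ l i, ∑ v, U (σ l) v * algebraMap k K (act p g (Pi.single i 1) v) = c l * U l i

namespace Monomialization

variable {p : Fin n → Fin n → kˣ} {g : gradedAut p} {π : Equiv.Perm (Quotient (blockSetoid p))}

theorem U_mul_Z (D : Monomialization K g π) : D.U * D.Z = 1 :=
  mul_eq_one_comm.1 D.Z_mul_U

/-- The commutation scalars of the new variables. -/
noncomputable def param (D : Monomialization K g π) (l m : Fin n) : Kˣ :=
  Units.map (algebraMap k K).toMonoidHom (blockParam p (D.bl l) (D.bl m))

theorem commParam_param (D : Monomialization K g π) (l m : Fin n) :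
    commParam D.param l m = D.param l m := by
  rcases lt_trichotomy l m with h | rfl | h
  · rw [commParam_of_lt _ h]
  · rw [commParam_self, param, blockParam_self, map_one]
  · rw [commParam_symm, commParam_of_lt _ h, param, param, blockParam_symm p (D.bl l), map_inv,
      inv_inv]

/-- The variables `x_i`, mapped to the skew polynomial ring in the new variables. -/
noncomputable def newX (D : Monomialization K g π) (i : Fin n) : SkewPoly D.param :=
  linForm D.param fun l => D.U l i

theorem newX_mul (D : Monomialization K g π) (i j : Fin n) :
    D.newX j * D.newX i = algebraMap k K (commParam p i j) • (D.newX i * D.newX j) := by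
  rw [newX, newX, linForm_apply, linForm_apply, Finset.sum_mul_sum, Finset.sum_mul_sum,
    Finset.sum_comm, Finset.smul_sum]
  refine Finset.sum_congr rfl fun l _ => ?_
  rw [Finset.smul_sum]
  refine Finset.sum_congr rfl fun m _ => ?_
  by_cases hl : D.U l i = 0
  · simp [hl]
  by_cases hm : D.U m j = 0
  · simp [hm]
  rw [smul_mul_smul_comm, smul_mul_smul_comm, x_mul_x', commParam_param, param,
    D.bl_of_U_ne_zero l i hl, D.bl_of_U_ne_zero m j hm, blockParam_mk, smul_smul, smul_smul]
  congr 1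
  simp only [Units.coe_map, RingHom.toMonoidHom_eq_coe, MonoidHom.coe_coe]
  ring

theorem qCommute_newX (D : Monomialization K g π) : QCommute K D.newX := fun i j =>
  ⟨_, by simp, D.newX_mul i j⟩

theorem span_newX (D : Monomialization K g π) :
    Submodule.span K (Set.range D.newX) = Submodule.span K (Set.range (x D.param)) := by
  apply le_antisymm
  · rw [Submodule.span_le]
    rintro _ ⟨i, rfl⟩
    rw [newX, SetLike.mem_coe, ← component_one, ← range_linForm]
    exact ⟨_, rfl⟩
  · rw [Submodule.span_le]
    rintro _ ⟨l, rfl⟩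
    have : x D.param l = ∑ i, D.Z i l • D.newX i := by
      have h1 : x D.param l = linForm D.param (Pi.single l 1) := by simp
      rw [h1]
      simp only [newX, ← map_smul, ← map_sum]
      congr 1
      funext m
      have := congrFun (congrFun D.U_mul_Z m) l
      rw [Matrix.mul_apply, Matrix.one_apply] at this
      simp only [Finset.sum_apply, Pi.smul_apply, smul_eq_mul, Pi.single_apply]
      rw [← this]
      exact Finset.sum_congr rfl fun i _ => mul_comm _ _
    rw [this]
    exact Submodule.sum_mem _ fun i _ =>
      Submodule.smul_mem _ _ (Submodule.subset_span ⟨i, rfl⟩)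

theorem span_monomialProd_newX (D : Monomialization K g π) (d : ℕ) :
    Submodule.span K (Set.range fun M : Sym (Fin n) d => monomialProd D.newX M) =
      component D.param d := by
  rw [component, ← D.span_newX, D.qCommute_newX.span_pow_eq]

/-- The monomials in the old variables, as a basis over `K`: they span the component, and there are
as many of them as monomials in the new variables. -/
noncomputable def basis (D : Monomialization K g π) (d : ℕ) :
    Module.Basis (Sym (Fin n) d) K (component D.param d) :=
  basisOfTopLeSpanOfCardEqFinrank
    (fun M : Sym (Fin n) d => (⟨monomialProd D.newX M, by
      rw [← D.span_monomialProd_newX]; exact Submodule.subset_span ⟨M, rfl⟩⟩ : component D.param d))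
    (by
      rintro ⟨a, ha⟩ -
      have ha' := ha
      rw [← D.span_monomialProd_newX] at ha'
      have e := Submodule.map_span (component D.param d).subtype (Set.range fun M : Sym (Fin n) d =>
        (⟨monomialProd D.newX M, by
          rw [← D.span_monomialProd_newX]
          exact Submodule.subset_span ⟨M, rfl⟩⟩ : component D.param d))
      rw [← Set.range_comp] at e
      obtain ⟨b, hb, rfl⟩ := e.symm.le ha'
      exact hb)
    (Module.finrank_eq_card_basis (monomialBasis D.param d)).symm

theorem basis_apply (D : Monomialization K g π) (d : ℕ) (M : Sym (Fin n) d) :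
    (D.basis d M : SkewPoly D.param) = monomialProd D.newX M := by
  rw [basis, coe_basisOfTopLeSpanOfCardEqFinrank]

/-- The monomial endomorphism of the skew polynomial ring in the new variables. It respects the
relations since `g` preserves the commutation scalars of the blocks. -/
noncomputable def hom (D : Monomialization K g π)
    (hπ : ∀ B C, blockParam p (π B) (π C) = blockParam p B C) :
    SkewPoly D.param →ₐ[K] SkewPoly D.param :=
  lift D.param (fun l => D.c l • x D.param (D.σ l)) fun l m _ => by
    rw [smul_mul_smul_comm, smul_mul_smul_comm, x_mul_x', commParam_param, param, D.bl_σ, D.bl_σ,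
      hπ, ← param, smul_smul, smul_smul]
    congr 1
    ring

theorem hom_x (D : Monomialization K g π)
    (hπ : ∀ B C, blockParam p (π B) (π C) = blockParam p B C) (l : Fin n) :
    D.hom hπ (x D.param l) = D.c l • x D.param (D.σ l) := lift_x _ _ _ _

theorem hom_newX (D : Monomialization K g π)
    (hπ : ∀ B C, blockParam p (π B) (π C) = blockParam p B C) (i : Fin n) :
    D.hom hπ (D.newX i) =
      ∑ v, algebraMap k K (act p g (Pi.single i 1) v) • D.newX v := by
  simp only [newX, ← map_smul, ← map_sum]
  rw [linForm_apply, linForm_apply, map_sum]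
  conv_rhs => rw [← Equiv.sum_comp D.σ]
  refine Finset.sum_congr rfl fun l _ => ?_
  rw [map_smul, hom_x, smul_smul]
  congr 1
  rw [mul_comm, ← D.U_mul, Finset.sum_apply]
  exact Finset.sum_congr rfl fun v _ => mul_comm _ _

theorem mem_component_hom (D : Monomialization K g π)
    (hπ : ∀ B C, blockParam p (π B) (π C) = blockParam p B C) (d : ℕ) :
    ∀ a ∈ component D.param d, (D.hom hπ).toLinearMap a ∈ component D.param d := by
  intro a ha
  have h1 : (component D.param 1).map (D.hom hπ).toLinearMap ≤ component D.param 1 := by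
    rw [component_one, Submodule.map_span, Submodule.span_le]
    rintro _ ⟨_, ⟨l, rfl⟩, rfl⟩
    rw [AlgHom.toLinearMap_apply, hom_x]
    exact Submodule.smul_mem _ _ (Submodule.subset_span ⟨_, rfl⟩)
  have h2 : (component D.param d).map (D.hom hπ).toLinearMap ≤ component D.param d := by
    rw [component_one] at h1
    rw [component, Submodule.map_pow]
    exact pow_le_pow_left' h1 d
  exact h2 (Submodule.mem_map_of_mem ha)

/-- The traces of `g` are those of the monomial endomorphism: the two maps have the same matrix on
the monomials in the old variables. -/
theorem algebraMap_trace (D : Monomialization K g π)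
    (hπ : ∀ B C, blockParam p (π B) (π C) = blockParam p B C) (d : ℕ) :
    algebraMap k K (LinearMap.trace k (component p d) (restrictComponent g d)) =
      LinearMap.trace K (component D.param d)
        ((D.hom hπ).toLinearMap.restrict (D.mem_component_hom hπ d)) := by
  obtain ⟨Φ, hΦ, hx⟩ := exists_semilinear_lift (K := K) p D.newX fun i j h => by
    rw [D.newX_mul, commParam_of_lt p h]
  have hcomm : ∀ a ∈ component p d, Φ (g.1 a) = D.hom hπ (Φ a) := by
    intro a ha
    have hgen : ∀ i, Φ (g.1 (x p i)) = D.hom hπ (Φ (x p i)) := by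
      intro i
      rw [hx, hom_newX, gradedAut_x, linForm_apply, map_sum]
      exact Finset.sum_congr rfl fun v _ => by rw [hΦ, hx]
    rw [component, (qCommute_x p).span_pow_eq] at ha
    induction ha using Submodule.span_induction with
    | mem a h =>
      obtain ⟨M, rfl⟩ := h
      have e1 := map_monomialProd (Φ.comp (g.1 : SkewPoly p →+* SkewPoly p)) (x p)
        (M : Multiset (Fin n))
      have e2 := map_monomialProd ((D.hom hπ : SkewPoly D.param →+* SkewPoly D.param).comp Φ)
        (x p) (M : Multiset (Fin n))
      refine e1.trans (Eq.trans ?_ e2.symm)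
      congr 1
      exact funext hgen
    | zero => simp
    | add a b _ _ ha hb => simp only [map_add, ha, hb]
    | smul c a _ ha => rw [map_smul, hΦ, ha, hΦ, map_smul]
  have hmem : ∀ a ∈ component p d, Φ a ∈ component D.param d := by
    intro a ha
    rw [component, (qCommute_x p).span_pow_eq] at ha
    induction ha using Submodule.span_induction with
    | mem a h =>
      obtain ⟨M, rfl⟩ := h
      rw [map_monomialProd, ← D.span_monomialProd_newX]
      exact Submodule.subset_span ⟨M, by simp only [hx]⟩
    | zero => simp
    | add a b _ _ ha hb => rw [map_add]; exact Submodule.add_mem _ ha hb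
    | smul c a _ ha => rw [hΦ]; exact Submodule.smul_mem _ _ ha
  let Φd : component p d →+ component D.param d :=
    { toFun := fun a => ⟨Φ a, hmem a a.2⟩
      map_zero' := Subtype.ext (map_zero Φ)
      map_add' := fun a b => Subtype.ext (map_add Φ _ _) }
  refine (trace_eq_of_semilinear (monomialBasis p d) (D.basis d) Φd (fun c a => ?_) (fun M => ?_)
    _ _ fun a => ?_).symm
  · exact Subtype.ext (hΦ c a)
  · apply Subtype.ext
    change Φ (monomialBasis p d M : SkewPoly p) = _
    rw [basis_apply, monomialBasis_apply, map_monomialProd]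
    simp only [hx]
  · exact Subtype.ext (hcomm a a.2)

end Monomialization

end SkewPoly

/-! ### Quasi-reflections in monomializing coordinates -/

namespace SkewPoly

namespace Monomialization

variable {k : Type*} [Field k] {n : ℕ} {K : Type*} [Field K] [Algebra k K]
  {p : Fin n → Fin n → kˣ} {g : gradedAut p} {π : Equiv.Perm (Quotient (blockSetoid p))}

/-- The product of two variables interchanged by the monomial endomorphism is an eigenvector. -/
theorem hom_pair (D : Monomialization K g π)
    (hπ : ∀ B C, blockParam p (π B) (π C) = blockParam p B C) {s : Fin n}
    (hs : D.σ (D.σ s) = s) :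
    D.hom hπ (x D.param s * x D.param (D.σ s)) =
      (D.c s * D.c (D.σ s) * D.param s (D.σ s)) • (x D.param s * x D.param (D.σ s)) := by
  rw [map_mul, hom_x, hom_x, hs, smul_mul_smul_comm, x_mul_x', commParam_param, smul_smul]

/-- The shape of a quasi-reflection in monomializing coordinates: the factors `1 - ζ X ^ r` of the
orbits have product `(1 - X) ^ (n - 1) * (1 - λ X)`, so that at most one of them differs from
`1 - X`, and that one is linear or equal to `1 - X ^ 2`. -/
theorem cases_of_isQuasiReflection [IsAlgClosed K] [CharZero K] (D : Monomialization K g π)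
    (hπ : ∀ B C, blockParam p (π B) (π C) = blockParam p B C) (hg : IsQuasiReflection g) :
    (D.σ = 1 ∧ ∀ l l', D.c l ≠ 1 → D.c l' ≠ 1 → l = l') ∨
      ∃ s, D.σ s ≠ s ∧ D.σ (D.σ s) = s ∧ (∀ l, l ≠ s → l ≠ D.σ s → D.σ l = l ∧ D.c l = 1) ∧
        D.c s * D.c (D.σ s) * D.param s (D.σ s) = 1 := by
  classical
  obtain ⟨w, hw, hw0, hwmul, hwM, hwtr⟩ := exists_weight D.param (D.hom hπ) D.σ D.c
    D.c_ne_zero (D.hom_x hπ)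
  have hne := (linearIndependent_monomialProd D.param).ne_zero
  obtain ⟨a, -, ha⟩ := hg
  have hseries : PowerSeries.map (algebraMap k K) (traceSeries g) = PowerSeries.mk fun d =>
      ∑ M ∈ Finset.univ.filter fun M : Sym (Fin n) d => (M : Multiset (Fin n)).map D.σ = M,
        w M := by
    ext d
    rw [PowerSeries.coeff_map, traceSeries, PowerSeries.coeff_mk, PowerSeries.coeff_mk,
      D.algebraMap_trace hπ, hwtr]
    intro a
    rfl
  set ζ : PermOrbit D.σ → K := fun o => w (orbitMultiset D.σ o) with hζ
  set r : PermOrbit D.σ → ℕ := fun o => (orbitMultiset D.σ o).card with hr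
  open Polynomial in
  have hprod : ∏ o, (1 - C (ζ o) * X ^ r o) =
      (1 - X) ^ (n - 1) * (1 - C (algebraMap k K a) * X : K[X]) := by
    have h1 := invariant_genFun_mul hw0 hwmul
    rw [← hseries] at h1
    have h2 := congrArg (PowerSeries.map (algebraMap k K)) ha
    rw [map_mul, map_one] at h2
    have hunit := IsUnit.of_mul_eq_one _ h1
    have h3 := hunit.mul_left_cancel (h1.trans h2.symm)
    apply Polynomial.coe_injective K
    have e1 : ((∏ o, (1 - C (ζ o) * X ^ r o) : K[X]) : PowerSeries K) =
        ∏ o, (1 - PowerSeries.C (ζ o) * PowerSeries.X ^ r o) := by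
      have := map_prod (Polynomial.coeToPowerSeries.ringHom (R := K))
        (fun o => (1 - C (ζ o) * X ^ r o : K[X])) Finset.univ
      refine this.trans (Finset.prod_congr rfl fun o _ => ?_)
      simp
    rw [e1, h3]
    simp
  have hr0 : ∀ o, 0 < r o := card_orbitMultiset_pos D.σ
  have hζ0 : ∀ o, ζ o ≠ 0 := fun o => hw _
  have hcases := factor_cases hr0 hζ0 hprod
  have huniq : ∀ o o', ¬ (r o = 1 ∧ ζ o = 1) → ¬ (r o' = 1 ∧ ζ o' = 1) → o = o' :=
    fun o o' => factor_unique hr0 hζ0 hprod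
  let mk : Fin n → PermOrbit D.σ := Quotient.mk (Equiv.Perm.SameCycle.setoid D.σ)
  have hmem : ∀ l, l ∈ orbitMultiset D.σ (mk l) := fun l => mem_orbitMultiset.2 rfl
  have hmem' : ∀ l, D.σ l ∈ orbitMultiset D.σ (mk l) := fun l =>
    mem_orbitMultiset.2 (orbitMk_apply D.σ l)
  have hnodup : ∀ o, (orbitMultiset D.σ o).Nodup := fun o => Finset.nodup _
  have hone : ∀ l, r (mk l) = 1 → orbitMultiset D.σ (mk l) = {l} := by
    intro l hl
    obtain ⟨b, hb⟩ := Multiset.card_eq_one.1 hl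
    have := hmem l
    rw [hb, Multiset.mem_singleton] at this
    rw [hb, this]
  have hfix : ∀ l, r (mk l) = 1 → D.σ l = l := by
    intro l hl
    have := hmem' l
    rwa [hone l hl, Multiset.mem_singleton] at this
  have hζ1 : ∀ l, r (mk l) = 1 → ζ (mk l) = D.c l := by
    intro l hl
    have h1 := hwM _ (map_orbitMultiset D.σ (mk l))
    have h2 : monomialProd (x D.param) ({l} : Multiset (Fin n)) = x D.param l := by
      simp [monomialProd]
    have h3 := hne {l}
    rw [h2] at h3
    change _ = ζ (mk l) • _ at h1
    rw [hone l hl, h2, hom_x, hfix l hl] at h1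
    exact (smul_left_injective K h3 h1).symm
  by_cases hall : ∀ l, r (mk l) = 1
  · left
    refine ⟨Equiv.ext fun l => hfix l (hall l), fun l l' hl hl' => ?_⟩
    have := huniq (mk l) (mk l') (fun h => hl ((hζ1 l (hall l)).symm.trans h.2))
      (fun h => hl' ((hζ1 l' (hall l')).symm.trans h.2))
    have hm := hmem l'
    rw [← this, hone l (hall l), Multiset.mem_singleton] at hm
    exact hm.symm
  · right
    push Not at hall
    obtain ⟨s, hs⟩ := hall
    obtain ⟨hs2, hsζ⟩ := (hcases (mk s)).resolve_left hs
    -- from here on, the orbit of `s` has two elements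
    have hsσ : D.σ s ≠ s := by
      intro h
      have hsub : orbitMultiset D.σ (mk s) ≤ {s} := by
        rw [Multiset.le_iff_subset (hnodup _)]
        intro l hl
        rw [mem_orbitMultiset] at hl
        have hsc : D.σ.SameCycle l s := Quotient.exact hl
        rw [Multiset.mem_singleton]
        exact (hsc.symm.eq_of_left h).symm
      have := Multiset.card_le_card hsub
      rw [Multiset.card_singleton] at this
      have h2 : (orbitMultiset D.σ (mk s)).card = 2 := hs2
      omega
    have horb : orbitMultiset D.σ (mk s) = {s, D.σ s} := by
      have hsub : ({s, D.σ s} : Multiset (Fin n)) ≤ orbitMultiset D.σ (mk s) := by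
        rw [Multiset.le_iff_subset (by simpa using hsσ.symm)]
        intro l hl
        simp only [Multiset.insert_eq_cons, Multiset.mem_cons, Multiset.mem_singleton] at hl
        rcases hl with rfl | rfl
        · exact hmem _
        · exact hmem' _
      refine (Multiset.eq_of_le_of_card_le hsub ?_).symm
      exact (show (orbitMultiset D.σ (mk s)).card = 2 from hs2).le
    have hσσ : D.σ (D.σ s) = s := by
      have h := hmem' (D.σ s)
      have e : mk (D.σ s) = mk s := orbitMk_apply D.σ s
      rw [e, horb] at h
      simp only [Multiset.insert_eq_cons, Multiset.mem_cons, Multiset.mem_singleton] at h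
      exact h.resolve_right fun h => hsσ (D.σ.injective h)
    refine ⟨s, hsσ, hσσ, fun l hl hl' => ?_, ?_⟩
    · have hne' : mk l ≠ mk s := by
        intro h
        have := hmem l
        rw [h, horb] at this
        simp only [Multiset.insert_eq_cons, Multiset.mem_cons, Multiset.mem_singleton] at this
        exact this.elim hl hl'
      have : r (mk l) = 1 ∧ ζ (mk l) = 1 := by
        by_contra h
        exact hne' (huniq _ _ h fun h' => hs h'.1)
      exact ⟨hfix l this.1, (hζ1 l this.1).symm.trans this.2⟩
    · obtain ⟨b, hb, e⟩ := (qCommute_x D.param).prod_eq_smul_monomialProd [s, D.σ s]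
      have e' : x D.param s * x D.param (D.σ s) =
          b • monomialProd (x D.param) (orbitMultiset D.σ (mk s)) := by
        rw [horb]
        simp only [List.map_cons, List.map_nil, List.prod_cons, List.prod_nil, mul_one] at e
        exact e
      have h1 := D.hom_pair hπ hσσ
      have h2 : D.hom hπ (x D.param s * x D.param (D.σ s)) =
          (1 : K) • (x D.param s * x D.param (D.σ s)) := by
        rw [e', map_smul, hwM _ (map_orbitMultiset D.σ (mk s)), one_smul]
        change b • ζ (mk s) • _ = _
        rw [hsζ, one_smul]
      have h3 : x D.param s * x D.param (D.σ s) ≠ 0 := by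
        rw [e']
        exact smul_ne_zero hb (hne _)
      exact smul_left_injective K h3 (h1.symm.trans h2)

end Monomialization

end SkewPoly

/-! ### Monomial bases for finite-order maps that permute subspaces -/

section MonomialBasis

open Module

variable {K V : Type*} [Field K] [AddCommGroup V] [Module K V] [FiniteDimensional K V]

/-- An invariant subspace of a linear map of finite order is spanned by eigenvectors, as many as its
dimension. -/
theorem exists_eigenvectors_span [IsAlgClosed K] [CharZero K] {m : ℕ} (hm : 0 < m)
    (f : End K V) (hf : f ^ m = 1) (W : Submodule K V) (hW : W.map f ≤ W) :
    ∃ (e : Fin (finrank K W) → V) (η : Fin (finrank K W) → K),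
      Submodule.span K (Set.range e) = W ∧ ∀ l, f (e l) = η l • e l := by
  classical
  have hW' : ∀ w ∈ W, f w ∈ W := fun w hw => hW (Submodule.mem_map_of_mem hw)
  set f' : End K W := f.restrict hW' with hf'
  have hpow : ∀ (j : ℕ) (w : W), ((f' ^ j) w : V) = (f ^ j) w := by
    intro j
    induction j with
    | zero => simp
    | succ j ih => intro w; rw [pow_succ, pow_succ, End.mul_apply, End.mul_apply, ih]; rfl
  have hf'm : f' ^ m = 1 := by
    ext w
    rw [hpow, hf]
    rfl
  have hss : f'.IsSemisimple := by
    refine End.isSemisimple_of_squarefree_aeval_eq_zero (p := Polynomial.X ^ m - 1) ?_ ?_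
    · exact ((Polynomial.separable_X_pow_sub_C (1 : K) (Nat.cast_ne_zero.2 hm.ne')
        one_ne_zero).squarefree)
    · simp [hf'm]
  have htop : ⨆ μ : K, f'.eigenspace μ = ⊤ := by
    rw [← End.iSup_maxGenEigenspace_eq_top f']
    exact iSup_congr fun μ => (hss.isFinitelySemisimple.maxGenEigenspace_eq_eigenspace μ).symm
  set S : Set W := {w | ∃ μ : K, f' w = μ • w} with hS
  have hspan : Submodule.span K S = ⊤ := by
    rw [eq_top_iff, ← htop, iSup_le_iff]
    intro μ w hw
    exact Submodule.subset_span ⟨μ, End.mem_eigenspace_iff.1 hw⟩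
  obtain ⟨b, hbS, hbspan, hbli⟩ := exists_linearIndependent K S
  let B : Basis b K W := Basis.mk hbli (by rw [Subtype.range_coe, hbspan, hspan])
  have : Fintype b := FiniteDimensional.fintypeBasisIndex B
  let eq : b ≃ Fin (finrank K W) := Fintype.equivFinOfCardEq (finrank_eq_card_basis B).symm
  have hb : ∀ l : Fin (finrank K W), ∃ μ : K, f' (eq.symm l) = μ • ((eq.symm l : b) : W) :=
    fun l => hbS (eq.symm l).2
  choose η hη using hb
  refine ⟨fun l => ((eq.symm l : b) : W), η, ?_, fun l => congrArg Subtype.val (hη l)⟩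
  have hr : Set.range (fun l => (((eq.symm l : b) : W) : V)) = W.subtype '' b := by
    rw [← Function.comp_def (fun w : b => ((w : W) : V)), eq.symm.surjective.range_comp]
    ext v
    simp
  rw [hr, ← Submodule.map_span, hbspan, hspan, Submodule.map_top, Submodule.range_subtype]

variable {ι : Type*} [Fintype ι]

/-- A linear map of finite order that permutes a decomposition of the space into subspaces is
monomial in a basis adapted to the decomposition. Each cycle of subspaces gets its basis from
eigenvectors of the first return map on one of them, translated along the cycle. -/
theorem exists_monomial_basis [IsAlgClosed K] [CharZero K] {m : ℕ} (hm : 0 < m)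
    (T : End K V) (hT : T ^ m = 1) (W : ι → Submodule K V) (hsup : ⨆ B, W B = ⊤)
    (hdim : ∑ B, finrank K (W B) = finrank K V) (π : Equiv.Perm ι)
    (hπ : ∀ B, (W B).map T = W (π B)) :
    ∃ (y : Basis (Fin (finrank K V)) K V) (bl : Fin (finrank K V) → ι)
      (σ : Equiv.Perm (Fin (finrank K V))) (c : Fin (finrank K V) → K),
      (∀ B, W B = Submodule.span K (y '' {l | bl l = B})) ∧ (∀ l, c l ≠ 0) ∧
      (∀ l, T (y l) = c l • y (σ l)) ∧ (∀ l, bl (σ l) = π (bl l)) ∧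
      (∀ l, σ l ≠ l → bl (σ l) ≠ bl l) := by
  classical
  have hTinj : ∀ j : ℕ, Function.Injective (T ^ j) := by
    have h1 : Function.Injective T := by
      intro v w h
      have : (T ^ m) v = (T ^ m) w := by
        obtain ⟨j, rfl⟩ := Nat.exists_eq_succ_of_ne_zero hm.ne'
        rw [pow_succ, End.mul_apply, End.mul_apply, h]
      rwa [hT] at this
    intro j
    rw [Module.End.coe_pow]
    exact h1.iterate j
  have hπpow : ∀ (j : ℕ) B, (W B).map (T ^ j) = W ((π ^ j) B) := by
    intro j
    induction j with
    | zero => intro B; simp [End.one_eq_id]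
    | succ j ih =>
      intro B
      rw [pow_succ', pow_succ', End.mul_eq_comp, Submodule.map_comp, ih, hπ]
      rfl
  have hhit : ∀ B : ι, ∃ j : ℕ,
      (π ^ j) (Quotient.mk (Equiv.Perm.SameCycle.setoid π) B).out = B := by
    intro B
    obtain ⟨j, -, -, e⟩ := Equiv.Perm.SameCycle.exists_pow_eq'' (f := π)
      (Quotient.exact (s := Equiv.Perm.SameCycle.setoid π)
        (Quotient.out_eq (Quotient.mk (Equiv.Perm.SameCycle.setoid π) B)))
    exact ⟨j, e⟩
  -- `τ B` is the number of steps from the representative of the cycle of `B` to `B`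
  let τ : ι → ℕ := fun B => Nat.find (hhit B)
  have hτ : ∀ B, (π ^ τ B) (Quotient.mk (Equiv.Perm.SameCycle.setoid π) B).out = B :=
    fun B => Nat.find_spec (hhit B)
  have hτout : ∀ o : PermOrbit π, τ o.out = 0 := by
    intro o
    apply (Nat.find_eq_zero (hhit o.out)).2
    rw [pow_zero, Quotient.out_eq]
    rfl
  have hτsucc : ∀ B, π B ≠ (Quotient.mk (Equiv.Perm.SameCycle.setoid π) B).out →
      τ (π B) = τ B + 1 := by
    intro B hB
    have hmk := orbitMk_apply π B
    apply le_antisymm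
    · apply Nat.find_min'
      rw [hmk, pow_succ', Equiv.Perm.mul_apply, hτ]
    · have h0 : τ (π B) ≠ 0 := by
        intro h0
        have := hτ (π B)
        rw [h0, hmk, pow_zero, Equiv.Perm.one_apply] at this
        exact hB this.symm
      obtain ⟨j, hj⟩ := Nat.exists_eq_succ_of_ne_zero h0
      rw [hj]
      apply Nat.succ_le_succ
      apply Nat.find_min'
      have := hτ (π B)
      rw [hj, hmk, Nat.succ_eq_add_one, pow_succ', Equiv.Perm.mul_apply] at this
      exact π.injective this
  -- the first return to the representative takes one more step than its predecessor on the cycle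
  have hret : ∀ o : PermOrbit π, (π ^ (τ (π.symm o.out) + 1)) o.out = o.out := by
    intro o
    have h1 : (Quotient.mk (Equiv.Perm.SameCycle.setoid π) (π.symm o.out)) = o := by
      rw [← orbitMk_apply π, Equiv.apply_symm_apply, Quotient.out_eq]
    have h2 := hτ (π.symm o.out)
    rw [h1] at h2
    rw [pow_succ', Equiv.Perm.mul_apply, h2, Equiv.apply_symm_apply]
  have heig := fun o : PermOrbit π => exists_eigenvectors_span hm (T ^ (τ (π.symm o.out) + 1))
    (by rw [← pow_mul, mul_comm, pow_mul, hT, one_pow]) (W o.out) (by rw [hπpow, hret])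
  choose e η hspan hη using heig
  let I := Σ o : PermOrbit π,
    {B : ι // Quotient.mk (Equiv.Perm.SameCycle.setoid π) B = o} × Fin (finrank K (W o.out))
  let y₀ : I → V := fun z => (T ^ τ z.2.1) (e z.1 z.2.2)
  let bl₀ : I → ι := fun z => z.2.1
  let σ₀ : Equiv.Perm I := Equiv.sigmaCongrRight fun o =>
    (π.subtypePerm fun B => by rw [orbitMk_apply]).prodCongr (Equiv.refl _)
  have hWspan : ∀ B, W B = Submodule.span K (y₀ '' {z | bl₀ z = B}) := by
    intro B
    set o : PermOrbit π := Quotient.mk (Equiv.Perm.SameCycle.setoid π) B with ho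
    have h1 : W B = (W o.out).map (T ^ τ B) := by rw [hπpow, hτ]
    rw [h1, ← hspan o, Submodule.map_span, ← Set.range_comp]
    congr 1
    ext v
    constructor
    · rintro ⟨l, rfl⟩
      exact ⟨⟨o, ⟨⟨B, rfl⟩, l⟩⟩, rfl, rfl⟩
    · rintro ⟨⟨o', ⟨⟨B', hB'⟩, l⟩⟩, hz, rfl⟩
      obtain rfl : B' = B := hz
      subst hB'
      exact ⟨l, rfl⟩
  have hcard : Fintype.card I = finrank K V := by
    rw [← hdim, Fintype.card_sigma,
      ← (Equiv.sigmaFiberEquiv (Quotient.mk (Equiv.Perm.SameCycle.setoid π))).sum_comp,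
      Fintype.sum_sigma]
    refine Finset.sum_congr rfl fun o _ => ?_
    rw [Fintype.card_prod, Fintype.card_fin, ← smul_eq_mul, ← Finset.card_univ,
      ← Finset.sum_const]
    refine Finset.sum_congr rfl fun B _ => ?_
    obtain ⟨B, rfl⟩ := B
    change finrank K (W _) = finrank K (W B)
    conv_rhs => rw [← hτ B, ← hπpow]
    exact (Submodule.equivMapOfInjective _ (hTinj _) _).finrank_eq
  let E : I ≃ Fin (finrank K V) := Fintype.equivFinOfCardEq hcard
  have hy₀ : ⊤ ≤ Submodule.span K (Set.range y₀) := by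
    rw [← hsup, iSup_le_iff]
    intro B
    rw [hWspan]
    exact Submodule.span_mono (Set.image_subset_range _ _)
  let y : Basis (Fin (finrank K V)) K V :=
    (basisOfTopLeSpanOfCardEqFinrank y₀ hy₀ hcard).reindex E
  have hy : ∀ l, y l = y₀ (E.symm l) := by
    intro l
    rw [Basis.reindex_apply, coe_basisOfTopLeSpanOfCardEqFinrank]
  have hstep : ∀ z : I, ∃ c : K, T (y₀ z) = c • y₀ (σ₀ z) := by
    rintro ⟨o, ⟨⟨B, hB⟩, l⟩⟩
    have h1 : T (y₀ ⟨o, ⟨⟨B, hB⟩, l⟩⟩) = (T ^ (τ B + 1)) (e o l) := by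
      rw [pow_succ', End.mul_apply]
    have h2 : y₀ (σ₀ ⟨o, ⟨⟨B, hB⟩, l⟩⟩) = (T ^ τ (π B)) (e o l) := rfl
    rw [h1, h2]
    by_cases hBo : π B = o.out
    · refine ⟨η o l, ?_⟩
      have h3 : B = π.symm o.out := by rw [← hBo, Equiv.symm_apply_apply]
      have h4 := hη o l
      rw [← h3] at h4
      rw [h4, hBo, hτout, pow_zero, End.one_apply]
    · exact ⟨1, by rw [hτsucc B (by rwa [hB]), one_smul]⟩
  choose c₀ hc₀ using hstep
  refine ⟨y, fun l => bl₀ (E.symm l), (E.symm.trans σ₀).trans E, fun l => c₀ (E.symm l), ?_, ?_,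
    ?_, ?_, ?_⟩
  · intro B
    rw [hWspan B]
    congr 1
    ext v
    constructor
    · rintro ⟨z, hz, rfl⟩
      exact ⟨E z, by simpa using hz, by rw [hy, Equiv.symm_apply_apply]⟩
    · rintro ⟨l, hl, rfl⟩
      exact ⟨E.symm l, hl, (hy l).symm⟩
  · intro l hl
    have h1 := hc₀ (E.symm l)
    have hl' : c₀ (E.symm l) = 0 := hl
    rw [hl', zero_smul, ← hy] at h1
    have h2 := hTinj 1
    rw [pow_one] at h2
    exact y.ne_zero l (h2 (h1.trans (map_zero T).symm))
  · intro l
    rw [hy, hy, hc₀]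
    simp
  · intro l
    simp only [Equiv.trans_apply, Equiv.symm_apply_apply]
    rfl
  · intro l hl h
    apply hl
    simp only [Equiv.trans_apply, Equiv.symm_apply_apply] at h ⊢
    rw [← Equiv.eq_symm_apply]
    generalize E.symm l = z at h ⊢
    obtain ⟨o, ⟨⟨B, hB⟩, l⟩⟩ := z
    have h' : π B = B := h
    refine Sigma.ext rfl (heq_of_eq (Prod.ext (Subtype.ext h') rfl))

end MonomialBasis

namespace SkewPoly

variable {k : Type*} [Field k] {n : ℕ}

/-- A graded automorphism of finite order is monomial over an algebraically closed field, in
coordinates that respect the blocks. -/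
theorem exists_monomialization {K : Type*} [Field K] [Algebra k K] [IsAlgClosed K] [CharZero K]
    {p : Fin n → Fin n → kˣ} (g : gradedAut p) {m : ℕ} (hm : 0 < m) (hg : g ^ m = 1)
    {π : Equiv.Perm (Quotient (blockSetoid p))}
    (hπ : ∀ i u, act p g (Pi.single i 1) u ≠ 0 → (⟦u⟧ : Quotient (blockSetoid p)) = π ⟦i⟧) :
    Nonempty (Monomialization K g π) := by
  classical
  let A : gradedAut p → Matrix (Fin n) (Fin n) k := fun h =>
    LinearMap.toMatrix' (act p h).toLinearMap
  have hA : ∀ h u i, A h u i = act p h (Pi.single i 1) u := by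
    intro h u i
    simp [A, LinearMap.toMatrix'_apply]
  let T : gradedAut p → Module.End K (Fin n → K) := fun h =>
    Matrix.toLin' ((A h).map (algebraMap k K))
  have hTmul : ∀ h h', T (h * h') = T h * T h' := by
    intro h h'
    have : A (h * h') = A h * A h' := by
      rw [← LinearMap.toMatrix'_comp]
      simp only [A, map_mul]
      rfl
    simp only [T]
    rw [this, Matrix.map_mul, Matrix.toLin'_mul]
    rfl
  have hT1 : T 1 = 1 := by
    have : A 1 = 1 := by
      simp only [A, map_one]
      exact LinearMap.toMatrix'_id
    simp only [T]
    rw [this, Matrix.map_one _ (map_zero _) (map_one _), Matrix.toLin'_one]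
    rfl
  have hTpow : T g ^ m = 1 := by
    have : ∀ j : ℕ, T g ^ j = T (g ^ j) := by
      intro j
      induction j with
      | zero => rw [pow_zero, pow_zero, hT1]
      | succ j ih => rw [pow_succ, pow_succ, hTmul, ih]
    rw [this, hg, hT1]
  have hTsingle : ∀ h i, T h (Pi.single i 1) =
      fun u => algebraMap k K (act p h (Pi.single i 1) u) := by
    intro h i
    funext u
    rw [← hA]
    simp [T]
  let W : Quotient (blockSetoid p) → Submodule K (Fin n → K) := fun B =>
    Submodule.span K (Pi.basisFun K (Fin n) '' {i | (⟦i⟧ : Quotient (blockSetoid p)) = B})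
  have hW : ∀ B v, v ∈ W B ↔ ∀ u, v u ≠ 0 → (⟦u⟧ : Quotient (blockSetoid p)) = B := by
    intro B v
    rw [Module.Basis.mem_span_image]
    simp [Set.subset_def, Finsupp.mem_support_iff]
  have hmap_le : ∀ (h : gradedAut p) (ρ : Equiv.Perm (Quotient (blockSetoid p))),
      (∀ i u, act p h (Pi.single i 1) u ≠ 0 → (⟦u⟧ : Quotient (blockSetoid p)) = ρ ⟦i⟧) →
      ∀ B, (W B).map (T h) ≤ W (ρ B) := by
    intro h ρ hρ B
    rw [Submodule.map_span, Submodule.span_le]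
    rintro _ ⟨_, ⟨i, hi, rfl⟩, rfl⟩
    rw [SetLike.mem_coe, hW, Pi.basisFun_apply, hTsingle]
    intro u hu
    rw [hρ i u fun h0 => hu (by simp only [h0, map_zero]), show (⟦i⟧ : Quotient _) = B from hi]
  -- the inverse of `g` induces the inverse permutation of the blocks
  have hinv : ∀ i u, act p g⁻¹ (Pi.single i 1) u ≠ 0 →
      (⟦u⟧ : Quotient (blockSetoid p)) = π.symm ⟦i⟧ := by
    intro i u hu
    obtain ⟨ρ, hρ⟩ := exists_blockPerm g⁻¹
    have hρπ : ∀ B, (W B) ≤ W (π (ρ B)) := by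
      intro B
      calc W B = (W B).map (T g * T g⁻¹) := by
            rw [← hTmul, mul_inv_cancel, hT1, Module.End.one_eq_id, Submodule.map_id]
        _ = ((W B).map (T g⁻¹)).map (T g) := Submodule.map_comp _ _ _
        _ ≤ W (π (ρ B)) := (Submodule.map_mono (hmap_le _ _ hρ B)).trans (hmap_le _ _ hπ _)
    have h1 : (⟦i⟧ : Quotient (blockSetoid p)) = π (ρ ⟦i⟧) := by
      have : (Pi.single i 1 : Fin n → K) ∈ W ⟦i⟧ := by
        rw [hW]
        intro u hu
        by_cases h : u = i
        · rw [h]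
        · simp [h] at hu
      exact (hW _ _).1 (hρπ _ this) i (by simp)
    rw [hρ i u hu, h1, Equiv.symm_apply_apply, ← h1]
  have hmap : ∀ B, (W B).map (T g) = W (π B) := by
    intro B
    apply le_antisymm (hmap_le g π hπ B)
    calc W (π B) = (W (π B)).map (T g * T g⁻¹) := by
          rw [← hTmul, mul_inv_cancel, hT1, Module.End.one_eq_id, Submodule.map_id]
      _ = ((W (π B)).map (T g⁻¹)).map (T g) := Submodule.map_comp _ _ _
      _ ≤ (W (π.symm (π B))).map (T g) := Submodule.map_mono (hmap_le _ _ hinv _)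
      _ = (W B).map (T g) := by rw [Equiv.symm_apply_apply]
  have hsup : ⨆ B, W B = ⊤ := by
    rw [eq_top_iff, ← (Pi.basisFun K (Fin n)).span_eq, Submodule.span_le]
    rintro _ ⟨i, rfl⟩
    exact Submodule.mem_iSup_of_mem ⟦i⟧ (Submodule.subset_span ⟨i, rfl, rfl⟩)
  have : Fintype (Quotient (blockSetoid p)) := Fintype.ofFinite _
  have hdim : ∑ B, Module.finrank K (W B) = Module.finrank K (Fin n → K) := by
    rw [Module.finrank_fin_fun]
    conv_rhs => rw [← Fintype.card_fin n,
      Fintype.card_congr (Equiv.sigmaFiberEquiv (Quotient.mk (blockSetoid p))).symm,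
      Fintype.card_sigma]
    refine Finset.sum_congr rfl fun B _ => ?_
    have hli := (Pi.basisFun K (Fin n)).linearIndependent.comp
      (fun i : {i // (⟦i⟧ : Quotient (blockSetoid p)) = B} => (i : Fin n)) Subtype.val_injective
    have hr : Set.range (fun i : {i // (⟦i⟧ : Quotient (blockSetoid p)) = B} => (i : Fin n)) =
        {i | (⟦i⟧ : Quotient (blockSetoid p)) = B} := Subtype.range_coe
    rw [← finrank_span_eq_card hli, Set.range_comp, hr]
  have hn : Module.finrank K (Fin n → K) = n := Module.finrank_fin_fun K
  have hex := exists_monomial_basis hm (T g) hTpow W hsup hdim π hmap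
  rw [hn] at hex
  obtain ⟨y, bl, σ, c, hWy, hc, hTy, hblσ, hσne⟩ := hex
  have hbl_mem : ∀ l, y l ∈ W (bl l) := fun l => by
    rw [hWy]; exact Submodule.subset_span ⟨l, rfl, rfl⟩
  refine ⟨{
    Z := Matrix.of fun i l => y l i
    U := Matrix.of fun l i => y.repr (Pi.single i 1) l
    bl := bl
    σ := σ
    c := c
    c_ne_zero := hc
    Z_mul_U := ?_
    bl_of_U_ne_zero := ?_
    bl_of_Z_ne_zero := fun i l h => ((hW _ _).1 (hbl_mem l) i h).symm
    bl_σ := hblσ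
    bl_σ_ne := hσne
    U_mul := ?_ }⟩
  · ext i j
    rw [Matrix.mul_apply, Matrix.one_apply]
    have := congrFun (y.sum_repr (Pi.single j 1)) i
    simp only [Finset.sum_apply, Pi.smul_apply, smul_eq_mul, Pi.single_apply] at this
    rw [← this]
    exact Finset.sum_congr rfl fun l _ => mul_comm _ _
  · intro l i h
    have h1 : (Pi.single i 1 : Fin n → K) ∈ W ⟦i⟧ :=
      Submodule.subset_span ⟨i, rfl, by simp⟩
    rw [hWy, Module.Basis.mem_span_image] at h1
    exact h1 (Finsupp.mem_support_iff.2 h)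
  · intro l i
    have hv : ∀ v : Fin n → K, ∀ l, y.repr (T g v) (σ l) = c l * y.repr v l := by
      intro v l
      conv_lhs => rw [← y.sum_repr v, map_sum]
      simp only [map_smul, hTy, map_sum, Module.Basis.repr_self, Finsupp.finsetSum_apply,
        Finsupp.smul_apply, Finsupp.single_apply, smul_eq_mul, mul_ite, mul_one, mul_zero,
        EmbeddingLike.apply_eq_iff_eq, Finset.sum_ite_eq', Finset.mem_univ, if_true]
      exact mul_comm _ _
    simp only [Matrix.of_apply]
    rw [← hv, hTsingle]
    have hdec := pi_eq_sum_univ (fun u => algebraMap k K (act p g (Pi.single i 1) u))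
    conv_rhs => rw [hdec]
    simp only [map_sum, map_smul, Finsupp.finsetSum_apply, Finsupp.smul_apply, smul_eq_mul]
    refine Finset.sum_congr rfl fun v _ => ?_
    rw [mul_comm]
    congr 3
    funext j
    simp [Pi.single_apply, eq_comm]

end SkewPoly

/-! ### Monomial linear maps -/

section MonomialMap

variable {k ι : Type*} [Field k]

/-- The linear map of `k^ι` that sends the basis vector of index `i` to `d i` times that of index
`σ i`. -/
def monomialMap (d : ι → kˣ) (σ : Equiv.Perm ι) : (ι → k) ≃ₗ[k] (ι → k) where
  toFun v u := d (σ.symm u) * v (σ.symm u)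
  map_add' v w := funext fun u => mul_add _ _ _
  map_smul' c v := funext fun u => by simp only [Pi.smul_apply, smul_eq_mul, RingHom.id_apply]; ring
  invFun v i := ((d i)⁻¹ : kˣ) * v (σ i)
  left_inv v := funext fun i => by simp
  right_inv v := funext fun u => by simp

theorem monomialMap_apply (d : ι → kˣ) (σ : Equiv.Perm ι) (v : ι → k) (u : ι) :
    monomialMap d σ v u = d (σ.symm u) * v (σ.symm u) := rfl

variable [DecidableEq ι]

theorem monomialMap_single (d : ι → kˣ) (σ : Equiv.Perm ι) (i : ι) (a : k) :
    monomialMap d σ (Pi.single i a) = Pi.single (σ i) (d i * a) := by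
  funext u
  rw [monomialMap_apply]
  by_cases h : u = σ i
  · subst h
    simp
  · rw [Pi.single_eq_of_ne h, Pi.single_eq_of_ne, mul_zero]
    rintro rfl
    exact h (by simp)

theorem linearEquiv_ext_single [Finite ι] {f g : (ι → k) ≃ₗ[k] (ι → k)}
    (h : ∀ i, f (Pi.single i 1) = g (Pi.single i 1)) : f = g :=
  LinearEquiv.toLinearMap_injective (LinearMap.pi_ext' fun i => LinearMap.ext_ring (h i))

theorem monomialMap_inj [Finite ι] {d d' : ι → kˣ} {σ σ' : Equiv.Perm ι} :
    monomialMap d σ = monomialMap d' σ' ↔ d = d' ∧ σ = σ' := by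
  constructor
  · intro h
    have key : ∀ i, σ i = σ' i ∧ d i = d' i := by
      intro i
      have h1 := LinearEquiv.congr_fun h (Pi.single i 1)
      rw [monomialMap_single, monomialMap_single, mul_one, mul_one] at h1
      have h2 := congrFun h1 (σ i)
      rw [Pi.single_eq_same] at h2
      by_cases hσ : σ i = σ' i
      · rw [hσ, Pi.single_eq_same] at h2
        exact ⟨hσ, Units.ext h2⟩
      · rw [Pi.single_eq_of_ne hσ] at h2
        exact absurd h2 (d i).ne_zero
    exact ⟨funext fun i => (key i).2, Equiv.ext fun i => (key i).1⟩
  · rintro ⟨rfl, rfl⟩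
    rfl

/-- The linear reflection multiplying the coordinate of index `s` by `c`. -/
def thetaLin (s : ι) (c : kˣ) : (ι → k) ≃ₗ[k] (ι → k) :=
  monomialMap (Function.update 1 s c) 1

/-- The linear mystic reflection: on basis vectors, `e_s ↦ c e_t` and `e_t ↦ -c⁻¹ e_s`. -/
def tauLin (s t : ι) (c : kˣ) : (ι → k) ≃ₗ[k] (ι → k) :=
  monomialMap (Function.update (Function.update 1 t (-c⁻¹)) s c) (Equiv.swap s t)

theorem thetaLin_single (s : ι) (c : kˣ) (i : ι) :
    thetaLin s c (Pi.single i (1 : k)) =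
      if i = s then (c : k) • Pi.single s 1 else Pi.single i 1 := by
  rw [thetaLin, monomialMap_single]
  split_ifs with h
  · subst h
    simp [← Pi.single_smul]
  · simp [h]

theorem tauLin_single {s t : ι} (hst : s ≠ t) (c : kˣ) (i : ι) :
    tauLin s t c (Pi.single i (1 : k)) =
      if i = s then (c : k) • Pi.single t 1
      else if i = t then -((c⁻¹ : kˣ) : k) • Pi.single s 1 else Pi.single i 1 := by
  rw [tauLin, monomialMap_single]
  split_ifs with h h'
  · subst h
    simp [← Pi.single_smul]
  · subst h'
    simp [← Pi.single_smul, hst.symm, Pi.single_neg]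
  · simp [h, h', Equiv.swap_apply_of_ne_of_ne]

end MonomialMap

/-! ### The two kinds of quasi-reflections -/

namespace SkewPoly

variable {k : Type*} [Field k] {n : ℕ}

/-- The matrix of `g` in terms of the monomializing coordinates. -/
theorem Monomialization.algebraMap_act {K : Type*} [Field K] [Algebra k K]
    {p : Fin n → Fin n → kˣ} {g : gradedAut p} {π : Equiv.Perm (Quotient (blockSetoid p))}
    (D : Monomialization K g π) (i u : Fin n) :
    algebraMap k K (act p g (Pi.single i 1) u) = ∑ l, D.Z u (D.σ l) * (D.c l * D.U l i) := by
  simp only [← D.U_mul, Finset.mul_sum]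
  rw [Finset.sum_comm]
  have : ∀ v, ∑ l, D.Z u (D.σ l) *
      (D.U (D.σ l) v * algebraMap k K (act p g (Pi.single i 1) v)) =
      (D.Z * D.U) u v * algebraMap k K (act p g (Pi.single i 1) v) := by
    intro v
    rw [Equiv.sum_comp D.σ fun m => D.Z u m *
      (D.U m v * algebraMap k K (act p g (Pi.single i 1) v)), Matrix.mul_apply, Finset.sum_mul]
    exact Finset.sum_congr rfl fun l _ => (mul_assoc _ _ _).symm
  simp only [this, D.Z_mul_U, Matrix.one_apply, ite_mul, one_mul, zero_mul, Finset.sum_ite_eq,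
    Finset.mem_univ, if_true]

/-- The linear map `f` differs from the identity by a map of rank at most one that vanishes on the
variables outside the block `B` and has its image in the span of those in `B`. -/
def IsBlockReflection (p : Fin n → Fin n → kˣ) (f : (Fin n → k) ≃ₗ[k] (Fin n → k))
    (B : Quotient (blockSetoid p)) : Prop :=
  ∃ φ v : Fin n → k, (∀ i, φ i ≠ 0 → (⟦i⟧ : Quotient (blockSetoid p)) = B) ∧
    (∀ u, v u ≠ 0 → (⟦u⟧ : Quotient (blockSetoid p)) = B) ∧
    ∀ i, f (Pi.single i 1) = Pi.single i 1 + φ i • v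

/-- If `g` is diagonal in the new variables, with at most one entry other than `1`, then it
differs from the identity by a map of rank at most one over `K`, and hence over `k`. -/
theorem isBlockReflection_of_monomialization {K : Type*} [Field K] [Algebra k K]
    {p : Fin n → Fin n → kˣ} {g : gradedAut p} {π : Equiv.Perm (Quotient (blockSetoid p))}
    (D : Monomialization K g π) (hn : 1 ≤ n) (hσ : D.σ = 1)
    (hc : ∀ l l', D.c l ≠ 1 → D.c l' ≠ 1 → l = l') :
    ∃ B, IsBlockReflection p (act p g) B := by
  obtain ⟨l₀, hl₀⟩ : ∃ l₀, ∀ l, l ≠ l₀ → D.c l = 1 := by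
    by_cases h : ∃ l, D.c l ≠ 1
    · obtain ⟨l₀, h0⟩ := h
      exact ⟨l₀, fun l hl => by_contra fun h => hl (hc l l₀ h h0)⟩
    · push Not at h
      exact ⟨⟨0, hn⟩, fun l _ => h l⟩
  let M : Fin n → Fin n → k := fun u i => act p g (Pi.single i 1) u - (Pi.single i 1 : Fin n → k) u
  have hM : ∀ u i, algebraMap k K (M u i) = D.Z u l₀ * ((D.c l₀ - 1) * D.U l₀ i) := by
    intro u i
    have h1 : algebraMap k K ((Pi.single i 1 : Fin n → k) u) = ∑ l, D.Z u l * D.U l i := by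
      rw [← Matrix.mul_apply, D.Z_mul_U, Matrix.one_apply, Pi.single_apply]
      split_ifs <;> simp
    simp only [M]
    rw [map_sub, D.algebraMap_act, h1, ← Finset.sum_sub_distrib, Finset.sum_eq_single l₀]
    · rw [hσ, Equiv.Perm.one_apply]
      ring
    · intro l _ hl
      rw [hσ, Equiv.Perm.one_apply, hl₀ l hl]
      ring
    · simp
  have hblock : ∀ u i, M u i ≠ 0 → D.bl l₀ = ⟦u⟧ ∧ D.bl l₀ = ⟦i⟧ := by
    intro u i h
    have h1 : algebraMap k K (M u i) ≠ 0 := by simpa using h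
    rw [hM] at h1
    exact ⟨D.bl_of_Z_ne_zero _ _ (left_ne_zero_of_mul h1),
      D.bl_of_U_ne_zero _ _ (right_ne_zero_of_mul (right_ne_zero_of_mul h1))⟩
  have hminor : ∀ u v i j, M u i * M v j = M u j * M v i := by
    intro u v i j
    apply (algebraMap k K).injective
    rw [map_mul, map_mul, hM, hM, hM, hM]
    ring
  have hact : ∀ i, act p g (Pi.single i 1) = Pi.single i 1 + fun u => M u i := by
    intro i
    funext u
    simp [M]
  refine ⟨D.bl l₀, ?_⟩
  by_cases h : ∃ u i, M u i ≠ 0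
  · obtain ⟨u₀, i₀, h0⟩ := h
    refine ⟨fun i => M u₀ i / M u₀ i₀, fun u => M u i₀, fun i hi => ?_, fun u hu => ?_,
      fun i => ?_⟩
    · exact (hblock u₀ i fun h => hi (by simp [h])).2.symm
    · exact (hblock u i₀ hu).1.symm
    · rw [hact]
      congr 1
      funext u
      rw [Pi.smul_apply, smul_eq_mul, div_mul_eq_mul_div, eq_div_iff h0, mul_comm, hminor]
  · push Not at h
    refine ⟨0, 0, by simp, by simp, fun i => ?_⟩
    rw [hact]
    congr 1
    funext u
    simp [h u i]

/-- If `g` interchanges two new variables and fixes the others, then these are up to scalars two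
of the old variables, each alone in its block. The product of the two variables being fixed makes
`g` a mystic reflection, once their commutation scalar is known to be `-1`: it is its own inverse
since `g` interchanges the two variables, and it is not `1` since their blocks are different. -/
theorem eq_tauLin_of_monomialization {K : Type*} [Field K] [Algebra k K]
    {p : Fin n → Fin n → kˣ} {g : gradedAut p} {π : Equiv.Perm (Quotient (blockSetoid p))}
    (D : Monomialization K g π) {s' : Fin n} (hs : D.σ s' ≠ s') (hss : D.σ (D.σ s') = s')
    (hfix : ∀ l, l ≠ s' → l ≠ D.σ s' → D.σ l = l ∧ D.c l = 1)
    (hc : D.c s' * D.c (D.σ s') * D.param s' (D.σ s') = 1) :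
    ∃ (s t : Fin n) (c : kˣ), s ≠ t ∧ commParam p s t = -1 ∧ act p g = tauLin s t c := by
  set t' := D.σ s' with ht'
  have hB : D.bl t' ≠ D.bl s' := D.bl_σ_ne s' hs
  have hfibs : ∀ l, D.bl l = D.bl s' → l = s' := by
    intro l hl
    by_contra hls
    have hlt : l ≠ t' := fun h => hB (h ▸ hl)
    have h1 := D.bl_σ l
    rw [(hfix l hls hlt).1, hl, ← D.bl_σ s'] at h1
    exact hB h1.symm
  have hfibt : ∀ l, D.bl l = D.bl t' → l = t' := by
    intro l hl
    by_contra hlt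
    have hls : l ≠ s' := fun h => hB (h ▸ hl).symm
    have h1 := D.bl_σ l
    rw [(hfix l hls hlt).1] at h1
    have h2 : π (D.bl l) = π (D.bl s') := by rw [← h1, hl, ht', D.bl_σ s']
    exact hls (hfibs l (π.injective h2))
  -- a block with a single new variable has a single old variable
  have hsingle : ∀ l₀, (∀ l, D.bl l = D.bl l₀ → l = l₀) →
      ∃ i, D.bl l₀ = ⟦i⟧ ∧ D.Z i l₀ * D.U l₀ i = 1 ∧ ∀ j, D.bl l₀ = ⟦j⟧ → j = i := by
    intro l₀ h
    have hZU : ∀ i j, D.bl l₀ = ⟦j⟧ → D.Z i l₀ * D.U l₀ j = if i = j then 1 else 0 := by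
      intro i j hj
      rw [← Matrix.one_apply, ← D.Z_mul_U, Matrix.mul_apply, Finset.sum_eq_single l₀]
      · intro l _ hl
        by_contra hne
        exact hl (h l ((D.bl_of_U_ne_zero l j (right_ne_zero_of_mul hne)).trans hj.symm))
      · simp
    obtain ⟨i, hi⟩ : ∃ i, D.U l₀ i ≠ 0 := by
      by_contra! h0
      have := congrFun (congrFun D.U_mul_Z l₀) l₀
      rw [Matrix.mul_apply, Matrix.one_apply_eq] at this
      simp [h0] at this
    have hbi := D.bl_of_U_ne_zero l₀ i hi
    have h1 := hZU i i hbi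
    rw [if_pos rfl] at h1
    refine ⟨i, hbi, h1, fun j hj => ?_⟩
    by_contra hne
    have h2 := hZU j j hj
    rw [if_pos rfl] at h2
    have h3 := hZU i j hj
    rw [if_neg (Ne.symm hne)] at h3
    exact (mul_ne_zero (left_ne_zero_of_mul_eq_one h1) (right_ne_zero_of_mul_eq_one h2)) h3
  obtain ⟨s, hbs, hZs, hus⟩ := hsingle s' hfibs
  obtain ⟨t, hbt, hZt, hut⟩ := hsingle t' hfibt
  have hst : s ≠ t := by
    rintro rfl
    exact hB (hbt.trans hbs.symm)
  -- the images of the variables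
  have hAs : ∀ u, algebraMap k K (act p g (Pi.single s 1) u) = D.Z u t' * (D.c s' * D.U s' s) := by
    intro u
    rw [D.algebraMap_act, Finset.sum_eq_single s']
    · intro l _ hl
      by_contra hne
      exact hl (hfibs l ((D.bl_of_U_ne_zero l s
        (right_ne_zero_of_mul (right_ne_zero_of_mul hne))).trans hbs.symm))
    · simp
  have hAt : ∀ u, algebraMap k K (act p g (Pi.single t 1) u) = D.Z u s' * (D.c t' * D.U t' t) := by
    intro u
    rw [D.algebraMap_act, Finset.sum_eq_single t', hss]
    · intro l _ hl
      by_contra hne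
      exact hl (hfibt l ((D.bl_of_U_ne_zero l t
        (right_ne_zero_of_mul (right_ne_zero_of_mul hne))).trans hbt.symm))
    · simp
  have hsu : ∀ u, u ≠ t → act p g (Pi.single s 1) u = 0 := by
    intro u hu
    by_contra h0
    have : algebraMap k K (act p g (Pi.single s 1) u) ≠ 0 := by simpa using h0
    rw [hAs] at this
    exact hu (hut u (D.bl_of_Z_ne_zero _ _ (left_ne_zero_of_mul this)))
  have htu : ∀ u, u ≠ s → act p g (Pi.single t 1) u = 0 := by
    intro u hu
    by_contra h0
    have : algebraMap k K (act p g (Pi.single t 1) u) ≠ 0 := by simpa using h0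
    rw [hAt] at this
    exact hu (hus u (D.bl_of_Z_ne_zero _ _ (left_ne_zero_of_mul this)))
  have hi : ∀ i, i ≠ s → i ≠ t → act p g (Pi.single i 1) = Pi.single i 1 := by
    intro i his hit
    funext u
    apply (algebraMap k K).injective
    have h1 : algebraMap k K ((Pi.single i 1 : Fin n → k) u) = ∑ l, D.Z u l * D.U l i := by
      rw [← Matrix.mul_apply, D.Z_mul_U, Matrix.one_apply, Pi.single_apply]
      split_ifs <;> simp
    rw [D.algebraMap_act, h1]
    refine Finset.sum_congr rfl fun l _ => ?_
    by_cases hU : D.U l i = 0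
    · simp [hU]
    have hbl := D.bl_of_U_ne_zero l i hU
    have hls : l ≠ s' := fun h => his (hus i (h ▸ hbl))
    have hlt : l ≠ t' := fun h => hit (hut i (h ▸ hbl))
    rw [(hfix l hls hlt).1, (hfix l hls hlt).2, one_mul]
  set α := act p g (Pi.single s 1) t with hα
  set β := act p g (Pi.single t 1) s with hβ
  -- the condition on the scalars, in the old variables
  have hαβ : α * β * commParam p s t = 1 := by
    apply (algebraMap k K).injective
    rw [map_mul, map_mul, map_one, hα, hβ, hAs, hAt, ← hc, Monomialization.param, hbs, hbt,
      blockParam_mk]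
    simp only [Units.coe_map, RingHom.toMonoidHom_eq_coe, MonoidHom.coe_coe]
    linear_combination (D.c s' * D.c t' * algebraMap k K (commParam p s t)) *
      (D.Z t t' * D.U t' t * hZs + hZt)
  have hα0 : α ≠ 0 := left_ne_zero_of_mul (left_ne_zero_of_mul_eq_one hαβ)
  have hβ0 : β ≠ 0 := right_ne_zero_of_mul (left_ne_zero_of_mul_eq_one hαβ)
  have hq : commParam p t s = commParam p s t := commParam_eq_of_act_ne_zero g hα0 hβ0
  have hqother : ∀ u, u ≠ s → u ≠ t → commParam p t u = commParam p s u := by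
    intro u hus hut
    refine commParam_eq_of_act_ne_zero g hα0 ?_
    rw [hi u hus hut, Pi.single_eq_same]
    exact one_ne_zero
  have hq1 : commParam p s t ≠ 1 := by
    intro h
    apply hB
    rw [hbs, hbt]
    refine Quotient.sound fun u => ?_
    by_cases hus : u = s
    · rw [hus, hq, h, commParam_self]
    by_cases hut : u = t
    · rw [hut, h, commParam_self]
    exact hqother u hus hut
  have hqm : commParam p s t = -1 := by
    rw [commParam_symm p s t, inv_eq_iff_mul_eq_one] at hq
    have h2 : ((commParam p s t : k) - 1) * (commParam p s t + 1) = 0 := by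
      have : (commParam p s t : k) * commParam p s t = 1 := by rw [← Units.val_mul, hq]; simp
      linear_combination this
    rcases mul_eq_zero.1 h2 with h | h
    · exact absurd (Units.ext (by simpa using sub_eq_zero.1 h)) hq1
    · exact Units.ext (by simpa using eq_neg_of_add_eq_zero_left h)
  refine ⟨s, t, Units.mk0 α hα0, hst, hqm, linearEquiv_ext_single fun i => ?_⟩
  rw [tauLin_single hst]
  split_ifs with h1 h2
  · funext u
    rw [h1]
    by_cases hu : u = t
    · subst hu
      simp [hα]
    · rw [hsu u hu]
      simp [hu]
  · funext u
    rw [h2]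
    by_cases hu : u = s
    · subst hu
      rw [← hβ]
      rw [hqm, Units.val_neg, Units.val_one] at hαβ
      simp only [Units.val_inv_eq_inv_val, Units.val_mk0,
        Pi.smul_apply, Pi.single_eq_same, smul_eq_mul, mul_one]
      rw [eq_neg_iff_add_eq_zero]
      field_simp
      linear_combination -hαβ
    · rw [htu u hu]
      simp [hu]
  · exact hi i h1 h2

/-- The quasi-reflections of finite order: a reflection of one block, or a mystic reflection. -/
theorem IsQuasiReflection.cases [CharZero k] {p : Fin n → Fin n → kˣ} {g : gradedAut p}
    (hg : IsQuasiReflection g) (hn : 1 ≤ n) {m : ℕ} (hm : 0 < m) (hgm : g ^ m = 1) :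
    (∃ B, IsBlockReflection p (act p g) B) ∨
      ∃ (s t : Fin n) (c : kˣ), s ≠ t ∧ commParam p s t = -1 ∧ act p g = tauLin s t c := by
  obtain ⟨π, hπ⟩ := exists_blockPerm g
  have : CharZero (AlgebraicClosure k) := charZero_of_injective_algebraMap
    (algebraMap k (AlgebraicClosure k)).injective
  obtain ⟨D⟩ := exists_monomialization (K := AlgebraicClosure k) g hm hgm hπ
  rcases D.cases_of_isQuasiReflection (blockParam_perm g hπ) hg with ⟨hσ, hc⟩ | ⟨s, hs, hss, hf, hc⟩
  · exact Or.inl (isBlockReflection_of_monomialization D hn hσ hc)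
  · exact Or.inr (eq_tauLin_of_monomialization D hs hss hf hc)

end SkewPoly

/-! ### Groups of block-diagonal linear maps -/

section BlockDiagonal

variable {k : Type*} [Field k]

/-- Conjugation by a linear equivalence, as an isomorphism of general linear groups. -/
def linConj {V W : Type*} [AddCommGroup V] [Module k V] [AddCommGroup W] [Module k W]
    (φ : V ≃ₗ[k] W) : (V ≃ₗ[k] V) ≃* (W ≃ₗ[k] W) where
  toFun g := (φ.symm.trans g).trans φ
  invFun g := (φ.trans g).trans φ.symm
  left_inv g := LinearEquiv.ext fun v => by simp
  right_inv g := LinearEquiv.ext fun v => by simp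
  map_mul' g h := LinearEquiv.ext fun v => by simp

theorem linConj_apply {V W : Type*} [AddCommGroup V] [Module k V] [AddCommGroup W] [Module k W]
    (φ : V ≃ₗ[k] W) (g : V ≃ₗ[k] V) (w : W) : linConj φ g w = φ (g (φ.symm w)) := rfl

variable {ι J : Type*} (f : ι → J)

/-- The block-diagonal linear map with given blocks on the coordinates in the fibres of `f`. -/
def blockLin (γ : ∀ j, ({i // f i = j} → k) ≃ₗ[k] ({i // f i = j} → k)) :
    (ι → k) →ₗ[k] (ι → k) where
  toFun v i := γ (f i) (fun q => v q) ⟨i, rfl⟩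
  map_add' v w := funext fun i => by
    change γ (f i) ((fun q : {i' // f i' = f i} => v q) +
      fun q : {i' // f i' = f i} => w q) ⟨i, rfl⟩ = _
    rw [map_add]
    rfl
  map_smul' c v := funext fun i => by
    change γ (f i) (c • fun q : {i' // f i' = f i} => v q) ⟨i, rfl⟩ = _
    rw [map_smul]
    rfl

theorem blockLin_apply (γ : ∀ j, ({i // f i = j} → k) ≃ₗ[k] ({i // f i = j} → k)) (v : ι → k)
    {j : J} (q : {i // f i = j}) : blockLin f γ v q = γ j (fun q => v q) q := by
  obtain ⟨i, rfl⟩ := q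
  rfl

theorem blockLin_mul (γ δ : ∀ j, ({i // f i = j} → k) ≃ₗ[k] ({i // f i = j} → k)) (v : ι → k) :
    blockLin f (γ * δ) v = blockLin f γ (blockLin f δ v) := by
  funext i
  change (γ (f i) * δ (f i)) (fun q => v q) ⟨i, rfl⟩ = γ (f i) _ ⟨i, rfl⟩
  rw [LinearEquiv.mul_apply]
  refine congrFun (congrArg (γ (f i)) (funext fun q => ?_)) _
  exact (blockLin_apply f δ v q).symm

/-- The block-diagonal maps, as a homomorphism from the product of the groups of the blocks. -/
def blockHom : (∀ j, ({i // f i = j} → k) ≃ₗ[k] ({i // f i = j} → k)) →*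
    ((ι → k) ≃ₗ[k] (ι → k)) where
  toFun γ := LinearEquiv.ofLinearMap (blockLin f γ) (blockLin f γ⁻¹)
    (LinearMap.ext fun v => by
      rw [LinearMap.comp_apply, ← blockLin_mul, mul_inv_cancel]; rfl)
    (LinearMap.ext fun v => by
      rw [LinearMap.comp_apply, ← blockLin_mul, inv_mul_cancel]; rfl)
  map_one' := rfl
  map_mul' γ δ := LinearEquiv.ext fun v => blockLin_mul f γ δ v

theorem blockHom_apply (γ : ∀ j, ({i // f i = j} → k) ≃ₗ[k] ({i // f i = j} → k)) (v : ι → k)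
    {j : J} (q : {i // f i = j}) : blockHom f γ v q = γ j (fun q => v q) q :=
  blockLin_apply f γ v q

open Classical in
/-- Extension by zero of a vector with coordinates in the fibre of `j`. -/
noncomputable def extendZero (j : J) (w : {i // f i = j} → k) (i : ι) : k :=
  if h : f i = j then w ⟨i, h⟩ else 0

theorem extendZero_coe (j : J) (w : {i // f i = j} → k) :
    (fun q : {i // f i = j} => extendZero f j w q) = w := by
  funext q
  simp [extendZero, q.2]

theorem blockHom_injective : Function.Injective (blockHom (k := k) f) := by
  intro γ δ h
  funext j
  refine LinearEquiv.ext fun w => funext fun q => ?_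
  have := congrFun (LinearEquiv.congr_fun h (extendZero f j w)) q
  rwa [blockHom_apply, blockHom_apply, extendZero_coe] at this

variable [DecidableEq J]

theorem blockHom_mulSingle_same (j : J) (γ : ({i // f i = j} → k) ≃ₗ[k] ({i // f i = j} → k))
    (v : ι → k) (q : {i // f i = j}) :
    blockHom f (Pi.mulSingle j γ) v q = γ (fun q => v q) q := by
  rw [blockHom_apply, Pi.mulSingle_eq_same]

theorem blockHom_mulSingle_of_ne {j : J} (γ : ({i // f i = j} → k) ≃ₗ[k] ({i // f i = j} → k))
    (v : ι → k) {i : ι} (h : f i ≠ j) : blockHom f (Pi.mulSingle j γ) v i = v i := by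
  have := blockHom_apply f (Pi.mulSingle j γ) v (⟨i, rfl⟩ : {i' // f i' = f i})
  rw [Pi.mulSingle_eq_of_ne h] at this
  exact this

/-- A linear map acting on the coordinates of one fibre only is block-diagonal. -/
theorem exists_eq_blockHom_mulSingle [Fintype ι] [DecidableEq ι] (j : J) (g : (ι → k) ≃ₗ[k] (ι → k))
    (h₁ : ∀ i, f i ≠ j → g (Pi.single i 1) = Pi.single i 1)
    (h₂ : ∀ i u, f i = j → f u ≠ j → g (Pi.single i 1) u = 0) :
    ∃ γ, g = blockHom f (Pi.mulSingle j γ) := by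
  have hg : ∀ v u, g v u = ∑ i, v i * g (Pi.single i 1) u := by
    intro v u
    conv_lhs => rw [pi_eq_sum_univ' v, map_sum, Finset.sum_apply]
    refine Finset.sum_congr rfl fun i _ => ?_
    rw [map_smul]
    rfl
  have hout : ∀ v u, f u ≠ j → g v u = v u := by
    intro v u hu
    rw [hg, Finset.sum_eq_single u]
    · rw [h₁ u hu, Pi.single_eq_same, mul_one]
    · intro i _ hi
      by_cases hij : f i = j
      · rw [h₂ i u hij hu, mul_zero]
      · rw [h₁ i hij, Pi.single_eq_of_ne (Ne.symm hi), mul_zero]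
    · simp
  have hin : ∀ v u, f u = j → g v u = g (extendZero f j fun q => v q) u := by
    intro v u hu
    rw [hg, hg (extendZero f j _)]
    refine Finset.sum_congr rfl fun i _ => ?_
    by_cases hij : f i = j
    · simp [extendZero, hij]
    · rw [h₁ i hij, Pi.single_eq_of_ne, mul_zero, mul_zero]
      rintro rfl
      exact hij hu
  let E : ({i // f i = j} → k) →ₗ[k] (ι → k) :=
    { toFun := extendZero f j
      map_add' := fun v w => funext fun i => by
        by_cases h : f i = j <;> simp [extendZero, h]
      map_smul' := fun c v => funext fun i => by
        by_cases h : f i = j <;> simp [extendZero, h] }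
  let R : (ι → k) →ₗ[k] ({i // f i = j} → k) := LinearMap.funLeft k k Subtype.val
  let γ₀ : ({i // f i = j} → k) →ₗ[k] ({i // f i = j} → k) := R ∘ₗ g.toLinearMap ∘ₗ E
  have hγ₀ : Function.Injective γ₀ := by
    rw [injective_iff_map_eq_zero]
    intro w hw
    have h0 : g (extendZero f j w) = 0 := by
      funext u
      by_cases hu : f u = j
      · exact congrFun hw ⟨u, hu⟩
      · rw [hout _ u hu]
        simp [extendZero, hu]
    rw [LinearEquiv.map_eq_zero_iff] at h0
    rw [← extendZero_coe f j w, h0]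
    rfl
  refine ⟨LinearEquiv.ofInjectiveEndo γ₀ hγ₀, LinearEquiv.ext fun v => funext fun u => ?_⟩
  by_cases hu : f u = j
  · rw [hin v u hu]
    exact (blockHom_mulSingle_same f j (LinearEquiv.ofInjectiveEndo γ₀ hγ₀) v ⟨u, hu⟩).symm
  · rw [hout v u hu, blockHom_mulSingle_of_ne f _ v hu]

/-- The subgroup of the block `j` generated by the elements of `S` that act on this block only. -/
def blockSubgroup (S : Set ((ι → k) ≃ₗ[k] (ι → k))) (j : J) :
    Subgroup (({i // f i = j} → k) ≃ₗ[k] ({i // f i = j} → k)) :=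
  Subgroup.closure {γ | blockHom f (Pi.mulSingle j γ) ∈ S}

theorem map_blockSubgroup_le (S : Set ((ι → k) ≃ₗ[k] (ι → k))) (j : J) :
    (blockSubgroup f S j).map ((blockHom f).comp (MonoidHom.mulSingle _ j)) ≤
      Subgroup.closure S := by
  rw [blockSubgroup, MonoidHom.map_closure]
  apply Subgroup.closure_mono
  rintro _ ⟨γ, hγ, rfl⟩
  exact hγ

theorem map_pi_blockSubgroup [Finite J] {S : Set ((ι → k) ≃ₗ[k] (ι → k))}
    (hS : ∀ g ∈ S, ∃ j γ, g = blockHom f (Pi.mulSingle j γ)) :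
    (Subgroup.pi Set.univ (blockSubgroup f S)).map (blockHom f) = Subgroup.closure S := by
  apply le_antisymm
  · rw [Subgroup.map_le_iff_le_comap, Subgroup.pi_le_iff]
    intro j
    rw [← Subgroup.map_le_iff_le_comap, Subgroup.map_map]
    exact map_blockSubgroup_le f S j
  · rw [Subgroup.closure_le]
    intro g hg
    obtain ⟨j, γ, rfl⟩ := hS g hg
    refine Subgroup.mem_map_of_mem _ ?_
    rw [Subgroup.mulSingle_mem_pi]
    exact fun _ => Subgroup.subset_closure hg

/-- A group generated by elements acting on one block each is the product of its blocks. -/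
theorem nonempty_closure_mulEquiv_pi [Finite J] {S : Set ((ι → k) ≃ₗ[k] (ι → k))}
    (hS : ∀ g ∈ S, ∃ j γ, g = blockHom f (Pi.mulSingle j γ)) :
    Nonempty (Subgroup.closure S ≃* ∀ j, blockSubgroup f S j) := by
  rw [← map_pi_blockSubgroup f hS]
  let e : Subgroup.pi Set.univ (blockSubgroup f S) ≃* ∀ j, blockSubgroup f S j :=
    { toFun := fun γ j => ⟨γ.1 j, γ.2 j trivial⟩
      invFun := fun γ => ⟨fun j => γ j, fun j _ => (γ j).2⟩
      left_inv := fun _ => rfl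
      right_inv := fun _ => rfl
      map_mul' := fun _ _ => rfl }
  exact ⟨(Subgroup.equivMapOfInjective _ _ (blockHom_injective f)).symm.trans e⟩

theorem mem_blockSubgroup_of_mem [Finite J] {S : Set ((ι → k) ≃ₗ[k] (ι → k))}
    (hS : ∀ g ∈ S, ∃ j γ, g = blockHom f (Pi.mulSingle j γ)) {j : J}
    {γ : ({i // f i = j} → k) ≃ₗ[k] ({i // f i = j} → k)}
    (h : blockHom f (Pi.mulSingle j γ) ∈ Subgroup.closure S) : γ ∈ blockSubgroup f S j := by
  rw [← map_pi_blockSubgroup f hS] at h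
  obtain ⟨δ, hδ, e⟩ := h
  have := congrFun (blockHom_injective f e) j
  rw [Pi.mulSingle_eq_same] at this
  exact this ▸ hδ j trivial

theorem finite_blockSubgroup (S : Set ((ι → k) ≃ₗ[k] (ι → k))) [Finite (Subgroup.closure S)]
    (j : J) : Finite (blockSubgroup f S j) := by
  have hinj : Function.Injective ((blockHom (k := k) f).comp (MonoidHom.mulSingle _ j)) :=
    (blockHom_injective f).comp (Pi.mulSingle_injective
      (M := fun j => ({i // f i = j} → k) ≃ₗ[k] ({i // f i = j} → k)) j)
  have := Finite.of_injective _ (Subgroup.inclusion_injective (map_blockSubgroup_le f S j))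
  exact Finite.of_equiv _ (Subgroup.equivMapOfInjective (blockSubgroup f S j) _ hinj).symm.toEquiv

end BlockDiagonal

/-! ### Groups generated by reflections -/

section Reflections

variable {k : Type*} [Field k]

/-- The linear map `g` differs from the identity by a map of rank at most one. -/
def IsRankOneChange {V : Type*} [AddCommGroup V] [Module k V] (g : V ≃ₗ[k] V) : Prop :=
  ∃ (φ : V →ₗ[k] k) (v : V), ∀ w, g w = w + φ w • v

/-- In characteristic zero, an element of finite order that fixes a hyperplane is a reflection. -/
theorem IsRankOneChange.isClassicalReflection [CharZero k] {m : ℕ}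
    {g : (Fin m → k) ≃ₗ[k] (Fin m → k)} (hg : IsRankOneChange g) (h1 : g ≠ 1) {r : ℕ} (hr : 0 < r)
    (hgr : g ^ r = 1) : IsClassicalReflection g := by
  obtain ⟨φ, v, hφ⟩ := hg
  obtain ⟨w₀, hw₀⟩ : ∃ w, φ w • v ≠ 0 := by
    by_contra! h
    exact h1 (LinearEquiv.ext fun w => by rw [hφ, h, add_zero]; rfl)
  have hφw : φ w₀ ≠ 0 := fun h => hw₀ (by rw [h, zero_smul])
  have hv0 : v ≠ 0 := fun h => hw₀ (by rw [h, smul_zero])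
  -- otherwise `g` is a transvection, of infinite order in characteristic zero
  have hφv : φ v ≠ 0 := by
    intro h
    have hpow : ∀ j : ℕ, (g ^ j) w₀ = w₀ + ((j : k) * φ w₀) • v := by
      intro j
      induction j with
      | zero => simp
      | succ j ih =>
        rw [pow_succ', LinearEquiv.mul_apply, ih, hφ, map_add, map_smul, h, smul_zero, add_zero,
          add_assoc, ← add_smul]
        congr 2
        push_cast
        ring
    have := hpow r
    rw [hgr, LinearEquiv.coe_one, id, left_eq_add, mul_smul, smul_eq_zero] at this
    exact this.elim (fun h => hr.ne' (Nat.cast_eq_zero.1 h)) hw₀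
  have hrange : LinearMap.range φ = ⊤ := by
    rw [LinearMap.range_eq_top]
    intro a
    exact ⟨(a / φ v) • v, by rw [map_smul, smul_eq_mul, div_mul_cancel₀ _ hφv]⟩
  have hker : Module.finrank k (LinearMap.ker φ) + 1 = m := by
    have := LinearMap.finrank_range_add_finrank_ker φ
    rw [hrange, finrank_top, Module.finrank_self, Module.finrank_fin_fun] at this
    omega
  obtain ⟨d, rfl⟩ : ∃ d, m = d + 1 := ⟨_, hker.symm⟩
  have hd : Module.finrank k (LinearMap.ker φ) = d := by omega
  let b := Module.finBasisOfFinrankEq k (LinearMap.ker φ) hd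
  let y := Module.Basis.mkFinCons v b
    (fun c x hx h => by
      have := congrArg φ h
      rw [map_add, map_smul, LinearMap.mem_ker.1 hx, add_zero, map_zero, smul_eq_mul] at this
      exact (mul_eq_zero.1 this).resolve_right hφv)
    (fun z => ⟨-(φ z / φ v), by
      rw [LinearMap.mem_ker, map_add, map_smul, smul_eq_mul, neg_mul, div_mul_cancel₀ _ hφv,
        add_neg_cancel]⟩)
  have hy : (y : Fin (d + 1) → (Fin (d + 1) → k)) = Fin.cons v ((↑) ∘ b) :=
    Module.Basis.coe_mkFinCons _ _ _ _
  refine ⟨y, 0, 1 + φ v, by simpa using hφv, ?_, ?_⟩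
  · rw [hy, Fin.cons_zero, hφ, add_smul, one_smul]
  · intro j hj
    obtain ⟨j, rfl⟩ := Fin.exists_succ_eq.2 hj
    rw [hy, Fin.cons_succ, hφ, Function.comp_apply, LinearMap.mem_ker.1 (b j).2, zero_smul,
      add_zero]

/-- A finite group generated by elements fixing hyperplanes is a classical reflection group. -/
theorem exists_isClassicalReflectionGroup [CharZero k] {P : Type*} [Finite P]
    (S : Set ((P → k) ≃ₗ[k] (P → k))) [Finite (Subgroup.closure S)]
    (hS : ∀ g ∈ S, IsRankOneChange g) :
    ∃ (m : ℕ) (R : Subgroup ((Fin m → k) ≃ₗ[k] (Fin m → k))), IsClassicalReflectionGroup R ∧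
      Nonempty (Subgroup.closure S ≃* R) := by
  let e := Finite.equivFin P
  let Φ := linConj (LinearEquiv.funCongrLeft k k e.symm)
  let R := (Subgroup.closure S).map Φ.toMonoidHom
  let eR : Subgroup.closure S ≃* R := Φ.subgroupMap (Subgroup.closure S)
  have hfin : Finite R := Finite.of_equiv _ eR.toEquiv
  refine ⟨_, R, ⟨hfin, le_antisymm ?_ ?_⟩, ⟨eR⟩⟩
  · rw [Subgroup.closure_le]
    exact fun g hg => hg.1
  · change (Subgroup.closure S).map Φ.toMonoidHom ≤ _
    rw [MonoidHom.map_closure, Subgroup.closure_le]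
    rintro _ ⟨g, hg, rfl⟩
    by_cases h1 : Φ.toMonoidHom g = 1
    · rw [h1]
      exact one_mem _
    have hmem : Φ.toMonoidHom g ∈ R := Subgroup.mem_map_of_mem _ (Subgroup.subset_closure hg)
    refine Subgroup.subset_closure ⟨hmem, ?_⟩
    have hrank : IsRankOneChange (Φ.toMonoidHom g) := by
      obtain ⟨φ, v, hφ⟩ := hS g hg
      refine ⟨φ ∘ₗ (LinearEquiv.funCongrLeft k k e.symm).symm.toLinearMap,
        LinearEquiv.funCongrLeft k k e.symm v, fun w => ?_⟩
      change linConj (LinearEquiv.funCongrLeft k k e.symm) g w = _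
      rw [linConj_apply, hφ, map_add, map_smul, LinearEquiv.apply_symm_apply]
      rfl
    refine hrank.isClassicalReflection h1 (orderOf_pos (⟨_, hmem⟩ : R)) ?_
    exact congrArg Subtype.val (pow_orderOf_eq_one (⟨_, hmem⟩ : R))

end Reflections

/-! ### Groups generated by linear reflections and mystic reflections -/

section Mystic

variable {k ι : Type*} [Field k] [DecidableEq ι]

theorem thetaLin_mul [Finite ι] (s : ι) (c d : kˣ) :
    thetaLin s c * thetaLin s d = thetaLin s (c * d) := by
  refine linearEquiv_ext_single fun i => ?_
  by_cases h : i = s <;> simp [thetaLin_single, h, smul_smul, mul_comm]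

theorem thetaLin_one (s : ι) : thetaLin s (1 : kˣ) = 1 := by
  rw [thetaLin, Pi.one_def, Function.update_eq_self]
  refine LinearEquiv.ext fun v => funext fun u => ?_
  rw [monomialMap_apply]
  simp
  rfl

theorem thetaLin_inv [Finite ι] (s : ι) (c : kˣ) : (thetaLin s c)⁻¹ = thetaLin s c⁻¹ := by
  rw [inv_eq_iff_mul_eq_one, thetaLin_mul, mul_inv_cancel, thetaLin_one]

variable [Finite ι] {s t u : ι}

theorem tauLin_symm (hst : s ≠ t) (c : kˣ) : tauLin s t c = tauLin t s (-c⁻¹) := by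
  refine linearEquiv_ext_single fun i => ?_
  rw [tauLin_single hst, tauLin_single hst.symm]
  by_cases hs : i = s
  · subst hs
    simp [hst]
  · by_cases ht : i = t
    · simp [ht, hst.symm]
    · simp [hs, ht]

theorem tauLin_inv (hst : s ≠ t) (c : kˣ) : (tauLin s t c)⁻¹ = tauLin s t (-c) := by
  rw [inv_eq_iff_mul_eq_one]
  refine linearEquiv_ext_single fun i => ?_
  by_cases hs : i = s
  · simp [hs, tauLin_single hst, hst.symm, smul_smul]
  · by_cases ht : i = t
    · simp [ht, tauLin_single hst, hst.symm, smul_smul]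
    · simp [hs, ht, tauLin_single hst]

/-- Conjugation by a mystic reflection moves the second index of another one. -/
theorem tauLin_trans (hst : s ≠ t) (htu : t ≠ u) (hsu : s ≠ u) (c d : kˣ) :
    tauLin t u d * tauLin s t c * (tauLin t u d)⁻¹ = tauLin s u (c * d) := by
  rw [mul_inv_eq_iff_eq_mul]
  refine linearEquiv_ext_single fun i => ?_
  by_cases hs : i = s
  · simp [hs, tauLin_single hst, tauLin_single htu, tauLin_single hsu, hst, hsu, smul_smul]
  · by_cases ht : i = t
    · subst ht
      simp [tauLin_single hst, tauLin_single htu, tauLin_single hsu, hst, hst.symm, hsu, hsu.symm,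
        smul_smul]
    · by_cases hu : i = u
      · subst hu
        simp [tauLin_single hst, tauLin_single htu, tauLin_single hsu, htu.symm, hst.symm,
          hsu.symm, htu]
      · simp [hs, ht, hu, tauLin_single hst, tauLin_single htu, tauLin_single hsu]

/-- The mystic reflections of a pair of indices multiply like their scalars, relative to the one of
scalar `1`. -/
theorem tauLin_mul_mul (hst : s ≠ t) (c d : kˣ) :
    tauLin s t c * (tauLin s t 1)⁻¹ * tauLin s t d = tauLin s t (c * d) := by
  rw [tauLin_inv hst]
  refine linearEquiv_ext_single fun i => ?_
  by_cases hs : i = s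
  · simp [hs, tauLin_single hst, hst.symm, smul_smul, mul_comm]
  · by_cases ht : i = t
    · simp [ht, tauLin_single hst, hst.symm, smul_smul, mul_comm]
    · simp [hs, ht, tauLin_single hst]

theorem tauLin_conj_thetaLin (hst : s ≠ t) (c : kˣ) :
    tauLin s t 1 * thetaLin s c * (tauLin s t 1)⁻¹ = thetaLin t c := by
  rw [mul_inv_eq_iff_eq_mul]
  refine linearEquiv_ext_single fun i => ?_
  by_cases hs : i = s
  · simp [hs, tauLin_single hst, thetaLin_single]
  · by_cases ht : i = t
    · simp [ht, tauLin_single hst, thetaLin_single, hst, hst.symm]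
    · simp [hs, ht, tauLin_single hst, thetaLin_single]

theorem thetaLin_conj_tauLin (hst : s ≠ t) (c : kˣ) :
    thetaLin s c * tauLin s t 1 * (thetaLin s c)⁻¹ = tauLin s t c⁻¹ := by
  rw [mul_inv_eq_iff_eq_mul]
  refine linearEquiv_ext_single fun i => ?_
  by_cases hs : i = s
  · simp [hs, tauLin_single hst, thetaLin_single, hst.symm, smul_smul]
  · by_cases ht : i = t
    · simp [ht, tauLin_single hst, thetaLin_single, hst.symm]
    · simp [hs, ht, tauLin_single hst, thetaLin_single]

theorem thetaLin_injective (s : ι) : Function.Injective (thetaLin (k := k) s) := by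
  intro c d h
  rw [thetaLin, thetaLin, monomialMap_inj] at h
  simpa using congrFun h.1 s

theorem tauLin_injective (s t : ι) : Function.Injective (tauLin (k := k) s t) := by
  intro c d h
  rw [tauLin, tauLin, monomialMap_inj] at h
  simpa using congrFun h.1 s

/-- The linear group generated by the reflections with scalars in the `α`-th roots of unity and the
mystic reflections with scalars in the `β`-th roots of unity. -/
def mysticLin (k ι : Type*) [Field k] [DecidableEq ι] (α β : ℕ) :
    Subgroup ((ι → k) ≃ₗ[k] (ι → k)) :=
  Subgroup.closure ({g | ∃ (i : ι) (c : kˣ), c ^ α = 1 ∧ g = thetaLin i c} ∪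
    {g | ∃ (i j : ι) (_ : i ≠ j) (c : kˣ), c ^ β = 1 ∧ g = tauLin i j c})

/-- A finite subgroup of order `m` of the multiplicative group of a field consists of all the
`m`-th roots of unity. -/
theorem mem_iff_pow_natCard_eq_one (A : Subgroup kˣ) [Finite A] (c : kˣ) :
    c ∈ A ↔ c ^ Nat.card A = 1 := by
  have : NeZero (Nat.card A) := ⟨Nat.card_pos.ne'⟩
  have hle : A ≤ rootsOfUnity (Nat.card A) k := by
    intro a ha
    rw [mem_rootsOfUnity]
    exact congrArg Subtype.val (pow_card_eq_one' (x := (⟨a, ha⟩ : A)))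
  have heq : A = rootsOfUnity (Nat.card A) k :=
    Subgroup.eq_of_le_of_card_ge hle (card_rootsOfUnity k _)
  rw [← mem_rootsOfUnity, ← heq]

variable (H : Subgroup ((ι → k) ≃ₗ[k] (ι → k)))

/-- The scalars `c` of the reflections `θ_{s,c}` in a group. -/
def thetaScalars (s : ι) : Subgroup kˣ where
  carrier := {c | thetaLin s c ∈ H}
  one_mem' := by
    change thetaLin s 1 ∈ H
    rw [thetaLin_one]
    exact H.one_mem
  mul_mem' {c d} hc hd := by
    change thetaLin s (c * d) ∈ H
    rw [← thetaLin_mul]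
    exact H.mul_mem hc hd
  inv_mem' {c} hc := by
    change thetaLin s c⁻¹ ∈ H
    rw [← thetaLin_inv]
    exact H.inv_mem hc

variable {H}

/-- The scalars `c` of the mystic reflections `τ_{s,t,c}` in a group containing `τ_{s,t,1}`. -/
def tauScalars (hst : s ≠ t) (h1 : tauLin s t 1 ∈ H) : Subgroup kˣ where
  carrier := {c | tauLin s t c ∈ H}
  one_mem' := h1
  mul_mem' {c d} hc hd := by
    change tauLin s t (c * d) ∈ H
    rw [← tauLin_mul_mul hst]
    exact H.mul_mem (H.mul_mem hc (H.inv_mem h1)) hd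
  inv_mem' {c} hc := by
    change tauLin s t c⁻¹ ∈ H
    have h : (tauLin s t c * (tauLin s t 1)⁻¹)⁻¹ * tauLin s t 1 = tauLin s t c⁻¹ := by
      rw [inv_mul_eq_iff_eq_mul, tauLin_mul_mul hst, mul_inv_cancel]
    rw [← h]
    exact H.mul_mem (H.inv_mem (H.mul_mem hc (H.inv_mem h1))) h1

theorem tauLin_swap_mem (hst : s ≠ t) (h1 : tauLin s t 1 ∈ H) {c : kˣ} (hc : tauLin s t c ∈ H) :
    tauLin t s c ∈ H := by
  have hc' : c⁻¹ ∈ tauScalars hst h1 := inv_mem (s := tauScalars hst h1) hc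
  have h := H.inv_mem (show tauLin s t c⁻¹ ∈ H from hc')
  rwa [tauLin_inv hst, tauLin_symm hst, inv_neg, inv_inv, neg_neg] at h

/-- If all `τ_{s,t,1}` are in the group, then the scalars `c` of the `τ_{s,t,c}` in the group do not
depend on the indices. -/
theorem tauLin_mem_of_mem (h1 : ∀ s t : ι, s ≠ t → tauLin s t (1 : kˣ) ∈ H) {c : kˣ}
    {s' t' : ι} (hst : s ≠ t) (hst' : s' ≠ t') (hc : tauLin s t c ∈ H) : tauLin s' t' c ∈ H := by
  have hright : ∀ {s t u : ι}, s ≠ t → s ≠ u → tauLin s t c ∈ H → tauLin s u c ∈ H := by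
    intro s t u hst hsu hc
    by_cases htu : t = u
    · rwa [← htu]
    · have := tauLin_trans hst htu hsu c 1
      rw [mul_one] at this
      rw [← this]
      exact H.mul_mem (H.mul_mem (h1 t u htu) hc) (H.inv_mem (h1 t u htu))
  have hswap : ∀ {s t : ι}, s ≠ t → tauLin s t c ∈ H → tauLin t s c ∈ H :=
    fun hst hc => tauLin_swap_mem hst (h1 _ _ hst) hc
  by_cases hs : s = t'
  · subst hs
    exact hswap hst'.symm (hright hst hst'.symm hc)
  · exact hswap hst'.symm (hright (Ne.symm hs) hst'.symm (hswap hs (hright hst hs hc)))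

/-- A finite group generated by reflections `θ_{s,c}` and mystic reflections, and containing all
the `τ_{s,t,1}`, is one of the standard groups. -/
theorem exists_eq_mysticLin [CharZero k] [Nontrivial ι] (S : Set ((ι → k) ≃ₗ[k] (ι → k)))
    [Finite (Subgroup.closure S)]
    (hS : ∀ g ∈ S, (∃ s c, g = thetaLin s c) ∨ ∃ s t c, s ≠ t ∧ g = tauLin s t c)
    (h1 : ∀ s t : ι, s ≠ t → tauLin s t (1 : kˣ) ∈ Subgroup.closure S) :
    ∃ α β : ℕ, 0 < α ∧ 0 < β ∧ α ∣ β ∧ 2 ∣ β ∧ Subgroup.closure S = mysticLin k ι α β := by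
  set H := Subgroup.closure S with hH
  obtain ⟨s, t, hst⟩ := exists_pair_ne ι
  let A := thetaScalars H s
  let B := tauScalars hst (h1 s t hst)
  have hA : ∀ (u : ι) (c : kˣ), thetaLin u c ∈ H ↔ c ∈ A := by
    have key : ∀ {u v : ι} {c : kˣ}, thetaLin u c ∈ H → thetaLin v c ∈ H := by
      intro u v c hc
      by_cases huv : u = v
      · rwa [← huv]
      · rw [← tauLin_conj_thetaLin huv]
        exact H.mul_mem (H.mul_mem (h1 u v huv) hc) (H.inv_mem (h1 u v huv))
    exact fun u c => ⟨fun h => key h, fun h => key h⟩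
  have hB : ∀ (u v : ι) (c : kˣ), u ≠ v → (tauLin u v c ∈ H ↔ c ∈ B) := fun u v c huv =>
    ⟨fun h => tauLin_mem_of_mem h1 huv hst h, fun h => tauLin_mem_of_mem h1 hst huv h⟩
  have : Finite A := Finite.of_injective (fun c : A => (⟨thetaLin s c.1, c.2⟩ : H))
    fun c d h => Subtype.ext (thetaLin_injective s (congrArg Subtype.val h))
  have : Finite B := Finite.of_injective (fun c : B => (⟨tauLin s t c.1, c.2⟩ : H))
    fun c d h => Subtype.ext (tauLin_injective s t (congrArg Subtype.val h))
  have hAB : A ≤ B := by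
    intro c hc
    rw [← inv_inv c]
    refine inv_mem (?_ : tauLin s t c⁻¹ ∈ H)
    rw [← thetaLin_conj_tauLin hst]
    exact H.mul_mem (H.mul_mem hc (h1 s t hst)) (H.inv_mem hc)
  -- the inverse of `τ_{s,t,1}` is `τ_{s,t,-1}`, so that `β` is even
  have hneg : (-1 : kˣ) ∈ B := by
    have := H.inv_mem (h1 s t hst)
    rwa [tauLin_inv hst] at this
  have horder : orderOf (-1 : kˣ) = 2 := by
    rw [orderOf_eq_prime_iff]
    refine ⟨by simp, fun h => ?_⟩
    have h2 := congrArg Units.val h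
    rw [Units.val_neg, Units.val_one] at h2
    have h3 : (2 : k) = 0 := by linear_combination -h2
    exact two_ne_zero h3
  refine ⟨Nat.card A, Nat.card B, Nat.card_pos, Nat.card_pos, Subgroup.card_dvd_of_le hAB, ?_, ?_⟩
  · rw [← horder]
    exact Subgroup.orderOf_dvd_natCard B hneg
  · apply le_antisymm
    · rw [hH, Subgroup.closure_le]
      intro g hg
      have hgH : g ∈ H := Subgroup.subset_closure hg
      rcases hS g hg with ⟨u, c, rfl⟩ | ⟨u, v, c, huv, rfl⟩
      · exact Subgroup.subset_closure (Or.inl ⟨u, c,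
          (mem_iff_pow_natCard_eq_one A c).1 ((hA u c).1 hgH), rfl⟩)
      · exact Subgroup.subset_closure (Or.inr ⟨u, v, huv, c,
          (mem_iff_pow_natCard_eq_one B c).1 ((hB u v c huv).1 hgH), rfl⟩)
    · rw [mysticLin, Subgroup.closure_le]
      rintro g (⟨u, c, hc, rfl⟩ | ⟨u, v, huv, c, hc, rfl⟩)
      · exact (hA u c).2 ((mem_iff_pow_natCard_eq_one A c).2 hc)
      · exact (hB u v c huv).2 ((mem_iff_pow_natCard_eq_one B c).2 hc)

/-- A finite group generated by reflections `θ_{s,c}` and mystic reflections, and containing some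
`τ_{s,t,c}` for each pair of indices, is isomorphic to one of the standard groups: rescaling the
coordinates makes the `τ_{s,t,c}` for a fixed index `s` into `τ_{s,t,1}`. -/
theorem exists_mulEquiv_mysticLin [CharZero k] [Nontrivial ι]
    (S : Set ((ι → k) ≃ₗ[k] (ι → k))) [Finite (Subgroup.closure S)]
    (hS : ∀ g ∈ S, (∃ s c, g = thetaLin s c) ∨ ∃ s t c, s ≠ t ∧ g = tauLin s t c)
    (hall : ∀ s t : ι, s ≠ t → ∃ c : kˣ, tauLin s t c ∈ Subgroup.closure S) :
    ∃ N α β : ℕ, (2 ≤ N ∧ 0 < α ∧ 0 < β ∧ α ∣ β ∧ 2 ∣ β) ∧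
      Nonempty (Subgroup.closure S ≃* mysticLin k (Fin N) α β) := by
  let s₀ : ι := Classical.arbitrary ι
  have hδ : ∀ t, ∃ c : kˣ, s₀ ≠ t → tauLin s₀ t c ∈ Subgroup.closure S := by
    intro t
    by_cases h : s₀ = t
    · exact ⟨1, fun h' => absurd h h'⟩
    · obtain ⟨c, hc⟩ := hall s₀ t h
      exact ⟨c, fun _ => hc⟩
  choose c₀ hc₀ using hδ
  let δ : ι → kˣ := fun t => if t = s₀ then 1 else (c₀ t)⁻¹
  let e := Finite.equivFin ι
  let φ : (ι → k) ≃ₗ[k] (Fin (Nat.card ι) → k) :=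
    (monomialMap δ 1).trans (LinearEquiv.funCongrLeft k k e.symm)
  have hφ : ∀ i, φ (Pi.single i 1) = (δ i : k) • Pi.single (e i) 1 := by
    intro i
    change LinearEquiv.funCongrLeft k k e.symm (monomialMap δ 1 (Pi.single i 1)) = _
    rw [monomialMap_single, Equiv.Perm.one_apply]
    funext u
    rw [LinearEquiv.funCongrLeft_apply, LinearMap.funLeft_apply]
    simp [Pi.single_apply, Equiv.symm_apply_eq]
  let Φ := linConj φ
  have hΦ : ∀ g g', (∀ i, φ (g (Pi.single i 1)) = g' (φ (Pi.single i 1))) →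
      Φ.toMonoidHom g = g' := by
    intro g g' h
    refine linearEquiv_ext_single fun j => ?_
    obtain ⟨i, rfl⟩ := e.surjective j
    have h1 := h i
    change φ (g (φ.symm (Pi.single (e i) 1))) = _
    have h2 : φ.symm (Pi.single (e i) 1) = ((δ i)⁻¹ : kˣ) • (Pi.single i 1 : ι → k) := by
      rw [LinearEquiv.symm_apply_eq, Units.smul_def, map_smul, hφ, smul_smul]
      simp
    rw [h2, Units.smul_def, map_smul, map_smul, h1, hφ, map_smul, smul_smul]
    simp
  have htheta : ∀ s c, Φ.toMonoidHom (thetaLin s c) = thetaLin (e s) c := by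
    intro s c
    refine hΦ _ _ fun i => ?_
    rw [hφ, map_smul, thetaLin_single, thetaLin_single]
    by_cases h : i = s
    · subst h
      simp only [if_true, map_smul, hφ, smul_smul, mul_comm]
    · rw [if_neg h, if_neg (fun h' => h (e.injective h')), hφ]
  have htau : ∀ s t c, s ≠ t →
      Φ.toMonoidHom (tauLin s t c) = tauLin (e s) (e t) (c * δ t * (δ s)⁻¹) := by
    intro s t c hst
    refine hΦ _ _ fun i => ?_
    have hst' : e s ≠ e t := fun h => hst (e.injective h)
    rw [hφ, map_smul, tauLin_single hst, tauLin_single hst']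
    by_cases hs : i = s
    · subst hs
      simp only [if_true, map_smul, hφ, smul_smul]
      congr 1
      push_cast
      field_simp
    · by_cases ht : i = t
      · subst ht
        simp only [if_neg hst.symm, if_neg hst'.symm, if_true, map_smul, hφ, smul_smul]
        congr 1
        push_cast
        field_simp
      · rw [if_neg hs, if_neg ht, if_neg (fun h' => hs (e.injective h')),
          if_neg (fun h' => ht (e.injective h')), hφ]
  let S' := Φ.toMonoidHom '' S
  have hmap : (Subgroup.closure S).map Φ.toMonoidHom = Subgroup.closure S' :=
    MonoidHom.map_closure _ _
  let eS : Subgroup.closure S ≃* Subgroup.closure S' :=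
    (Φ.subgroupMap (Subgroup.closure S)).trans (MulEquiv.subgroupCongr hmap)
  have hfin : Finite (Subgroup.closure S') := Finite.of_equiv _ eS.toEquiv
  have hnt : Nontrivial (Fin (Nat.card ι)) := e.symm.nontrivial
  have hS' : ∀ g ∈ S', (∃ s c, g = thetaLin s c) ∨ ∃ s t c, s ≠ t ∧ g = tauLin s t c := by
    rintro _ ⟨g, hg, rfl⟩
    rcases hS g hg with ⟨s, c, rfl⟩ | ⟨s, t, c, hst, rfl⟩
    · exact Or.inl ⟨_, _, htheta s c⟩
    · exact Or.inr ⟨_, _, _, fun h => hst (e.injective h), htau s t c hst⟩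
  have hbase : ∀ t, e s₀ ≠ t → tauLin (e s₀) t (1 : kˣ) ∈ Subgroup.closure S' := by
    intro t ht
    obtain ⟨t, rfl⟩ := e.surjective t
    have ht' : s₀ ≠ t := fun h => ht (h ▸ rfl)
    have h := Subgroup.mem_map_of_mem Φ.toMonoidHom (hc₀ t ht')
    rw [hmap, htau _ _ _ ht'] at h
    simpa [δ, ht'.symm] using h
  have hbase' : ∀ t, e s₀ ≠ t → tauLin t (e s₀) (1 : kˣ) ∈ Subgroup.closure S' := fun t ht =>
    tauLin_swap_mem ht (hbase t ht) (hbase t ht)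
  have h1 : ∀ s t, s ≠ t → tauLin s t (1 : kˣ) ∈ Subgroup.closure S' := by
    intro s t hst
    by_cases hs : e s₀ = s
    · exact hs ▸ hbase t (hs ▸ hst)
    by_cases ht : e s₀ = t
    · exact ht ▸ hbase' s hs
    have := tauLin_trans (Ne.symm hs) ht hst (1 : kˣ) 1
    rw [mul_one] at this
    rw [← this]
    exact mul_mem (mul_mem (hbase t ht) (hbase' s hs)) (inv_mem (hbase t ht))
  obtain ⟨α, β, hα, hβ, hαβ, h2, heq⟩ := exists_eq_mysticLin S' hS' h1
  refine ⟨Nat.card ι, α, β, ⟨?_, hα, hβ, hαβ, h2⟩, ⟨eS.trans (MulEquiv.subgroupCongr heq)⟩⟩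
  exact Finite.one_lt_card

end Mystic

namespace SkewPoly

variable {k : Type*} [Field k] {n : ℕ}

theorem theta_x (s : Fin n) (c : kˣ) (i : Fin n) :
    theta s c (x (minusOne k n) i) =
      if i = s then (c : k) • x (minusOne k n) s else x (minusOne k n) i := thetaHom_x s c i

theorem tau_x (s t : Fin n) (hst : s ≠ t) (c : kˣ) (i : Fin n) :
    tau s t hst c (x (minusOne k n) i) =
      if i = s then (c : k) • x (minusOne k n) t
      else if i = t then -((c⁻¹ : kˣ) : k) • x (minusOne k n) s else x (minusOne k n) i :=
  tauHom_x s t hst c i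

theorem mem_gradedAut_of_linear {p : Fin n → Fin n → kˣ} (g : SkewPoly p ≃ₐ[k] SkewPoly p)
    (f : (Fin n → k) ≃ₗ[k] (Fin n → k)) (h : ∀ i, g (x p i) = linForm p (f (Pi.single i 1))) :
    g ∈ gradedAut p := by
  apply mem_gradedAut_of_map_span
  have h' : g.toLinearMap ∘ₗ linForm p = linForm p ∘ₗ f.toLinearMap := by
    refine LinearMap.pi_ext' fun i => LinearMap.ext_ring ?_
    change g (linForm p (Pi.single i 1)) = linForm p (f (Pi.single i 1))
    rw [linForm_single, one_smul, h]
  rw [← range_linForm, ← LinearMap.range_comp, h', LinearMap.range_comp, LinearEquiv.range,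
    Submodule.map_top]

theorem act_eq_of_linear {p : Fin n → Fin n → kˣ} (g : gradedAut p)
    (f : (Fin n → k) ≃ₗ[k] (Fin n → k)) (h : ∀ i, g.1 (x p i) = linForm p (f (Pi.single i 1))) :
    act p g = f :=
  linearEquiv_ext_single fun i => linForm_injective p ((gradedAut_x g i).symm.trans (h i))

theorem theta_x_eq_linForm (s : Fin n) (c : kˣ) (i : Fin n) :
    theta s c (x (minusOne k n) i) = linForm (minusOne k n) (thetaLin s c (Pi.single i 1)) := by
  rw [theta_x, thetaLin_single]
  split_ifs <;> simp

theorem tau_x_eq_linForm (s t : Fin n) (hst : s ≠ t) (c : kˣ) (i : Fin n) :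
    tau s t hst c (x (minusOne k n) i) =
      linForm (minusOne k n) (tauLin s t c (Pi.single i 1)) := by
  rw [tau_x, tauLin_single hst]
  split_ifs <;> simp

/-- The group of automorphisms `M(n, α, β)` acts faithfully on the linear forms. -/
theorem nonempty_mysticGroup_mulEquiv (k : Type*) [Field k] (n α β : ℕ) :
    Nonempty (mysticGroup k n α β ≃* mysticLin k (Fin n) α β) := by
  let S : Set (gradedAut (minusOne k n)) :=
    {g | (∃ (i : Fin n) (c : kˣ), c ^ α = 1 ∧ g.1 = theta i c) ∨
      ∃ (i j : Fin n) (h : i ≠ j) (c : kˣ), c ^ β = 1 ∧ g.1 = tau i j h c}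
  have h1 : (Subgroup.closure S).map (gradedAut (minusOne k n)).subtype = mysticGroup k n α β := by
    rw [MonoidHom.map_closure, mysticGroup]
    congr 1
    ext g
    constructor
    · rintro ⟨g, hg | hg, rfl⟩
      · exact Or.inl hg
      · exact Or.inr hg
    · rintro (⟨i, c, hc, rfl⟩ | ⟨i, j, h, c, hc, rfl⟩)
      · exact ⟨⟨_, mem_gradedAut_of_linear _ _ (theta_x_eq_linForm i c)⟩,
          Or.inl ⟨i, c, hc, rfl⟩, rfl⟩
      · exact ⟨⟨_, mem_gradedAut_of_linear _ _ (tau_x_eq_linForm i j h c)⟩,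
          Or.inr ⟨i, j, h, c, hc, rfl⟩, rfl⟩
  have h2 : (Subgroup.closure S).map (act (minusOne k n)) = mysticLin k (Fin n) α β := by
    rw [MonoidHom.map_closure, mysticLin]
    congr 1
    ext f
    constructor
    · rintro ⟨g, ⟨i, c, hc, hg⟩ | ⟨i, j, h, c, hc, hg⟩, rfl⟩
      · exact Or.inl ⟨i, c, hc, act_eq_of_linear _ _ fun l => by rw [hg, theta_x_eq_linForm]⟩
      · exact Or.inr ⟨i, j, h, c, hc, act_eq_of_linear _ _ fun l => by rw [hg, tau_x_eq_linForm]⟩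
    · rintro (⟨i, c, hc, rfl⟩ | ⟨i, j, h, c, hc, rfl⟩)
      · exact ⟨⟨_, mem_gradedAut_of_linear _ _ (theta_x_eq_linForm i c)⟩,
          Or.inl ⟨i, c, hc, rfl⟩, act_eq_of_linear _ _ (theta_x_eq_linForm i c)⟩
      · exact ⟨⟨_, mem_gradedAut_of_linear _ _ (tau_x_eq_linForm i j h c)⟩,
          Or.inr ⟨i, j, h, c, hc, rfl⟩, act_eq_of_linear _ _ (tau_x_eq_linForm i j h c)⟩
  rw [← h1, ← h2]
  exact ⟨(Subgroup.equivMapOfInjective _ _ (Subgroup.subtype_injective _)).symm.trans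
    (Subgroup.equivMapOfInjective _ _ (act_injective _))⟩

end SkewPoly

/-! ### The decomposition of a group generated by quasi-reflections -/

section Blocks

variable {k ι J : Type*} [Field k] (f : ι → J) [DecidableEq J]

theorem mulSingle_blockHom_inj {j : J}
    {γ δ : ({i // f i = j} → k) ≃ₗ[k] ({i // f i = j} → k)}
    (h : blockHom f (Pi.mulSingle j γ) = blockHom f (Pi.mulSingle j δ)) : γ = δ :=
  Pi.mulSingle_injective (M := fun j => ({i // f i = j} → k) ≃ₗ[k] ({i // f i = j} → k)) j
    (blockHom_injective f h)

variable [DecidableEq ι]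

theorem thetaLin_apply (s : ι) (c : kˣ) (v : ι → k) (u : ι) :
    thetaLin s c v u = if u = s then c * v s else v u := by
  rw [thetaLin, monomialMap_apply]
  change ((Function.update 1 s c : ι → kˣ) u : k) * v u = _
  by_cases h : u = s
  · subst h
    simp
  · simp [h]

theorem tauLin_apply {s t : ι} (hst : s ≠ t) (c : kˣ) (v : ι → k) (u : ι) :
    tauLin s t c v u =
      if u = t then c * v s else if u = s then -((c⁻¹ : kˣ) : k) * v t else v u := by
  rw [tauLin, monomialMap_apply, Equiv.symm_swap]
  by_cases ht : u = t
  · subst ht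
    simp
  · by_cases hs : u = s
    · subst hs
      simp [ht, hst.symm]
    · rw [Equiv.swap_apply_of_ne_of_ne hs ht]
      simp [hs, ht]

theorem blockHom_mulSingle_thetaLin {j : J} (s : {i // f i = j}) (c : kˣ) :
    blockHom f (Pi.mulSingle j (thetaLin s c)) = thetaLin (s : ι) c := by
  refine LinearEquiv.ext fun v => funext fun u => ?_
  rw [thetaLin_apply]
  by_cases hu : f u = j
  · refine (blockHom_mulSingle_same f j _ v ⟨u, hu⟩).trans ?_
    rw [thetaLin_apply]
    simp only [Subtype.ext_iff]
  · rw [blockHom_mulSingle_of_ne f _ v hu, if_neg]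
    rintro rfl
    exact hu s.2

theorem blockHom_mulSingle_tauLin {j : J} {s t : {i // f i = j}} (hst : s ≠ t) (c : kˣ) :
    blockHom f (Pi.mulSingle j (tauLin s t c)) = tauLin (s : ι) t c := by
  refine LinearEquiv.ext fun v => funext fun u => ?_
  rw [tauLin_apply (fun h => hst (Subtype.ext h))]
  by_cases hu : f u = j
  · refine (blockHom_mulSingle_same f j _ v ⟨u, hu⟩).trans ?_
    rw [tauLin_apply hst]
    simp only [Subtype.ext_iff]
  · rw [blockHom_mulSingle_of_ne f _ v hu, if_neg, if_neg]
    · rintro rfl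
      exact hu s.2
    · rintro rfl
      exact hu t.2

end Blocks

namespace SkewPoly

variable {k : Type*} [Field k] {n : ℕ} {p : Fin n → Fin n → kˣ}

/-- The formula of a block reflection on basis vectors, extended to all vectors. -/
theorem IsBlockReflection.apply {f : (Fin n → k) ≃ₗ[k] (Fin n → k)} {φ v : Fin n → k}
    (hf : ∀ i, f (Pi.single i 1) = Pi.single i 1 + φ i • v) (w : Fin n → k) :
    f w = w + (∑ i, w i * φ i) • v := by
  conv_lhs => rw [pi_eq_sum_univ' w, map_sum]
  simp only [map_smul, hf, smul_add, Finset.sum_add_distrib, smul_smul, ← Finset.sum_smul]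
  rw [← pi_eq_sum_univ' w]

variable [CharZero k]

/-- The variables `x_s` and `x_t` anticommute, and a mystic reflection in the group `Γ` interchanges
them up to scalars. -/
def MysticPair (p : Fin n → Fin n → kˣ) (Γ : Subgroup ((Fin n → k) ≃ₗ[k] (Fin n → k)))
    (s t : Fin n) : Prop :=
  commParam p s t = -1 ∧ ∃ c : kˣ, tauLin s t c ∈ Γ

variable {Γ : Subgroup ((Fin n → k) ≃ₗ[k] (Fin n → k))} {s t u : Fin n}

theorem MysticPair.neg_one_ne_one : (-1 : kˣ) ≠ 1 := by
  intro h
  have h2 := congrArg Units.val h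
  rw [Units.val_neg, Units.val_one] at h2
  exact two_ne_zero (by linear_combination -h2 : (2 : k) = 0)

theorem MysticPair.ne (h : MysticPair p Γ s t) : s ≠ t := by
  rintro rfl
  have := h.1
  rw [commParam_self] at this
  exact MysticPair.neg_one_ne_one this.symm

theorem MysticPair.symm (h : MysticPair p Γ s t) : MysticPair p Γ t s := by
  obtain ⟨c, hc⟩ := h.2
  refine ⟨?_, -c⁻¹, ?_⟩
  · rw [commParam_symm, h.1, inv_neg, inv_one]
  · rwa [← tauLin_symm h.ne]

/-- A mystic pair has the same commutation scalars with the other indices. -/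
theorem MysticPair.commParam_eq (hΓ : Γ ≤ (act p).range) (h : MysticPair p Γ s t) (hus : u ≠ s)
    (hut : u ≠ t) : commParam p t u = commParam p s u := by
  obtain ⟨c, hc⟩ := h.2
  obtain ⟨g, hg⟩ := hΓ hc
  refine commParam_eq_of_act_ne_zero g ?_ ?_
  · rw [hg, tauLin_single h.ne, if_pos rfl]
    simp
  · rw [hg, tauLin_single h.ne, if_neg hus, if_neg hut]
    simp

/-- The block of an index in a mystic pair has no other elements. -/
theorem MysticPair.eq_of_blockSetoid (hΓ : Γ ≤ (act p).range) (h : MysticPair p Γ s t)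
    (hu : blockSetoid p s u) : u = s := by
  by_contra hus
  have hut : u ≠ t := by
    rintro rfl
    have h1 := hu u
    rw [h.1, commParam_self] at h1
    exact MysticPair.neg_one_ne_one h1
  have h1 := h.commParam_eq hΓ hus hut
  have h2 := hu s
  have h3 := hu t
  rw [commParam_self] at h2
  rw [h.1] at h3
  rw [commParam_symm p u t, ← h3, commParam_symm p u s, ← h2, inv_neg, inv_one] at h1
  exact MysticPair.neg_one_ne_one h1

/-- The conjugate of a mystic reflection by another one is again a mystic reflection. -/
theorem MysticPair.trans (hΓ : Γ ≤ (act p).range) (h : MysticPair p Γ s t)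
    (h' : MysticPair p Γ t u) (hsu : s ≠ u) : MysticPair p Γ s u := by
  obtain ⟨c, hc⟩ := h.2
  obtain ⟨d, hd⟩ := h'.2
  refine ⟨?_, c * d, ?_⟩
  · rw [← h.commParam_eq hΓ hsu.symm h'.ne.symm, h'.1]
  · rw [← tauLin_trans h.ne h'.ne hsu]
    exact Γ.mul_mem (Γ.mul_mem hd hc) (Γ.inv_mem hd)

/-- The equivalence relation along which the group splits: indices in the same block, or joined by a
mystic reflection. -/
def componentSetoid (hΓ : Γ ≤ (act p).range) : Setoid (Fin n) where
  r i j := blockSetoid p i j ∨ MysticPair p Γ i j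
  iseqv := by
    refine ⟨fun i => Or.inl ((blockSetoid p).refl i), ?_, ?_⟩
    · rintro i j (h | h)
      · exact Or.inl ((blockSetoid p).symm h)
      · exact Or.inr h.symm
    · rintro i j l (h | h) (h' | h')
      · exact Or.inl ((blockSetoid p).trans h h')
      · obtain rfl := h'.eq_of_blockSetoid hΓ ((blockSetoid p).symm h)
        exact Or.inr h'
      · obtain rfl := h.symm.eq_of_blockSetoid hΓ h'
        exact Or.inr h
      · by_cases hil : i = l
        · subst hil
          exact Or.inl ((blockSetoid p).refl i)
        · exact Or.inr (h.trans hΓ h' hil)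

variable {S : Set ((Fin n → k) ≃ₗ[k] (Fin n → k))}

/-- The set `S` consists of reflections of one block and mystic reflections, induced by
automorphisms of the skew polynomial ring. -/
structure IsReflectionSet (p : Fin n → Fin n → kˣ) (S : Set ((Fin n → k) ≃ₗ[k] (Fin n → k))) :
    Prop where
  le_range : Subgroup.closure S ≤ (act p).range
  cases : ∀ g ∈ S, (∃ B, IsBlockReflection p g B) ∨
    ∃ (s t : Fin n) (c : kˣ), MysticPair p (Subgroup.closure S) s t ∧ g = tauLin s t c

namespace IsReflectionSet

/-- The component of an index. -/
def comp (hS : IsReflectionSet p S) (i : Fin n) : Quotient (componentSetoid hS.le_range) := ⟦i⟧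

theorem comp_eq (hS : IsReflectionSet p S) {i j : Fin n} :
    hS.comp i = hS.comp j ↔ blockSetoid p i j ∨ MysticPair p (Subgroup.closure S) i j :=
  Quotient.eq

open Classical in
/-- Each generator acts on the variables of a single component. -/
theorem exists_eq_blockHom (hS : IsReflectionSet p S) :
    ∀ g ∈ S, ∃ j γ, g = blockHom hS.comp (Pi.mulSingle j γ) := by
  intro g hg
  rcases hS.cases g hg with ⟨B, φ, v, hφ, hv, hgφ⟩ | ⟨s, t, c, hst, rfl⟩
  · have hB : ∀ i, (⟦i⟧ : Quotient (blockSetoid p)) = B → hS.comp i = hS.comp B.out := by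
      intro i hi
      rw [comp_eq]
      refine Or.inl (Quotient.exact ?_)
      rw [hi, Quotient.out_eq]
    refine ⟨hS.comp B.out, exists_eq_blockHom_mulSingle _ _ g (fun i hi => ?_)
      fun i u hi hu => ?_⟩
    · have : φ i = 0 := by
        by_contra h
        exact hi (hB i (hφ i h))
      rw [hgφ, this, zero_smul, add_zero]
    · have : v u = 0 := by
        by_contra h
        exact hu (hB u (hv u h))
      have hui : u ≠ i := by
        rintro rfl
        exact hu hi
      rw [hgφ, Pi.add_apply, Pi.smul_apply, this, smul_zero, add_zero, Pi.single_eq_of_ne hui]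
  · have hts : hS.comp t = hS.comp s := hS.comp_eq.2 (Or.inr hst.symm)
    refine ⟨hS.comp s, _, (blockHom_mulSingle_tauLin hS.comp (s := ⟨s, rfl⟩) (t := ⟨t, hts⟩)
      (fun h => hst.ne (congrArg Subtype.val h)) c).symm⟩

/-- A component is mystic if it contains a mystic pair. -/
def IsMystic (hS : IsReflectionSet p S) (j : Quotient (componentSetoid hS.le_range)) : Prop :=
  ∃ s t, hS.comp s = j ∧ hS.comp t = j ∧ MysticPair p (Subgroup.closure S) s t

open Classical in
theorem comp_eq_of_tauLin (hS : IsReflectionSet p S)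
    {j : Quotient (componentSetoid hS.le_range)}
    {γ : ({i // hS.comp i = j} → k) ≃ₗ[k] ({i // hS.comp i = j} → k)} {s t : Fin n}
    (hst : s ≠ t) {c : kˣ} (h : blockHom hS.comp (Pi.mulSingle j γ) = tauLin s t c) :
    hS.comp s = j := by
  by_contra hs
  have := blockHom_mulSingle_of_ne hS.comp γ (Pi.single s 1) hs
  rw [h, tauLin_single hst, if_pos rfl] at this
  simp [hst] at this

open Classical in
/-- The restriction to a component of a block reflection is a rank one change of the identity. -/
theorem block_apply (hS : IsReflectionSet p S) {j : Quotient (componentSetoid hS.le_range)}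
    {γ : ({i // hS.comp i = j} → k) ≃ₗ[k] ({i // hS.comp i = j} → k)}
    {g : (Fin n → k) ≃ₗ[k] (Fin n → k)} {φ v : Fin n → k}
    (hg : ∀ i, g (Pi.single i 1) = Pi.single i 1 + φ i • v)
    (h : blockHom hS.comp (Pi.mulSingle j γ) = g) (w : {i // hS.comp i = j} → k) :
    γ w = w + (∑ i, extendZero hS.comp j w i * φ i) • fun q : {i // hS.comp i = j} => v q := by
  funext q
  have h1 := blockHom_mulSingle_same hS.comp j γ (extendZero hS.comp j w) q
  rw [extendZero_coe] at h1
  rw [← h1, h, IsBlockReflection.apply hg]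
  have h2 := congrFun (extendZero_coe hS.comp j w) q
  change _ = w q + _
  rw [← h2]
  rfl

/-- Every index of a mystic component belongs to a mystic pair. -/
theorem IsMystic.exists_pair {hS : IsReflectionSet p S}
    {j : Quotient (componentSetoid hS.le_range)} (hj : hS.IsMystic j) {q : Fin n}
    (hq : hS.comp q = j) : ∃ r, MysticPair p (Subgroup.closure S) q r := by
  obtain ⟨s, t, hs, -, hst⟩ := hj
  rcases hS.comp_eq.1 (hq.trans hs.symm) with h | h
  · obtain rfl := hst.eq_of_blockSetoid hS.le_range ((blockSetoid p).symm h)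
    exact ⟨t, hst⟩
  · exact ⟨s, h⟩

variable [Finite (Subgroup.closure S)]

open Classical in
/-- A component without mystic pairs is a single block, and its group is a classical reflection
group. -/
theorem exists_classical (hS : IsReflectionSet p S)
    {j : Quotient (componentSetoid hS.le_range)} (hj : ¬ hS.IsMystic j) :
    ∃ (m : ℕ) (R : Subgroup ((Fin m → k) ≃ₗ[k] (Fin m → k))), IsClassicalReflectionGroup R ∧
      Nonempty (blockSubgroup hS.comp S j ≃* R) := by
  have := finite_blockSubgroup hS.comp S j
  have : Finite (Subgroup.closure {γ | blockHom hS.comp (Pi.mulSingle j γ) ∈ S}) := this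
  refine exists_isClassicalReflectionGroup {γ | blockHom hS.comp (Pi.mulSingle j γ) ∈ S}
    fun γ hγ => ?_
  rcases hS.cases _ hγ with ⟨B, φ, v, hφ, hv, hg⟩ | ⟨s, t, c, hst, hg⟩
  · have hlin : IsLinearMap k fun w : {i // hS.comp i = j} → k =>
        ∑ i, extendZero hS.comp j w i * φ i := by
      constructor
      · intro w w'
        rw [← Finset.sum_add_distrib]
        refine Finset.sum_congr rfl fun i _ => ?_
        by_cases h : hS.comp i = j <;> simp [extendZero, h, add_mul]
      · intro a w
        rw [Finset.smul_sum]
        refine Finset.sum_congr rfl fun i _ => ?_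
        by_cases h : hS.comp i = j <;> simp [extendZero, h, mul_assoc]
    exact ⟨hlin.mk' _, _, hS.block_apply hg rfl⟩
  · have hs := hS.comp_eq_of_tauLin hst.ne hg
    exact absurd ⟨s, t, hs, (hS.comp_eq.2 (Or.inr hst.symm)).trans hs, hst⟩ hj

open Classical in
/-- A component with a mystic pair gives one of the groups `M(N, α, β)`. -/
theorem exists_mystic (hS : IsReflectionSet p S)
    {j : Quotient (componentSetoid hS.le_range)} (hj : hS.IsMystic j) :
    ∃ N α β : ℕ, (2 ≤ N ∧ 0 < α ∧ 0 < β ∧ α ∣ β ∧ 2 ∣ β) ∧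
      Nonempty (blockSubgroup hS.comp S j ≃* mysticGroup k N α β) := by
  have := finite_blockSubgroup hS.comp S j
  have : Finite (Subgroup.closure {γ | blockHom hS.comp (Pi.mulSingle j γ) ∈ S}) := this
  obtain ⟨s₀, t₀, hs₀, ht₀, hst₀⟩ := id hj
  have : Nontrivial {i // hS.comp i = j} :=
    ⟨⟨s₀, hs₀⟩, ⟨t₀, ht₀⟩, fun h => hst₀.ne (congrArg Subtype.val h)⟩
  suffices h : _ ∧ _ by
    obtain ⟨N, α, β, hN, ⟨e⟩⟩ := exists_mulEquiv_mysticLin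
      {γ | blockHom hS.comp (Pi.mulSingle j γ) ∈ S} h.1 h.2
    obtain ⟨e'⟩ := nonempty_mysticGroup_mulEquiv k N α β
    exact ⟨N, α, β, hN, ⟨e.trans e'.symm⟩⟩
  refine ⟨fun γ hγ => ?_, fun s t hst => ?_⟩
  · rcases hS.cases _ hγ with ⟨B, φ, v, hφ, hv, hg⟩ | ⟨s, t, c, hst, hg⟩
    · left
      by_cases hB : ∃ q : {i // hS.comp i = j}, (⟦q⟧ : Quotient (blockSetoid p)) = B
      · obtain ⟨q, hq⟩ := hB
        have huniq : ∀ i : Fin n, (⟦i⟧ : Quotient (blockSetoid p)) = B → i = q := by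
          intro i hi
          obtain ⟨r, hr⟩ := hj.exists_pair q.2
          exact hr.eq_of_blockSetoid hS.le_range (Quotient.exact (hq.trans hi.symm))
        -- the block is a singleton, so that the block reflection is diagonal
        have hc0 : 1 + φ q * v q ≠ 0 := by
          intro h0
          have h1 : (blockHom hS.comp (Pi.mulSingle j γ)) (Pi.single (q : Fin n) 1) = 0 := by
            rw [hg]
            funext u
            by_cases hu : u = q
            · subst hu
              simpa using h0
            · have : v u = 0 := by
                by_contra h
                exact hu (huniq u (hv u h))
              simp [hu, this]
          rw [LinearEquiv.map_eq_zero_iff] at h1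
          simp at h1
        refine ⟨q, Units.mk0 _ hc0, mulSingle_blockHom_inj hS.comp ?_⟩
        rw [blockHom_mulSingle_thetaLin]
        refine linearEquiv_ext_single fun i => ?_
        rw [hg, thetaLin_single]
        by_cases hi : i = q
        · rw [if_pos hi, hi]
          funext u
          by_cases hu : u = q
          · subst hu
            simp
          · have : v u = 0 := by
              by_contra h
              exact hu (huniq u (hv u h))
            simp [hu, this]
        · have : φ i = 0 := by
            by_contra h
            exact hi (huniq i (hφ i h))
          rw [if_neg hi, this, zero_smul, add_zero]
      -- a block reflection of another component acts trivially, as `θ_{s,1}` does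
      · push Not at hB
        refine ⟨⟨s₀, hs₀⟩, 1, ?_⟩
        rw [thetaLin_one]
        refine LinearEquiv.ext fun w => ?_
        rw [hS.block_apply hg rfl w]
        have : (fun q : {i // hS.comp i = j} => v q) = 0 := by
          funext q
          by_contra h
          exact hB q (hv q h)
        rw [this, smul_zero, add_zero]
        rfl
    · right
      have hs := hS.comp_eq_of_tauLin hst.ne hg
      have ht := (hS.comp_eq.2 (Or.inr hst.symm)).trans hs
      have hst' : (⟨s, hs⟩ : {i // hS.comp i = j}) ≠ ⟨t, ht⟩ :=
        fun h => hst.ne (congrArg Subtype.val h)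
      refine ⟨⟨s, hs⟩, ⟨t, ht⟩, c, hst', mulSingle_blockHom_inj hS.comp ?_⟩
      rw [hg, blockHom_mulSingle_tauLin hS.comp hst']
  · obtain ⟨c, hc⟩ : ∃ c : kˣ, tauLin (s : Fin n) t c ∈ Subgroup.closure S := by
      rcases hS.comp_eq.1 (s.2.trans t.2.symm) with h | h
      · obtain ⟨r, hr⟩ := hj.exists_pair s.2
        exact absurd (Subtype.ext (hr.eq_of_blockSetoid hS.le_range h).symm) hst
      · exact h.2
    refine ⟨c, mem_blockSubgroup_of_mem hS.comp hS.exists_eq_blockHom ?_⟩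
    rwa [blockHom_mulSingle_tauLin hS.comp hst]

end IsReflectionSet

end SkewPoly

/-- A product over an index type, split along a predicate. -/
def mulEquivPiSubtypeProd {J : Type*} (P : J → Prop) [DecidablePred P] (H : J → Type*)
    [∀ j, Group (H j)] :
    (∀ j, H j) ≃* (∀ j : {j // P j}, H j) × (∀ j : {j // ¬ P j}, H j) :=
  { Equiv.piEquivPiSubtypeProd P H with map_mul' := fun _ _ => rfl }

/-- Reindexing a product of groups along a bijection. -/
def mulEquivPiReindex {I J : Type*} (e : I ≃ J) (H : J → Type*) [∀ j, Group (H j)] :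
    (∀ j, H j) ≃* ∀ i, H (e i) :=
  { (Equiv.piCongrLeft H e).symm with map_mul' := fun _ _ => rfl }

theorem corollary4p6 {k : Type*} [Field k] [CharZero k] (n : ℕ) (hn : 1 ≤ n)
    (p : Fin n → Fin n → kˣ) (G : Subgroup (SkewPoly.gradedAut p)) [Finite G]
    (hG : Subgroup.closure {g | g ∈ G ∧ SkewPoly.IsQuasiReflection g} = G) :
    ∃ (a b : ℕ) (m : Fin a → ℕ)
      (R : ∀ u : Fin a, Subgroup ((Fin (m u) → k) ≃ₗ[k] (Fin (m u) → k)))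
      (N α β : Fin b → ℕ),
      (∀ u, IsClassicalReflectionGroup (R u)) ∧
      (∀ v, 2 ≤ N v ∧ 0 < α v ∧ 0 < β v ∧ α v ∣ β v ∧ 2 ∣ β v) ∧
      Nonempty (G ≃* ((∀ u, R u) × (∀ v, SkewPoly.mysticGroup k (N v) (α v) (β v)))) := by
  classical
  set S := SkewPoly.act p '' {g | g ∈ G ∧ SkewPoly.IsQuasiReflection g} with hSdef
  have hmap : G.map (SkewPoly.act p) = Subgroup.closure S := by
    conv_lhs => rw [← hG]
    exact MonoidHom.map_closure _ _
  let eG : G ≃* Subgroup.closure S :=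
    (Subgroup.equivMapOfInjective G _ (SkewPoly.act_injective p)).trans
      (MulEquiv.subgroupCongr hmap)
  have hfin : Finite (Subgroup.closure S) := Finite.of_equiv _ eG.toEquiv
  have hS : SkewPoly.IsReflectionSet p S := by
    refine ⟨?_, ?_⟩
    · rw [← hmap]
      exact Subgroup.map_le_range _ _
    · rintro _ ⟨g, ⟨hgG, hg⟩, rfl⟩
      have hpow : g ^ orderOf (⟨g, hgG⟩ : G) = 1 :=
        congrArg Subtype.val (pow_orderOf_eq_one (⟨g, hgG⟩ : G))
      rcases hg.cases hn (orderOf_pos (⟨g, hgG⟩ : G)) hpow with h | ⟨s, t, c, -, hst, h⟩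
      · exact Or.inl h
      · exact Or.inr ⟨s, t, c, ⟨hst, c, h ▸ Subgroup.subset_closure ⟨g, ⟨hgG, hg⟩, rfl⟩⟩, h⟩
  obtain ⟨ePi⟩ := nonempty_closure_mulEquiv_pi hS.comp hS.exists_eq_blockHom
  let eProd := mulEquivPiSubtypeProd (fun j => ¬ hS.IsMystic j)
    fun j => blockSubgroup hS.comp S j
  have hclass := fun j : {j // ¬ hS.IsMystic j} => hS.exists_classical j.2
  have hmyst := fun j : {j // ¬ ¬ hS.IsMystic j} => hS.exists_mystic (not_not.1 j.2)
  choose m R hR eR using hclass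
  choose N α β hN eN using hmyst
  let eA := (Finite.equivFin {j // ¬ hS.IsMystic j}).symm
  let eB := (Finite.equivFin {j // ¬ ¬ hS.IsMystic j}).symm
  let e₁ := MulEquiv.piCongrRight fun j => (eR j).some
  let e₂ := MulEquiv.piCongrRight fun j => (eN j).some
  exact ⟨_, _, fun u => m (eA u), fun u => R (eA u), fun v => N (eB v), fun v => α (eB v),
    fun v => β (eB v), fun u => hR _, fun v => hN _,
    ⟨(eG.trans ePi).trans (eProd.trans ((e₁.prodCongr e₂).trans
      ((mulEquivPiReindex eA fun j => R j).prodCongr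
        (mulEquivPiReindex eB fun j => SkewPoly.mysticGroup k (N j) (α j) (β j)))))⟩⟩
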